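/- **Model.** Inputs are sequences $X\in\mathbb R^{\tau\times d}$ of $\tau\ge 1$ row vectors (tokens), $d\ge1$; $\|X\|_{2,\infty}$ is the largest Euclidean norm of a row. Layer $i$ has weights $W_Q^{(i)},W_K^{(i)},W_V^{(i)}\in\mathbb R^{d\times k}$, $W_C^{(i)}\in\mathbb R^{k\times d}$. Let $\mathrm{Attn}^{(i)}(Z)=\mathrm{Softmax}\big(ZW_Q^{(i)}(ZW_K^{(i)})^\top\big)ZW_V^{(i)}$ (row-wise softmax), let $\Pi_{\rm norm}$ project every row onto the closed Euclidean unit ball, and let the activation $\sigma:\mathbb R^k\to\mathbb R^k$, applied to every row, be $L_\sigma$-Lipschitz in the $\ell_2$ norm with $\sigma(0)=0$. Put $g^{(1)}(X)=X$, $g^{(i+1)}(X)=\Pi_{\rm norm}\big(\sigma(\Pi_{\rm norm}(\mathrm{Attn}^{(i)}(g^{(i)}(X))))W_C^{(i)}\big)$ for $1\le i\le L$, $L\ge1$, and $f_{\rm vlm}(X;\theta)=w^\top[g^{(L+1)}(X)]_\tau$ (last row), where $\theta$ consists of all the $W^{(i)}$ and of $w\in\mathbb R^d$. For $C_2,C_{2,1},B_w\ge0$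 let $\Theta$ be the set of all $\theta$ such that $\|W_V^{(i)}\|_2,\|W_K^{(i)}W_Q^{(i)\top}\|_2,\|W_C^{(i)}\|_2\le C_2$ (spectral norm) and $\|W_V^{(i)}\|_{2,1},\|W_K^{(i)}W_Q^{(i)\top}\|_{2,1},\|W_C^{(i)}\|_{2,1}\le C_{2,1}$ (sum of the Euclidean norms of the columns) for all $i$, and $\|w\|_2\le B_w$. **Data and training.** Let $l:\mathbb R\times\mathbb R\to\mathbb R$ satisfy $|l|\le b$ and be $L_{\rm loss}$-Lipschitz in each argument. Let $\mathcal D^{\rm txt},\mathcal D^{\rm mul}$ be probability distributions on $\mathbb R^{\tau\times d}$ under which $\|X\|_{2,\infty}\le B_X$ almost surely, and let $f_{\rm gt}^{\rm txt},f_{\rm gt}^{\rm mul}:\mathbb R^{\tau\times d}\to\mathbb R$ be measurable labelling functions. Let $X_1^{\rm txt},\dots,X_N^{\rm txt}$ be i.i.d. from $\mathcal D^{\rm txt}$ and $X_1^{\rm mul},\dots,X_M^{\rm mul}$ i.i.d. from $\mathcal D^{\rm mul}$, with $N,M\ge1$. Write $R_\bullet(\theta)=\mathbb E_{X\sim\mathcal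 D^\bullet}\,l(f_{\rm vlm}(X;\theta),f^\bullet_{\rm gt}(X))$ for $\bullet\in\{{\rm txt},{\rm mul}\}$, $\varepsilon_{\rm cross}=\sup_{\theta\in\Theta}|R_{\rm mul}(\theta)-R_{\rm txt}(\theta)|$, and let $\hat\theta_{\rm ERM}$ be any minimizer over $\Theta$ of the empirical loss $$\frac1{N+M}\Big(\sum_{i=1}^N l\big(f_{\rm vlm}(X_i^{\rm txt};\theta),f_{\rm gt}^{\rm txt}(X_i^{\rm txt})\big)+\sum_{i=1}^M l\big(f_{\rm vlm}(X_i^{\rm mul};\theta),f_{\rm gt}^{\rm mul}(X_i^{\rm mul})\big)\Big).$$ **Covering constant.** A number $C_{\rm vlm}$ is a covering constant if $\log\mathcal N_\infty\big(\{f_{\rm vlm}(\cdot;\theta):\theta\in\Theta\};\varepsilon;x_1,\dots,x_{N+M}\big)\le C_{\rm vlm}/\varepsilon^2$ for all $\varepsilon>0$ and all $x_1,\dots,x_{N+M}$ with $\|x_i\|_{2,\infty}\le B_X$; here $\mathcal N_\infty$ is the least number of functions of the class such that every function of the class is within $\varepsilon$ of one of them at all the points $x_i$. **Theorem.** There are universal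 constants $K>0$ and $c\in\mathbb N$ such that in the above setting: 1. The number $$K\,\big(\max(2,C_2)\max(1,L_\sigma)\big)^{cL}\;B_X^2\max(1,B_X)^4\,B_w^2\,C_{2,1}^2\;\log\big(\max(d,k)\,\tau\,(N+M)\big)$$ is a covering constant. 2. For every covering constant $C_{\rm vlm}$ and every $\delta\in(0,1)$, with probability at least $1-\delta$ the following two bounds hold together, for every empirical risk minimizer $\hat\theta_{\rm ERM}$: $$R_{\rm txt}(\hat\theta_{\rm ERM})\le\inf_{\theta\in\Theta}R_{\rm txt}(\theta)+K\Big(\frac{M}{N+M}\,\varepsilon_{\rm cross}+\mathrm{gen}\Big),\qquad R_{\rm mul}(\hat\theta_{\rm ERM})\le\inf_{\theta\in\Theta}R_{\rm mul}(\theta)+K\Big(\frac{N}{N+M}\,\varepsilon_{\rm cross}+\mathrm{gen}\Big),$$ where $$\mathrm{gen}=b\sqrt{\frac{\log(1/\delta)}{N+M}}+\big(1+\log(1+B_w)\big)\,L_{\rm loss}\sqrt{\frac{C_{\rm vlm}}{N+M}}\,\Big(1+\log\Big(1+\frac{N+M}{C_{\rm vlm}}\Big)\Big)$$ (the last term being $0$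 if $C_{\rm vlm}=0$). -/

import Mathlib

open MeasureTheory ProbabilityTheory
open scoped NNReal ENNReal

namespace VLM

noncomputable section

/-- A sequence of `τ` feature vectors (the rows of a `τ × d` matrix). Its norm in Lean is
`max_t ‖X t‖₂`, i.e. the `(2, ∞)`-norm, the maximal Euclidean norm of a token. -/
abbrev Tokens (τ d : ℕ) : Type := Fin τ → EuclideanSpace ℝ (Fin d)

/-- The product `z W` of a row vector with a matrix. -/
def rowMul {m n : ℕ} (z : EuclideanSpace ℝ (Fin m)) (W : Matrix (Fin m) (Fin n) ℝ) :
    EuclideanSpace ℝ (Fin n) :=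
  WithLp.toLp 2 (Matrix.vecMul z.ofLp W)

/-- The softmax of a vector. -/
def softmax {τ : ℕ} (a : Fin τ → ℝ) : Fin τ → ℝ :=
  fun s => Real.exp (a s) / ∑ r, Real.exp (a r)

/-- Normalization of one row: the Euclidean projection onto the closed unit ball. -/
def normalize {n : ℕ} (v : EuclideanSpace ℝ (Fin n)) : EuclideanSpace ℝ (Fin n) :=
  (max 1 ‖v‖)⁻¹ • v

/-- The spectral norm `‖W‖₂`. -/
def specNorm {m n : ℕ} (W : Matrix (Fin m) (Fin n) ℝ) : ℝ :=
  ‖LinearMap.toContinuousLinearMap (Matrix.toEuclideanLin W)‖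

/-- The `(2,1)`-norm: the sum of the Euclidean norms of the columns. -/
def norm21 {m n : ℕ} (W : Matrix (Fin m) (Fin n) ℝ) : ℝ :=
  ∑ j, Real.sqrt (∑ i, W i j ^ 2)

/-- The weight matrices of one transformer layer. -/
structure LayerParams (d k : ℕ) where
  WQ : Matrix (Fin d) (Fin k) ℝ
  WK : Matrix (Fin d) (Fin k) ℝ
  WV : Matrix (Fin d) (Fin k) ℝ
  WC : Matrix (Fin k) (Fin d) ℝ

/-- The parameters of an `L`-layer model: the weights of the layers and the output vector. -/
structure Params (L d k : ℕ) where
  layer : Fin L → LayerParams d k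
  w : EuclideanSpace ℝ (Fin d)

/-- The attention map `Softmax(Z W_Q (Z W_K)ᵀ) Z W_V`, row by row. -/
def attention {τ d k : ℕ} (p : LayerParams d k) (Z : Tokens τ d) : Tokens τ k :=
  fun t => ∑ s, softmax (fun r => inner ℝ (rowMul (Z t) p.WQ) (rowMul (Z r) p.WK)) s •
    rowMul (Z s) p.WV

/-- One transformer block `Π_norm(σ(Π_norm(f(Z))) W_C)`. The activation acts on rows; a scalar
activation applied entrywise is a special case. -/
def block {τ d k : ℕ} (σ : EuclideanSpace ℝ (Fin k) → EuclideanSpace ℝ (Fin k))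
    (p : LayerParams d k) (Z : Tokens τ d) : Tokens τ d :=
  fun t => normalize (rowMul (σ (normalize (attention p Z t))) p.WC)

/-- The composition of the blocks `0, …, L - 1`, block `0` being applied to the input. -/
def transformer {τ d k : ℕ} (σ : EuclideanSpace ℝ (Fin k) → EuclideanSpace ℝ (Fin k)) :
    (L : ℕ) → (Fin L → LayerParams d k) → Tokens τ d → Tokens τ d
  | 0, _, X => X
  | L + 1, W, X => block σ (W (Fin.last L)) (transformer σ L (fun i => W i.castSucc) X)

/-- The scalar output of the model: the inner product of `w` with the last row. -/
def fvlm {L τ d k : ℕ} [NeZero τ] (σ : EuclideanSpace ℝ (Fin k) → EuclideanSpace ℝ (Fin k))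
    (θ : Params L d k) (X : Tokens τ d) : ℝ :=
  inner ℝ θ.w (transformer σ L θ.layer X ⟨τ - 1, Nat.sub_lt (NeZero.pos τ) Nat.one_pos⟩)

/-- The parameter set `Θ`. -/
def paramSet (L d k : ℕ) (C₂ C₂₁ Bw : ℝ) : Set (Params L d k) :=
  {θ | (∀ i, specNorm (θ.layer i).WV ≤ C₂ ∧
      specNorm ((θ.layer i).WK * (θ.layer i).WQ.transpose) ≤ C₂ ∧
      specNorm (θ.layer i).WC ≤ C₂ ∧
      norm21 (θ.layer i).WV ≤ C₂₁ ∧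
      norm21 ((θ.layer i).WK * (θ.layer i).WQ.transpose) ≤ C₂₁ ∧
      norm21 (θ.layer i).WC ≤ C₂₁) ∧ ‖θ.w‖ ≤ Bw}

/-- `C` is a covering constant at sample size `m` of a class `F` of real functions on `B`-bounded
sequences: `log N_∞(F; ε; x₁, …, x_m) ≤ C / ε²` for all `ε > 0` and all sequences `x₁, …, x_m` of
`(2,∞)`-norm at most `B`. The space `Fin m → ℝ` carries the sup norm. -/
def IsCoveringConstant {τ d : ℕ} (F : Set (Tokens τ d → ℝ)) (B : ℝ) (m : ℕ) (C : ℝ) : Prop :=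
  ∀ ε : ℝ≥0, 0 < ε → ∀ x : Fin m → Tokens τ d, (∀ i, ‖x i‖ ≤ B) →
    Metric.coveringNumber ε {v : Fin m → ℝ | ∃ f ∈ F, v = fun i => f (x i)} ≠ ⊤ ∧
    Real.log (Metric.coveringNumber ε {v : Fin m → ℝ | ∃ f ∈ F, v = fun i => f (x i)}).toNat
      ≤ C / (ε : ℝ) ^ 2

/-- The expected loss of the predictor `f` for the distribution `D` and the labels `g`. -/
def risk {τ d : ℕ} (l : ℝ → ℝ → ℝ) (D : Measure (Tokens τ d)) (g f : Tokens τ d → ℝ) : ℝ :=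
  ∫ X, l (f X) (g X) ∂D

/-- The empirical loss of the predictor `f` on `N` text samples and `M` multi-modal samples. -/
def empRisk {τ d N M : ℕ} (l : ℝ → ℝ → ℝ) (gtxt gmul : Tokens τ d → ℝ)
    (xtxt : Fin N → Tokens τ d) (xmul : Fin M → Tokens τ d) (f : Tokens τ d → ℝ) : ℝ :=
  1 / ((N : ℝ) + M) *
    (∑ i, l (f (xtxt i)) (gtxt (xtxt i)) + ∑ i, l (f (xmul i)) (gmul (xmul i)))

end

end VLM

/-!
**Entropy of the class.** The core is the perceptron. If `‖w‖ ≤ b` and `‖x_i‖ ≤ B`, then a step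
along a point `± x_i` whose value is wrong by more than `ε` lowers the squared distance to `w` by
`ε² / B²`, so that `w` is matched on all points after `(b B / ε)²` steps
(`exists_mem_perceptronSet`). As each step is one of `2 n + 1` choices, this gives the entropy
`(b B / ε)² log (2 n + 1)` with no dependence on the dimension and no logarithm of `1 / ε`. A matrix
with bounded `(2, 1)`-norm is treated column by column, the number of steps being proportional to
the norm of the column (`hasCover_rowMul`). The blocks are Lipschitz on the unit ball, and
`HasCover.prod` composes covers: the entropies of the successive stages add up, the errors are
multiplied by the Lipschitz constants. Besides lying in the unit ball, the outputs of the blocks are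
at most a power of `max(2, C₂) max(1, Lσ)` times `B` in norm, which gives the factor `B²` also for
small `B`; the last one is at most a multiple of `C₂₁`, which makes the output vector `w` as cheap
as the layers.

**Generalization.** The losses are centred to `l(f(x), y) - l(0, y)`. Their Rademacher sums are
estimated by chaining, directly in exponential moments (`exists_chaining_bound`): above Dudley's
entropy sum, the supremum is subgaussian at the scale `r` of the class. Symmetrization of
exponential moments (`integral_expSup_le`) then gives a tail bound without a bounded-difference
inequality. All this is done for finite classes; the passage to the whole class uses a countable
subclass dense in the supremum norm on the ball.

A covering constant `C` controls the class itself: the class is symmetric, and one centre for `± f`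
is possible only if `ε ≥ |f|`, so that `log 2 · |f|² ≤ C` (`IsCoveringConstant.sq_le`). Hence
`r ≤ min(2 b, L_loss · √(C / log 2))`, the constant summand of the confidence term
`r √(log (8 / δ))` is absorbed by the entropy term, and the bound holds with `log (1 / δ)` also for
`δ` near `1`. The two samples need not be independent of each other, so that their deviations are
controlled separately and joined by a union bound.
-/

namespace VLM

/-! ### Covers of parametrized classes -/

/-- The class `{φ a : a ∈ S}` has an internal cover at scale `ε` of at most `exp H` elements. The
centres are recorded through their parameters. -/
def HasCover {α E : Type*} [PseudoMetricSpace E] (S : Set α) (φ : α → E) (ε H : ℝ) : Prop :=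
  ∃ F : Finset α, (F : Set α) ⊆ S ∧ (F.card : ℝ) ≤ Real.exp H ∧
    ∀ a ∈ S, ∃ a' ∈ F, dist (φ a) (φ a') ≤ ε

namespace HasCover

variable {α β E G : Type*} [PseudoMetricSpace E] [PseudoMetricSpace G]

/-- A cover by arbitrary centres gives an internal one at twice the scale. -/
theorem of_external {S : Set α} {φ : α → E} {ε H : ℝ} (F : Finset E)
    (hF : (F.card : ℝ) ≤ Real.exp H) (hc : ∀ a ∈ S, ∃ e ∈ F, dist (φ a) e ≤ ε) :
    HasCover S φ (2 * ε) H := by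
  classical
  rcases S.eq_empty_or_nonempty with rfl | ⟨a₀, -⟩
  · exact ⟨∅, by simp, by simpa using (Real.exp_pos H).le, by simp⟩
  have : Nonempty α := ⟨a₀⟩
  let F₀ := F.filter (fun e => ∃ a ∈ S, dist (φ a) e ≤ ε)
  have hex : ∀ e ∈ F₀, ∃ a ∈ S, dist (φ a) e ≤ ε := fun e he => (Finset.mem_filter.1 he).2
  choose! g hgS hg using hex
  refine ⟨F₀.image g, ?_, ?_, ?_⟩
  · intro a ha
    obtain ⟨e, he, rfl⟩ := Finset.mem_image.1 (Finset.mem_coe.1 ha)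
    exact hgS e he
  · refine le_trans ?_ hF
    exact_mod_cast Finset.card_image_le.trans (Finset.card_filter_le _ _)
  · intro a ha
    obtain ⟨e, he, hd⟩ := hc a ha
    have he' : e ∈ F₀ := Finset.mem_filter.2 ⟨he, a, ha, hd⟩
    refine ⟨g e, Finset.mem_image_of_mem g he', ?_⟩
    have := dist_triangle_right (φ a) (φ (g e)) e
    linarith [hg e he']

theorem of_dist_le {S : Set α} {φ : α → E} {ψ : α → G} {ε ε' H : ℝ} (h : HasCover S φ ε H)
    (hd : ∀ a ∈ S, ∀ a' ∈ S, dist (φ a) (φ a') ≤ ε → dist (ψ a) (ψ a') ≤ ε') :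
    HasCover S ψ ε' H := by
  obtain ⟨F, hFS, hF, hc⟩ := h
  refine ⟨F, hFS, hF, fun a ha => ?_⟩
  obtain ⟨a', ha', h'⟩ := hc a ha
  exact ⟨a', ha', hd a ha a' (hFS ha') h'⟩

theorem mono {S : Set α} {φ : α → E} {ε ε' H H' : ℝ} (h : HasCover S φ ε H)
    (hε : ε ≤ ε') (hH : H ≤ H') : HasCover S φ ε' H' := by
  obtain ⟨F, hFS, hF, hc⟩ := h
  refine ⟨F, hFS, hF.trans (Real.exp_le_exp.2 hH), fun a ha => ?_⟩
  obtain ⟨a', ha', h'⟩ := hc a ha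
  exact ⟨a', ha', h'.trans hε⟩

/-- Covers of a two-stage class: cover the first stage, and then, for each of its centres, the
second stage. The error of the first stage passes through the second one. -/
theorem prod {S : Set α} {S' : Set β} {φ : α → E} {Φ : α × β → G} {ε₁ ε₁' ε₂ H₁ H₂ : ℝ}
    (h₁ : HasCover S φ ε₁ H₁) (h₂ : ∀ a ∈ S, HasCover S' (fun b => Φ (a, b)) ε₂ H₂)
    (hd : ∀ b ∈ S', ∀ a ∈ S, ∀ a' ∈ S, dist (φ a) (φ a') ≤ ε₁ →
      dist (Φ (a, b)) (Φ (a', b)) ≤ ε₁') :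
    HasCover (S ×ˢ S') Φ (ε₁' + ε₂) (H₁ + H₂) := by
  classical
  obtain ⟨F, hFS, hF, hc⟩ := h₁
  choose! F₂ hFS₂ hF₂ hc₂ using h₂
  refine ⟨F.biUnion fun a => (F₂ a).image fun b => (a, b), ?_, ?_, ?_⟩
  · rintro ⟨a, b⟩ hab
    simp only [Finset.coe_biUnion, Finset.coe_image, Set.mem_iUnion, Set.mem_image,
      Finset.mem_coe, Prod.mk.injEq] at hab
    obtain ⟨a₁, ha₁, b₁, hb₁, rfl, rfl⟩ := hab
    exact ⟨hFS ha₁, hFS₂ _ (hFS ha₁) hb₁⟩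
  · calc ((F.biUnion fun a => (F₂ a).image fun b => (a, b)).card : ℝ)
        ≤ ∑ a ∈ F, (((F₂ a).image fun b => (a, b)).card : ℝ) := by
          exact_mod_cast Finset.card_biUnion_le
      _ ≤ ∑ a ∈ F, Real.exp H₂ := by
          refine Finset.sum_le_sum fun a ha => le_trans ?_ (hF₂ a (hFS ha))
          exact_mod_cast Finset.card_image_le
      _ = F.card * Real.exp H₂ := by simp
      _ ≤ Real.exp H₁ * Real.exp H₂ := by gcongr
      _ = _ := (Real.exp_add _ _).symm
  · rintro ⟨a, b⟩ ⟨ha, hb⟩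
    obtain ⟨a', ha', h'⟩ := hc a ha
    obtain ⟨b', hb', h''⟩ := hc₂ a' (hFS ha') b hb
    refine ⟨(a', b'), ?_, ?_⟩
    · exact Finset.mem_biUnion.2 ⟨a', ha', Finset.mem_image_of_mem _ hb'⟩
    · have := dist_triangle (Φ (a, b)) (Φ (a', b)) (Φ (a', b'))
      linarith [hd b hb a ha a' (hFS ha') h']

/-- Reparametrization of a class. -/
theorem image {S : Set α} {S' : Set β} {ψ : β → E} {ε H : ℝ} (g : α → β)
    (h : HasCover S (fun a => ψ (g a)) ε H) (hg : Set.MapsTo g S S')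
    (hsurj : ∀ b ∈ S', ∃ a ∈ S, g a = b) : HasCover S' ψ ε H := by
  classical
  obtain ⟨F, hFS, hF, hc⟩ := h
  refine ⟨F.image g, ?_, le_trans (by exact_mod_cast Finset.card_image_le) hF, ?_⟩
  · intro b hb
    obtain ⟨a, ha, rfl⟩ := Finset.mem_image.1 (Finset.mem_coe.1 hb)
    exact hg (hFS ha)
  · intro b hb
    obtain ⟨a, ha, rfl⟩ := hsurj b hb
    obtain ⟨a', ha', h'⟩ := hc a ha
    exact ⟨g a', Finset.mem_image_of_mem g ha', h'⟩

theorem of_const {S : Set α} {φ : α → E} {ε H : ℝ} (hH : 0 ≤ H) (hε : 0 ≤ ε)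
    (hφ : ∀ a ∈ S, ∀ a' ∈ S, dist (φ a) (φ a') ≤ 0) : HasCover S φ ε H := by
  rcases S.eq_empty_or_nonempty with rfl | ⟨a₀, ha₀⟩
  · exact ⟨∅, by simp, by simpa using (Real.exp_pos H).le, by simp⟩
  · refine ⟨{a₀}, by simpa using ha₀, by simpa using hH, fun a ha => ⟨a₀, by simp, ?_⟩⟩
    exact (hφ a ha a₀ ha₀).trans hε

end HasCover

/-! ### Covers of linear classes by sparse combinations of the sample points -/

section Perceptron

open scoped Pointwise

variable {E : Type*} [NormedAddCommGroup E] [InnerProductSpace ℝ E] {ι : Type*} [Fintype ι]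

open scoped Classical in
/-- The possible updates `0, ± η x_i` of a perceptron step. -/
noncomputable def perceptronSteps (x : ι → E) (η : ℝ) : Finset E :=
  insert 0 (Finset.univ.image (fun i => η • x i) ∪ Finset.univ.image (fun i => (-η) • x i))

open scoped Classical in
/-- The vectors reached from the origin by at most `T` perceptron steps. -/
noncomputable def perceptronSet (x : ι → E) (η : ℝ) (T : ℕ) : Finset E :=
  T • perceptronSteps x η

theorem card_perceptronSet_le (x : ι → E) (η : ℝ) (T : ℕ) :
    (perceptronSet x η T).card ≤ (2 * Fintype.card ι + 1) ^ T := by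
  classical
  refine Finset.card_nsmul_le.trans (Nat.pow_le_pow_left ?_ T)
  refine (Finset.card_insert_le _ _).trans ?_
  have h := Finset.card_union_le (Finset.univ.image (fun i => η • x i))
    (Finset.univ.image (fun i => (-η) • x i))
  have h1 := Finset.card_image_le (s := Finset.univ) (f := fun i => η • x i)
  have h2 := Finset.card_image_le (s := Finset.univ) (f := fun i => (-η) • x i)
  rw [Finset.card_univ] at h1 h2
  omega

theorem zero_mem_perceptronSet (x : ι → E) (η : ℝ) (T : ℕ) : 0 ∈ perceptronSet x η T := by
  classical exact Finset.zero_mem_nsmul (Finset.mem_insert_self _ _)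

/-- The mistake bound of the perceptron: as long as some point `x_i` has error more than `ε`, a
step of length `ε / B²` along `± x_i` lowers the squared distance to the target by `ε² / B²`. -/
theorem exists_mem_perceptronSet (x : ι → E) {B ε : ℝ} (hB : 0 < B) (hε : 0 < ε)
    (hx : ∀ i, ‖x i‖ ≤ B) (T : ℕ) (w : E) (hw : ‖w‖ ^ 2 * B ^ 2 < (T + 1) * ε ^ 2) :
    ∃ v ∈ perceptronSet x (ε / B ^ 2) T, ∀ i, |inner ℝ (w - v) (x i)| ≤ ε := by
  classical
  induction T generalizing w with
  | zero =>
    refine ⟨0, zero_mem_perceptronSet _ _ _, fun i => ?_⟩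
    have h1 : ‖w‖ * B < ε := by
      refine lt_of_pow_lt_pow_left₀ 2 hε.le ?_
      rw [mul_pow]; simpa using hw
    rw [sub_zero]
    refine (abs_real_inner_le_norm _ _).trans (le_trans ?_ h1.le)
    gcongr; exact hx i
  | succ T ih =>
    have hsucc : perceptronSet x (ε / B ^ 2) (T + 1)
        = perceptronSet x (ε / B ^ 2) T + perceptronSteps x (ε / B ^ 2) := succ_nsmul _ _
    by_cases hall : ∀ i, |inner ℝ w (x i)| ≤ ε
    · exact ⟨0, zero_mem_perceptronSet _ _ _, by simpa using hall⟩
    · push Not at hall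
      obtain ⟨i, hi⟩ := hall
      set η := ε / B ^ 2 with hη
      have hη0 : 0 < η := by positivity
      have key : ∃ u ∈ perceptronSteps x η, ‖w - u‖ ^ 2 * B ^ 2 < (T + 1) * ε ^ 2 := by
        have hxi : ‖x i‖ ^ 2 ≤ B ^ 2 := pow_le_pow_left₀ (norm_nonneg _) (hx i) 2
        have hηB : η * B ^ 2 = ε := by rw [hη]; field_simp
        have step : ∀ s : ℝ, s ^ 2 = η ^ 2 → ε * η ≤ s * inner ℝ w (x i) →
            ‖w - s • x i‖ ^ 2 * B ^ 2 < (T + 1) * ε ^ 2 := by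
          intro s hs hsi
          rw [norm_sub_sq_real, norm_smul, mul_pow, inner_smul_right, Real.norm_eq_abs, sq_abs, hs]
          have h2 : (‖w‖ ^ 2 - 2 * (s * inner ℝ w (x i)) + η ^ 2 * ‖x i‖ ^ 2) * B ^ 2
              ≤ (‖w‖ ^ 2 - 2 * (ε * η) + η ^ 2 * B ^ 2) * B ^ 2 := by gcongr
          have h3 : (‖w‖ ^ 2 - 2 * (ε * η) + η ^ 2 * B ^ 2) * B ^ 2
              = ‖w‖ ^ 2 * B ^ 2 - 2 * ε * (η * B ^ 2) + (η * B ^ 2) ^ 2 := by ring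
          rw [h3, hηB] at h2
          push_cast at hw
          nlinarith
        rcases lt_abs.1 hi with h | h
        · refine ⟨η • x i, ?_, step η rfl ?_⟩
          · simp [perceptronSteps]
          · rw [mul_comm]; gcongr
        · refine ⟨(-η) • x i, ?_, step (-η) (by ring) ?_⟩
          · exact Finset.mem_insert_of_mem (Finset.mem_union_right _
              (Finset.mem_image_of_mem _ (Finset.mem_univ i)))
          · nlinarith
      obtain ⟨u, hu, hlt⟩ := key
      obtain ⟨v, hv, hvx⟩ := ih (w - u) hlt
      refine ⟨v + u, ?_, fun j => ?_⟩
      · rw [hsucc]; exact Finset.add_mem_add hv hu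
      · rw [show w - (v + u) = w - u - v by abel]; exact hvx j

open scoped Classical in
/-- The integer vectors with nonnegative entries of sum at most `T`. -/
noncomputable def boundedSums (J : Type*) [Fintype J] (T : ℕ) : Finset (J → ℕ) :=
  T • insert 0 (Finset.univ.image fun j => Pi.single j 1)

theorem card_boundedSums_le (J : Type*) [Fintype J] (T : ℕ) :
    (boundedSums J T).card ≤ (Fintype.card J + 1) ^ T := by
  classical
  refine Finset.card_nsmul_le.trans (Nat.pow_le_pow_left ?_ T)
  exact (Finset.card_insert_le _ _).trans (Nat.succ_le_succ Finset.card_image_le)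

theorem mem_boundedSums {J : Type*} [Fintype J] (T : ℕ) (n : J → ℕ) (hn : ∑ j, n j ≤ T) :
    n ∈ boundedSums J T := by
  classical
  induction T generalizing n with
  | zero =>
    have : n = 0 := by
      ext j
      have := Finset.single_le_sum (f := n) (fun _ _ => Nat.zero_le _) (Finset.mem_univ j)
      simp only [Pi.zero_apply]; omega
    subst this
    simp [boundedSums]
  | succ T ih =>
    by_cases h0 : n = 0
    · subst h0
      exact Finset.zero_mem_nsmul (Finset.mem_insert_self _ _)
    · obtain ⟨j, hj⟩ := Function.ne_iff.1 h0
      have hj' : 1 ≤ n j := Nat.one_le_iff_ne_zero.2 hj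
      have hsplit : n = (n - Pi.single j 1) + Pi.single j 1 := by
        ext i
        by_cases hij : i = j
        · subst hij; simp; omega
        · simp [hij]
      have hsum : ∑ i, (n - Pi.single j 1 : J → ℕ) i ≤ T := by
        have h1 : ∑ i, n i = ∑ i, (n - Pi.single j 1 : J → ℕ) i + 1 := by
          conv_lhs => rw [hsplit]
          simp only [Pi.add_apply, Finset.sum_add_distrib]
          simp
        omega
      have : boundedSums J (T + 1) = boundedSums J T
          + insert 0 (Finset.univ.image fun j => Pi.single j 1) := succ_nsmul _ _
      rw [this, hsplit]
      exact Finset.add_mem_add (ih _ hsum) (Finset.mem_insert_of_mem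
        (Finset.mem_image_of_mem _ (Finset.mem_univ j)))

end Perceptron

/-- A column of a matrix as a Euclidean vector. -/
noncomputable def colVec {m n : ℕ} (W : Matrix (Fin m) (Fin n) ℝ) (j : Fin n) :
    EuclideanSpace ℝ (Fin m) :=
  WithLp.toLp 2 fun i => W i j

theorem rowMul_apply {m n : ℕ} (z : EuclideanSpace ℝ (Fin m)) (W : Matrix (Fin m) (Fin n) ℝ)
    (j : Fin n) : rowMul z W j = inner ℝ (colVec W j) z := by
  simp [rowMul, colVec, Matrix.vecMul, dotProduct, PiLp.inner_apply]

theorem norm21_eq {m n : ℕ} (W : Matrix (Fin m) (Fin n) ℝ) : norm21 W = ∑ j, ‖colVec W j‖ := by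
  simp [norm21, colVec, EuclideanSpace.norm_eq]

/-- A bound for a class of matrices with one perceptron per column. A column of norm `b_j` is
described by the integer `n_j = ⌊b_j / h⌋` with `h = ε² / (2 B² b)`, which fixes the precision
`ε_j² = ε² n_j h / (2 b)` demanded of it, and by at most `4 n_j` perceptron steps. Columns with
`n_j = 0` are replaced by zero. Altogether this costs at most `5 b / h` steps. -/
theorem hasCover_rowMul {α ι : Type*} [Fintype ι] {m n : ℕ} (S : Set α)
    (W : α → Matrix (Fin m) (Fin n) ℝ) (x : ι → EuclideanSpace ℝ (Fin m)) {b B ε ℓ : ℝ}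
    (hb : 0 ≤ b) (hB : 0 ≤ B) (hε : 0 < ε) (hW : ∀ a ∈ S, norm21 (W a) ≤ b)
    (hx : ∀ i, ‖x i‖ ≤ B) (hℓn : Real.log (n + 1) ≤ ℓ)
    (hℓι : Real.log (2 * Fintype.card ι + 1) ≤ ℓ) :
    HasCover S (fun a i => rowMul (x i) (W a)) (2 * ε) (10 * (b * B / ε) ^ 2 * ℓ) := by
  classical
  have hℓ0 : 0 ≤ ℓ := (Real.log_nonneg (by linarith [Nat.cast_nonneg (α := ℝ) n])).trans hℓn
  have hinner : ∀ a ∈ S, ∀ i j, |rowMul (x i) (W a) j| ≤ ‖colVec (W a) j‖ * B := by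
    intro a _ i j
    rw [rowMul_apply]
    exact (abs_real_inner_le_norm _ _).trans (by gcongr; exact hx i)
  rcases (mul_nonneg hb hB).eq_or_lt with h0 | hbB
  · -- all the values vanish
    refine HasCover.of_const (by positivity) (by positivity) fun a ha a' ha' => ?_
    have hz : ∀ a ∈ S, (fun i => rowMul (x i) (W a)) = 0 := by
      intro a ha
      funext i
      ext j
      have h1 := hinner a ha i j
      have h2 : ‖colVec (W a) j‖ ≤ b := by
        refine le_trans ?_ (hW a ha)
        rw [norm21_eq]
        exact Finset.single_le_sum (f := fun j => ‖colVec (W a) j‖)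
          (fun _ _ => norm_nonneg _) (Finset.mem_univ j)
      have h3 : ‖colVec (W a) j‖ * B ≤ b * B := by gcongr
      exact abs_nonpos_iff.1 (by linarith)
    rw [hz a ha, hz a' ha', dist_self]
  have hbpos : 0 < b := lt_of_le_of_ne hb fun h => by simp [← h] at hbB
  have hBpos : 0 < B := lt_of_le_of_ne hB fun h => by simp [← h] at hbB
  set h : ℝ := ε ^ 2 / (2 * B ^ 2 * b) with hh
  have hhpos : 0 < h := by positivity
  set T := ⌊b / h⌋₊ with hT
  have hTle : (T : ℝ) ≤ 2 * (b * B / ε) ^ 2 := by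
    refine (Nat.floor_le (by positivity)).trans (le_of_eq ?_)
    rw [hh]; field_simp
  let e : ℕ → ℝ := fun k => Real.sqrt (ε ^ 2 * (k * h) / (2 * b))
  have he : ∀ k, e k ^ 2 = ε ^ 2 * (k * h) / (2 * b) := fun k => Real.sq_sqrt (by positivity)
  -- the centres
  let C : (Fin n → ℕ) → Finset (Fin n → EuclideanSpace ℝ (Fin m)) := fun N =>
    Fintype.piFinset fun j => perceptronSet x (e (N j) / B ^ 2) (4 * N j)
  let val : (Fin n → EuclideanSpace ℝ (Fin m)) → ι → EuclideanSpace ℝ (Fin n) :=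
    fun v i => WithLp.toLp 2 fun j => inner ℝ (v j) (x i)
  let S₀ := (boundedSums (Fin n) T).filter fun N => ∑ j, N j ≤ T
  refine HasCover.of_external ((S₀.biUnion C).image val) ?_ ?_
  · set q : ℝ := 2 * Fintype.card ι + 1 with hq
    have hq1 : 1 ≤ q := by rw [hq]; linarith [Nat.cast_nonneg (α := ℝ) (Fintype.card ι)]
    have hC : ∀ N ∈ S₀, ((C N).card : ℝ) ≤ q ^ (4 * T) := by
      intro N hN
      have hN' : ∑ j, N j ≤ T := (Finset.mem_filter.1 hN).2
      rw [Fintype.card_piFinset]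
      push_cast
      calc ∏ j, ((perceptronSet x (e (N j) / B ^ 2) (4 * N j)).card : ℝ)
          ≤ ∏ j, q ^ (4 * N j) := by
            refine Finset.prod_le_prod (fun _ _ => by positivity) fun j _ => ?_
            rw [hq]
            exact_mod_cast card_perceptronSet_le x _ _
        _ = q ^ (4 * ∑ j, N j) := by rw [Finset.prod_pow_eq_pow_sum, Finset.mul_sum]
        _ ≤ _ := pow_le_pow_right₀ hq1 (by omega)
    have hS : ((S₀.biUnion C).card : ℝ) ≤ (n + 1 : ℝ) ^ T * q ^ (4 * T) := by
      calc ((S₀.biUnion C).card : ℝ) ≤ ∑ N ∈ S₀, ((C N).card : ℝ) := by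
            exact_mod_cast Finset.card_biUnion_le
        _ ≤ ∑ N ∈ S₀, q ^ (4 * T) := Finset.sum_le_sum hC
        _ = S₀.card * q ^ (4 * T) := by simp
        _ ≤ _ := by
            gcongr
            have := (Finset.card_filter_le (boundedSums (Fin n) T) fun N => ∑ j, N j ≤ T).trans
              (card_boundedSums_le (Fin n) T)
            rw [Fintype.card_fin] at this
            exact_mod_cast this
    calc (((S₀.biUnion C).image val).card : ℝ) ≤ ((S₀.biUnion C).card : ℝ) := by
          exact_mod_cast Finset.card_image_le
      _ ≤ (n + 1 : ℝ) ^ T * q ^ (4 * T) := hS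
      _ = Real.exp (T * Real.log (n + 1) + (4 * T : ℕ) * Real.log q) := by
          rw [Real.exp_add, mul_comm (T : ℝ), mul_comm ((4 * T : ℕ) : ℝ), Real.exp_mul,
            Real.exp_mul, Real.exp_log (by positivity), Real.exp_log (by positivity),
            Real.rpow_natCast, Real.rpow_natCast]
      _ ≤ _ := by
          rw [Real.exp_le_exp]
          push_cast
          calc (T : ℝ) * Real.log (n + 1) + 4 * T * Real.log q ≤ T * ℓ + 4 * T * ℓ := by gcongr
            _ = 5 * T * ℓ := by ring
            _ ≤ 5 * (2 * (b * B / ε) ^ 2) * ℓ := by gcongr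
            _ = _ := by ring
  · intro a ha
    set c : Fin n → ℝ := fun j => ‖colVec (W a) j‖ with hc
    have hcsum : ∑ j, c j ≤ b := by rw [← norm21_eq]; exact hW a ha
    have hc0 : ∀ j, 0 ≤ c j := fun j => norm_nonneg _
    let N : Fin n → ℕ := fun j => ⌊c j / h⌋₊
    have hNle : ∀ j, N j * h ≤ c j := fun j => by
      have := Nat.floor_le (div_nonneg (hc0 j) hhpos.le)
      rwa [le_div_iff₀ hhpos] at this
    have hNlt : ∀ j, c j < (N j + 1) * h := fun j => by
      have := Nat.lt_floor_add_one (c j / h)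
      rwa [div_lt_iff₀ hhpos] at this
    have hNsum : (∑ j, N j) ≤ T := by
      refine Nat.le_floor ?_
      push_cast
      rw [le_div_iff₀ hhpos, Finset.sum_mul]
      exact (Finset.sum_le_sum fun j _ => hNle j).trans hcsum
    have hex : ∀ j, ∃ v ∈ perceptronSet x (e (N j) / B ^ 2) (4 * N j),
        ∀ i, (inner ℝ (colVec (W a) j - v) (x i)) ^ 2 ≤ ε ^ 2 / b * c j := by
      intro j
      rcases Nat.eq_zero_or_pos (N j) with h0 | hpos
      · refine ⟨0, zero_mem_perceptronSet _ _ _, fun i => ?_⟩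
        have h1 : c j < h := by simpa [h0] using hNlt j
        have h2 : |inner ℝ (colVec (W a) j) (x i)| ≤ c j * B :=
          (abs_real_inner_le_norm _ _).trans (by gcongr; exact hx i)
        rw [sub_zero, ← sq_abs]
        calc |inner ℝ (colVec (W a) j) (x i)| ^ 2 ≤ (c j * B) ^ 2 := by gcongr
          _ = c j * c j * B ^ 2 := by ring
          _ ≤ h * c j * B ^ 2 := by have := hc0 j; gcongr
          _ = ε ^ 2 / b * c j / 2 := by rw [hh]; field_simp
          _ ≤ _ := by have := hc0 j; linarith [show 0 ≤ ε ^ 2 / b * c j by positivity]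
      · have hNj : (1 : ℝ) ≤ N j := by exact_mod_cast hpos
        have hepos : 0 < e (N j) := Real.sqrt_pos.2 (by positivity)
        obtain ⟨v, hv, hvx⟩ := exists_mem_perceptronSet x hBpos hepos hx (4 * N j)
          (colVec (W a) j) (by
            rw [he]
            have h1 : c j ≤ 2 * N j * h := by
              refine (hNlt j).le.trans ?_
              gcongr; linarith
            calc c j ^ 2 * B ^ 2 ≤ (2 * N j * h) ^ 2 * B ^ 2 := by
                  have := hc0 j; gcongr
              _ = 4 * N j * (ε ^ 2 * (N j * h) / (2 * b)) := by
                  rw [hh]; field_simp; norm_num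
              _ < _ := by
                  push_cast
                  have : 0 < ε ^ 2 * (N j * h) / (2 * b) := by positivity
                  linarith)
        refine ⟨v, hv, fun i => ?_⟩
        rw [← sq_abs]
        calc |inner ℝ (colVec (W a) j - v) (x i)| ^ 2 ≤ e (N j) ^ 2 := by
              gcongr; exact hvx i
          _ = ε ^ 2 / b * (N j * h) / 2 := by rw [he]; field_simp
          _ ≤ ε ^ 2 / b * c j / 2 := by gcongr; exact hNle j
          _ ≤ _ := by have := hc0 j; linarith [show 0 ≤ ε ^ 2 / b * c j by positivity]
    choose v hv hvx using hex
    refine ⟨val v, Finset.mem_image_of_mem _ (Finset.mem_biUnion.2 ⟨N, ?_, ?_⟩), ?_⟩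
    · exact Finset.mem_filter.2 ⟨mem_boundedSums T N hNsum, hNsum⟩
    · exact Fintype.mem_piFinset.2 hv
    · refine (dist_pi_le_iff hε.le).2 fun i => ?_
      rw [EuclideanSpace.dist_eq]
      refine Real.sqrt_le_iff.2 ⟨hε.le, ?_⟩
      calc ∑ j, dist (rowMul (x i) (W a) j) (val v i j) ^ 2 ≤ ∑ j, ε ^ 2 / b * c j := by
            refine Finset.sum_le_sum fun j _ => ?_
            rw [Real.dist_eq, sq_abs, rowMul_apply]
            have := hvx j i
            rwa [inner_sub_left] at this
        _ = ε ^ 2 / b * ∑ j, c j := by rw [Finset.mul_sum]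
        _ ≤ ε ^ 2 / b * b := by gcongr
        _ = ε ^ 2 := by field_simp

/-- Linear functionals of norm at most `b` on points of norm at most `B`. -/
theorem hasCover_inner {E ι α : Type*} [NormedAddCommGroup E] [InnerProductSpace ℝ E] [Fintype ι]
    (S : Set α) (w : α → E) (x : ι → E) {b B ε ℓ : ℝ} (hB : 0 ≤ B) (hε : 0 < ε)
    (hw : ∀ a ∈ S, ‖w a‖ ≤ b) (hx : ∀ i, ‖x i‖ ≤ B)
    (hℓ : Real.log (2 * Fintype.card ι + 1) ≤ ℓ) :
    HasCover S (fun a i => inner ℝ (w a) (x i)) (2 * ε) ((b * B / ε) ^ 2 * ℓ) := by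
  classical
  have hℓ0 : 0 ≤ ℓ :=
    (Real.log_nonneg (by linarith [Nat.cast_nonneg (α := ℝ) (Fintype.card ι)])).trans hℓ
  rcases hB.eq_or_lt with rfl | hBpos
  · refine HasCover.of_const (by positivity) (by positivity) fun a _ a' _ => ?_
    have hx0 : ∀ i, x i = 0 := fun i => norm_le_zero_iff.1 (hx i)
    simp [hx0]
  set T := ⌊(b * B / ε) ^ 2⌋₊ with hT
  refine HasCover.of_external
    ((perceptronSet x (ε / B ^ 2) T).image fun v i => inner ℝ v (x i)) ?_ ?_
  · set q : ℝ := 2 * Fintype.card ι + 1 with hq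
    have hq0 : 0 < q := by positivity
    calc _ ≤ ((perceptronSet x (ε / B ^ 2) T).card : ℝ) := by
          exact_mod_cast Finset.card_image_le
      _ ≤ q ^ T := by rw [hq]; exact_mod_cast card_perceptronSet_le x _ _
      _ = Real.exp (T * Real.log q) := by
          rw [mul_comm, Real.exp_mul, Real.exp_log hq0, Real.rpow_natCast]
      _ ≤ _ := by
          rw [Real.exp_le_exp]
          have : (T : ℝ) ≤ (b * B / ε) ^ 2 := Nat.floor_le (by positivity)
          calc (T : ℝ) * Real.log q ≤ T * ℓ := by gcongr
            _ ≤ _ := by gcongr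
  · intro a ha
    obtain ⟨v, hv, hvx⟩ := exists_mem_perceptronSet x hBpos hε hx T (w a) (by
      have h1 := Nat.lt_floor_add_one ((b * B / ε) ^ 2)
      have h2 : ‖w a‖ ^ 2 * B ^ 2 ≤ b ^ 2 * B ^ 2 := by gcongr; exact hw a ha
      have h3 : b ^ 2 * B ^ 2 = (b * B / ε) ^ 2 * ε ^ 2 := by field_simp
      rw [h3] at h2
      exact h2.trans_lt (by gcongr))
    refine ⟨_, Finset.mem_image_of_mem _ hv, (dist_pi_le_iff hε.le).2 fun i => ?_⟩
    rw [Real.dist_eq, ← inner_sub_left]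
    exact hvx i

/-! ### Norm and Lipschitz estimates for the operations of a block -/

theorem rowMul_sub {m n : ℕ} (z z' : EuclideanSpace ℝ (Fin m)) (W : Matrix (Fin m) (Fin n) ℝ) :
    rowMul (z - z') W = rowMul z W - rowMul z' W := by
  ext j
  simp [rowMul_apply, inner_sub_right]

theorem norm_rowMul_le_norm21 {m n : ℕ} (z : EuclideanSpace ℝ (Fin m))
    (W : Matrix (Fin m) (Fin n) ℝ) : ‖rowMul z W‖ ≤ norm21 W * ‖z‖ := by
  rw [norm21_eq, EuclideanSpace.norm_eq]
  refine Real.sqrt_le_iff.2 ⟨by positivity, ?_⟩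
  calc ∑ j, ‖rowMul z W j‖ ^ 2 ≤ ∑ j, (‖colVec W j‖ * ‖z‖) ^ 2 := by
        refine Finset.sum_le_sum fun j _ => ?_
        rw [rowMul_apply]
        gcongr
        exact abs_real_inner_le_norm _ _
    _ = (∑ j, ‖colVec W j‖ ^ 2) * ‖z‖ ^ 2 := by simp_rw [mul_pow, Finset.sum_mul]
    _ ≤ (∑ j, ‖colVec W j‖) ^ 2 * ‖z‖ ^ 2 := by
        gcongr
        exact Finset.sum_sq_le_sq_sum_of_nonneg fun j _ => norm_nonneg _
    _ = _ := by ring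

theorem inner_rowMul {m n : ℕ} (z : EuclideanSpace ℝ (Fin m)) (W : Matrix (Fin m) (Fin n) ℝ)
    (y : EuclideanSpace ℝ (Fin n)) :
    inner ℝ (rowMul z W) y = inner ℝ z (Matrix.toEuclideanLin W y) := by
  simp only [PiLp.inner_apply, rowMul, Matrix.toLpLin_apply, RCLike.inner_apply, conj_trivial]
  have := Matrix.dotProduct_mulVec z.ofLp W y.ofLp
  simp only [dotProduct] at this
  simp_rw [mul_comm (y.ofLp _), mul_comm (Matrix.mulVec _ _ _)]
  exact this.symm

theorem norm_rowMul_le_specNorm {m n : ℕ} (z : EuclideanSpace ℝ (Fin m))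
    (W : Matrix (Fin m) (Fin n) ℝ) : ‖rowMul z W‖ ≤ specNorm W * ‖z‖ := by
  set y := rowMul z W with hy
  have h1 : ‖y‖ * ‖y‖ ≤ ‖z‖ * (specNorm W * ‖y‖) := by
    rw [← real_inner_self_eq_norm_mul_norm]
    conv_lhs => rw [hy, inner_rowMul]
    refine (real_inner_le_norm _ _).trans ?_
    gcongr
    exact (LinearMap.toContinuousLinearMap (Matrix.toEuclideanLin W)).le_opNorm _
  rcases (norm_nonneg y).eq_or_lt with h0 | hpos
  · rw [← h0]; exact mul_nonneg (norm_nonneg _) (norm_nonneg _)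
  · nlinarith

/-- The attention logits depend on the query and key matrices through `W_K W_Qᵀ` only. -/
theorem inner_rowMul_rowMul {d k : ℕ} (z y : EuclideanSpace ℝ (Fin d))
    (WQ WK : Matrix (Fin d) (Fin k) ℝ) :
    inner ℝ (rowMul z WQ) (rowMul y WK) = inner ℝ z (rowMul y (WK * WQ.transpose)) := by
  rw [inner_rowMul]
  congr 1
  simp only [rowMul, Matrix.toLpLin_apply, ← Matrix.vecMul_vecMul, Matrix.vecMul_transpose]

theorem sum_softmax {τ : ℕ} [NeZero τ] (a : Fin τ → ℝ) : ∑ s, softmax a s = 1 := by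
  have : (0 : ℝ) < ∑ r, Real.exp (a r) :=
    Finset.sum_pos (fun _ _ => Real.exp_pos _) Finset.univ_nonempty
  simp only [softmax]
  rw [← Finset.sum_div, div_self this.ne']

theorem softmax_nonneg {τ : ℕ} (a : Fin τ → ℝ) (s : Fin τ) : 0 ≤ softmax a s := by
  unfold softmax; positivity

theorem softmax_le_exp_mul {τ : ℕ} [NeZero τ] {a b : Fin τ → ℝ} {η : ℝ}
    (h : ∀ s, |a s - b s| ≤ η) (s : Fin τ) :
    softmax a s ≤ Real.exp (2 * η) * softmax b s := by
  have hb : (0 : ℝ) < ∑ r, Real.exp (b r) :=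
    Finset.sum_pos (fun _ _ => Real.exp_pos _) Finset.univ_nonempty
  have ha : (0 : ℝ) < ∑ r, Real.exp (a r) :=
    Finset.sum_pos (fun _ _ => Real.exp_pos _) Finset.univ_nonempty
  have h1 : Real.exp (a s) ≤ Real.exp η * Real.exp (b s) := by
    rw [← Real.exp_add, Real.exp_le_exp]; linarith [(abs_le.1 (h s)).2]
  have h2 : ∑ r, Real.exp (b r) ≤ Real.exp η * ∑ r, Real.exp (a r) := by
    rw [Finset.mul_sum]
    refine Finset.sum_le_sum fun r _ => ?_
    rw [← Real.exp_add, Real.exp_le_exp]; linarith [(abs_le.1 (h r)).1]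
  unfold softmax
  rw [← mul_div_assoc, div_le_div_iff₀ ha hb]
  calc Real.exp (a s) * ∑ r, Real.exp (b r)
      ≤ (Real.exp η * Real.exp (b s)) * (Real.exp η * ∑ r, Real.exp (a r)) := by gcongr
    _ = _ := by rw [two_mul, Real.exp_add]; ring

/-- The softmax is Lipschitz from `ℓ_∞` to `ℓ_1`. -/
theorem sum_abs_softmax_sub_le {τ : ℕ} [NeZero τ] {a b : Fin τ → ℝ} {η : ℝ}
    (h : ∀ s, |a s - b s| ≤ η) : ∑ s, |softmax a s - softmax b s| ≤ 4 * η := by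
  have hη : 0 ≤ η := (abs_nonneg _).trans (h ⟨0, NeZero.pos τ⟩)
  rcases le_total (2 * η) 1 with h1 | h1
  · have he : Real.exp (2 * η) ≤ 1 + 4 * η := by
      have := (abs_le.1 (Real.abs_exp_sub_one_sub_id_le (x := 2 * η)
        (by rw [abs_of_nonneg (by positivity)]; exact h1))).2
      nlinarith
    have he' : 1 - 4 * η ≤ 1 / Real.exp (2 * η) := by
      rw [one_div, ← Real.exp_neg]
      linarith [Real.add_one_le_exp (-(2 * η))]
    calc ∑ s, |softmax a s - softmax b s| ≤ ∑ s, 4 * η * softmax b s := by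
          refine Finset.sum_le_sum fun s _ => ?_
          have hb := softmax_nonneg b s
          have hup := softmax_le_exp_mul h s
          have hlow := softmax_le_exp_mul (fun s => (abs_sub_comm (b s) (a s)).trans_le (h s)) s
          have hlow' : 1 / Real.exp (2 * η) * softmax b s ≤ softmax a s := by
            rw [one_div, inv_mul_le_iff₀ (Real.exp_pos _)]; exact hlow
          rw [abs_le]
          constructor <;> nlinarith
      _ = 4 * η := by rw [← Finset.mul_sum, sum_softmax, mul_one]
  · calc ∑ s, |softmax a s - softmax b s| ≤ ∑ s, (softmax a s + softmax b s) := by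
          refine Finset.sum_le_sum fun s _ => (abs_sub _ _).trans_eq ?_
          rw [abs_of_nonneg (softmax_nonneg a s), abs_of_nonneg (softmax_nonneg b s)]
      _ ≤ 4 * η := by rw [Finset.sum_add_distrib, sum_softmax, sum_softmax]; linarith

theorem norm_softmax_average_le {τ : ℕ} [NeZero τ] {E : Type*} [NormedAddCommGroup E]
    [NormedSpace ℝ E] (a : Fin τ → ℝ) {v : Fin τ → E} {V : ℝ} (hv : ∀ s, ‖v s‖ ≤ V) :
    ‖∑ s, softmax a s • v s‖ ≤ V := by
  calc ‖∑ s, softmax a s • v s‖ ≤ ∑ s, softmax a s * V := by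
        refine (norm_sum_le _ _).trans (Finset.sum_le_sum fun s _ => ?_)
        rw [norm_smul, Real.norm_of_nonneg (softmax_nonneg a s)]
        exact mul_le_mul_of_nonneg_left (hv s) (softmax_nonneg a s)
    _ = V := by rw [← Finset.sum_mul, sum_softmax, one_mul]

theorem norm_softmax_average_sub_le {τ : ℕ} [NeZero τ] {E : Type*} [NormedAddCommGroup E]
    [NormedSpace ℝ E] {a b : Fin τ → ℝ} {v u : Fin τ → E} {V η ξ : ℝ}
    (hv : ∀ s, ‖v s‖ ≤ V) (hab : ∀ s, |a s - b s| ≤ η) (hvu : ∀ s, ‖v s - u s‖ ≤ ξ) :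
    ‖∑ s, softmax a s • v s - ∑ s, softmax b s • u s‖ ≤ 4 * η * V + ξ := by
  have hV : 0 ≤ V := (norm_nonneg _).trans (hv ⟨0, NeZero.pos τ⟩)
  have hsplit : ∑ s, softmax a s • v s - ∑ s, softmax b s • u s
      = ∑ s, (softmax a s - softmax b s) • v s + ∑ s, softmax b s • (v s - u s) := by
    rw [← Finset.sum_sub_distrib, ← Finset.sum_add_distrib]
    refine Finset.sum_congr rfl fun s _ => ?_
    rw [sub_smul, smul_sub]; abel
  rw [hsplit]
  refine (norm_add_le _ _).trans (add_le_add ?_ (norm_softmax_average_le b hvu))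
  calc ‖∑ s, (softmax a s - softmax b s) • v s‖ ≤ ∑ s, |softmax a s - softmax b s| * V := by
        refine (norm_sum_le _ _).trans (Finset.sum_le_sum fun s _ => ?_)
        rw [norm_smul, Real.norm_eq_abs]
        gcongr; exact hv s
    _ ≤ 4 * η * V := by
        rw [← Finset.sum_mul]; gcongr; exact sum_abs_softmax_sub_le hab

theorem norm_normalize_le_one {n : ℕ} (v : EuclideanSpace ℝ (Fin n)) : ‖normalize v‖ ≤ 1 := by
  have h1 : 0 < max 1 ‖v‖ := lt_max_of_lt_left one_pos
  rw [normalize, norm_smul, Real.norm_of_nonneg (by positivity), inv_mul_le_iff₀ h1, mul_one]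
  exact le_max_right _ _

theorem norm_normalize_le {n : ℕ} (v : EuclideanSpace ℝ (Fin n)) : ‖normalize v‖ ≤ ‖v‖ := by
  have h1 : 0 < max 1 ‖v‖ := lt_max_of_lt_left one_pos
  rw [normalize, norm_smul, Real.norm_of_nonneg (by positivity), inv_mul_le_iff₀ h1]
  exact le_mul_of_one_le_left (norm_nonneg _) (le_max_left _ _)

/-- The projection is even `1`-Lipschitz, but the constant `2`, valid in every normed space, is
enough. -/
theorem norm_normalize_sub_le {n : ℕ} (u v : EuclideanSpace ℝ (Fin n)) :
    ‖normalize u - normalize v‖ ≤ 2 * ‖u - v‖ := by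
  have hu : 0 < max 1 ‖u‖ := lt_max_of_lt_left one_pos
  have hv : 0 < max 1 ‖v‖ := lt_max_of_lt_left one_pos
  have hsplit : normalize u - normalize v = (max 1 ‖u‖)⁻¹ • (u - v)
      + ((max 1 ‖u‖)⁻¹ * (max 1 ‖v‖ - max 1 ‖u‖)) • normalize v := by
    have h : (max 1 ‖u‖)⁻¹ * (max 1 ‖v‖ - max 1 ‖u‖) * (max 1 ‖v‖)⁻¹
        = (max 1 ‖u‖)⁻¹ - (max 1 ‖v‖)⁻¹ := by field_simp
    rw [normalize, normalize, smul_smul, h, smul_sub, sub_smul]; abel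
  have h1 : (max 1 ‖u‖)⁻¹ ≤ 1 := inv_le_one_of_one_le₀ (le_max_left _ _)
  have h2 : |max 1 ‖v‖ - max 1 ‖u‖| ≤ ‖u - v‖ := by
    rw [max_comm 1, max_comm 1]
    refine (abs_max_sub_max_le_abs _ _ _).trans ?_ |>.trans (norm_sub_rev v u).le
    exact abs_norm_sub_norm_le v u
  have h0 : 0 ≤ (max 1 ‖u‖)⁻¹ := by positivity
  rw [hsplit]
  refine (norm_add_le _ _).trans ?_
  rw [norm_smul, norm_smul, Real.norm_of_nonneg h0, norm_mul, Real.norm_of_nonneg h0,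
    Real.norm_eq_abs]
  have h3 : (max 1 ‖u‖)⁻¹ * ‖u - v‖ ≤ 1 * ‖u - v‖ := by gcongr
  have h4 : (max 1 ‖u‖)⁻¹ * |max 1 ‖v‖ - max 1 ‖u‖| * ‖normalize v‖ ≤ 1 * ‖u - v‖ * 1 := by
    gcongr; exact norm_normalize_le_one v
  linarith

/-! ### One block -/

section Block

variable {d k τ : ℕ} {C₂ C₂₁ R : ℝ} {Lσ : ℝ≥0}
  {σ : EuclideanSpace ℝ (Fin k) → EuclideanSpace ℝ (Fin k)}

/-- The admissible weights of one layer. -/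
def layerSet (d k : ℕ) (C₂ C₂₁ : ℝ) : Set (LayerParams d k) :=
  {p | specNorm p.WV ≤ C₂ ∧ specNorm (p.WK * p.WQ.transpose) ≤ C₂ ∧ specNorm p.WC ≤ C₂ ∧
    norm21 p.WV ≤ C₂₁ ∧ norm21 (p.WK * p.WQ.transpose) ≤ C₂₁ ∧ norm21 p.WC ≤ C₂₁}

theorem attention_eq (p : LayerParams d k) (Z : Tokens τ d) (t : Fin τ) :
    attention p Z t = ∑ s, softmax (fun r => inner ℝ (Z t)
      (rowMul (Z r) (p.WK * p.WQ.transpose))) s • rowMul (Z s) p.WV := by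
  simp only [attention, inner_rowMul_rowMul]

/-- The part of the block behind the attention map. -/
noncomputable def postAttention (σ : EuclideanSpace ℝ (Fin k) → EuclideanSpace ℝ (Fin k))
    (W : Matrix (Fin k) (Fin d) ℝ) (a : EuclideanSpace ℝ (Fin k)) : EuclideanSpace ℝ (Fin d) :=
  normalize (rowMul (σ (normalize a)) W)

theorem block_eq (p : LayerParams d k) (Z : Tokens τ d) (t : Fin τ) :
    block σ p Z t = postAttention σ p.WC (attention p Z t) := rfl

theorem norm_block_le_one (p : LayerParams d k) (Z : Tokens τ d) (t : Fin τ) :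
    ‖block σ p Z t‖ ≤ 1 := norm_normalize_le_one _

theorem norm_activation_le (hσ : LipschitzWith Lσ σ) (hσ0 : σ 0 = 0)
    (a : EuclideanSpace ℝ (Fin k)) : ‖σ (normalize a)‖ ≤ Lσ * ‖a‖ := by
  have := hσ.norm_sub_le (normalize a) 0
  rw [hσ0, sub_zero, sub_zero] at this
  exact this.trans (by gcongr; exact norm_normalize_le a)

theorem norm_postAttention_sub_le (hσ : LipschitzWith Lσ σ) (hC : 0 ≤ C₂)
    {W : Matrix (Fin k) (Fin d) ℝ} (hW : specNorm W ≤ C₂) (a a' : EuclideanSpace ℝ (Fin k)) :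
    ‖postAttention σ W a - postAttention σ W a'‖ ≤ 4 * C₂ * Lσ * ‖a - a'‖ := by
  refine (norm_normalize_sub_le _ _).trans ?_
  rw [← rowMul_sub]
  have h1 := norm_rowMul_le_specNorm (σ (normalize a) - σ (normalize a')) W
  have h2 := hσ.norm_sub_le (normalize a) (normalize a')
  have h3 := norm_normalize_sub_le a a'
  calc 2 * ‖rowMul (σ (normalize a) - σ (normalize a')) W‖
      ≤ 2 * (C₂ * (Lσ * (2 * ‖a - a'‖))) := by
        gcongr
        refine h1.trans (mul_le_mul hW (h2.trans ?_) (norm_nonneg _) hC)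
        gcongr
    _ = _ := by ring

variable [NeZero τ]

theorem norm_attention_le (hC : 0 ≤ C₂) {p : LayerParams d k} (hp : p ∈ layerSet d k C₂ C₂₁)
    {Z : Tokens τ d} (hZ : ∀ t, ‖Z t‖ ≤ R) (t : Fin τ) : ‖attention p Z t‖ ≤ C₂ * R :=
  norm_softmax_average_le _ fun s =>
    (norm_rowMul_le_specNorm _ _).trans (mul_le_mul hp.1 (hZ s) (norm_nonneg _) hC)

/-- Dependence of the attention on its logit matrix, its value matrix and its input. -/
theorem norm_attention_sub_le (hC : 0 ≤ C₂) {p p' : LayerParams d k}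
    (hp : p ∈ layerSet d k C₂ C₂₁) {Z Z' : Tokens τ d} (hZ : ∀ t, ‖Z t‖ ≤ R) {η ξ : ℝ}
    (t : Fin τ)
    (hη : ∀ r, |inner ℝ (Z t) (rowMul (Z r) (p.WK * p.WQ.transpose))
      - inner ℝ (Z' t) (rowMul (Z' r) (p'.WK * p'.WQ.transpose))| ≤ η)
    (hξ : ∀ s, ‖rowMul (Z s) p.WV - rowMul (Z' s) p'.WV‖ ≤ ξ) :
    ‖attention p Z t - attention p' Z' t‖ ≤ 4 * η * (C₂ * R) + ξ := by
  rw [attention_eq, attention_eq]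
  exact norm_softmax_average_sub_le (fun s => (norm_rowMul_le_specNorm _ _).trans
    (mul_le_mul hp.1 (hZ s) (norm_nonneg _) hC)) hη hξ

theorem norm_block_le {c : ℝ} (hσ : LipschitzWith Lσ σ) (hσ0 : σ 0 = 0) (hC : 0 ≤ C₂)
    {p : LayerParams d k} (hp : p ∈ layerSet d k C₂ C₂₁) (hc0 : 0 ≤ c)
    (hc : ∀ y, ‖rowMul y p.WC‖ ≤ c * ‖y‖) {Z : Tokens τ d} (hZ : ∀ t, ‖Z t‖ ≤ R) (t : Fin τ) :
    ‖block σ p Z t‖ ≤ c * Lσ * C₂ * R := by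
  refine (norm_normalize_le _).trans ((hc _).trans ?_)
  have h1 := norm_activation_le hσ hσ0 (attention p Z t)
  have h2 := norm_attention_le hC hp hZ t
  calc c * ‖σ (normalize (attention p Z t))‖ ≤ c * (Lσ * (C₂ * R)) := by
        gcongr; exact h1.trans (by gcongr)
    _ = _ := by ring

/-- On inputs with rows in the unit ball a block is Lipschitz. -/
theorem norm_block_sub_le (hσ : LipschitzWith Lσ σ) (hC : 0 ≤ C₂) {p : LayerParams d k}
    (hp : p ∈ layerSet d k C₂ C₂₁) {Z Z' : Tokens τ d} (hZ : ∀ t, ‖Z t‖ ≤ 1)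
    (hZ' : ∀ t, ‖Z' t‖ ≤ 1) {δ : ℝ} (hδ : ∀ t, ‖Z t - Z' t‖ ≤ δ) (t : Fin τ) :
    ‖block σ p Z t - block σ p Z' t‖ ≤ 4 * C₂ * Lσ * (8 * C₂ ^ 2 + C₂) * δ := by
  have hA : ∀ y, ‖rowMul y (p.WK * p.WQ.transpose)‖ ≤ C₂ * ‖y‖ := fun y =>
    (norm_rowMul_le_specNorm _ _).trans (by gcongr; exact hp.2.1)
  have hV : ∀ y, ‖rowMul y p.WV‖ ≤ C₂ * ‖y‖ := fun y =>
    (norm_rowMul_le_specNorm _ _).trans (by gcongr; exact hp.1)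
  have hatt : ‖attention p Z t - attention p Z' t‖ ≤ 4 * (2 * C₂ * δ) * (C₂ * 1) + C₂ * δ := by
    refine norm_attention_sub_le hC hp hZ t (fun r => ?_) fun s => ?_
    · set A := p.WK * p.WQ.transpose
      have hsplit : inner ℝ (Z t) (rowMul (Z r) A) - inner ℝ (Z' t) (rowMul (Z' r) A)
          = inner ℝ (Z t - Z' t) (rowMul (Z r) A)
            + inner ℝ (Z' t) (rowMul (Z r - Z' r) A) := by
        rw [rowMul_sub, inner_sub_left, inner_sub_right]; ring
      rw [hsplit]
      have h1 : |inner ℝ (Z t - Z' t) (rowMul (Z r) A)| ≤ δ * (C₂ * 1) :=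
        (abs_real_inner_le_norm _ _).trans (mul_le_mul (hδ t)
          ((hA _).trans (by gcongr; exact hZ r)) (norm_nonneg _)
          ((norm_nonneg _).trans (hδ t)))
      have h2 : |inner ℝ (Z' t) (rowMul (Z r - Z' r) A)| ≤ 1 * (C₂ * δ) :=
        (abs_real_inner_le_norm _ _).trans (mul_le_mul (hZ' t)
          ((hA _).trans (by gcongr; exact hδ r)) (norm_nonneg _) zero_le_one)
      exact (abs_add_le _ _).trans (by linarith)
    · rw [← rowMul_sub]
      exact (hV _).trans (by gcongr; exact hδ s)
  rw [block_eq, block_eq]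
  refine (norm_postAttention_sub_le hσ hC hp.2.2.1 _ _).trans ?_
  calc 4 * C₂ * Lσ * ‖attention p Z t - attention p Z' t‖
      ≤ 4 * C₂ * Lσ * (4 * (2 * C₂ * δ) * (C₂ * 1) + C₂ * δ) := by gcongr
    _ = _ := by ring

end Block

/-! ### Covers of the model class -/

section Model

variable {d k τ n : ℕ} {C₂ C₂₁ : ℝ} {Lσ : ℝ≥0}
  {σ : EuclideanSpace ℝ (Fin k) → EuclideanSpace ℝ (Fin k)}

/-- The layer with the logit matrix of `q.1.1`, the value matrix of `q.1.2` and the output matrix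
of `q.2`. The constraints on the three matrices are independent. -/
def mixLayer (q : (LayerParams d k × LayerParams d k) × LayerParams d k) : LayerParams d k :=
  ⟨q.1.1.WQ, q.1.1.WK, q.1.2.WV, q.2.WC⟩

theorem mixLayer_mem {p p' p'' : LayerParams d k} (h : p ∈ layerSet d k C₂ C₂₁)
    (h' : p' ∈ layerSet d k C₂ C₂₁) (h'' : p'' ∈ layerSet d k C₂ C₂₁) :
    mixLayer ((p, p'), p'') ∈ layerSet d k C₂ C₂₁ :=
  ⟨h'.1, h.2.1, h''.2.2.1, h'.2.2.2.1, h.2.2.2.2.1, h''.2.2.2.2.2⟩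

theorem transformer_snoc {L : ℕ} (W : Fin L → LayerParams d k) (p : LayerParams d k)
    (X : Tokens τ d) : transformer σ (L + 1) (Fin.snoc W p) X
      = block σ p (transformer σ L W X) := by
  simp [transformer]

theorem norm_transformer_le_one {L : ℕ} (hL : 1 ≤ L) (W : Fin L → LayerParams d k)
    (X : Tokens τ d) (t : Fin τ) : ‖transformer σ L W X t‖ ≤ 1 := by
  obtain ⟨L, rfl⟩ := Nat.exists_eq_add_of_le' hL
  exact norm_block_le_one _ _ _

theorem coveringNumber_le_of_hasCover {α : Type*} {S : Set α} {F : α → Tokens τ d → ℝ}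
    {x : Fin n → Tokens τ d} {ε : ℝ≥0} {H : ℝ} (h : HasCover S (fun a i => F a (x i)) ε H) :
    Metric.coveringNumber ε {v : Fin n → ℝ | ∃ f ∈ {f | ∃ a ∈ S, f = F a}, v = fun i => f (x i)} ≠ ⊤
      ∧ ((Metric.coveringNumber ε {v : Fin n → ℝ | ∃ f ∈ {f | ∃ a ∈ S, f = F a},
        v = fun i => f (x i)}).toNat : ℝ) ≤ Real.exp H := by
  classical
  obtain ⟨A, hAS, hA, hc⟩ := h
  let C : Finset (Fin n → ℝ) := A.image fun a i => F a (x i)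
  have hle : Metric.coveringNumber ε {v : Fin n → ℝ | ∃ f ∈ {f | ∃ a ∈ S, f = F a},
      v = fun i => f (x i)} ≤ (C : Set (Fin n → ℝ)).encard := by
    refine Metric.IsCover.coveringNumber_le_encard ?_ ?_
    · intro v hv
      obtain ⟨a, ha, rfl⟩ := Finset.mem_image.1 (Finset.mem_coe.1 hv)
      exact ⟨F a, ⟨a, hAS ha, rfl⟩, rfl⟩
    · rintro v ⟨f, ⟨a, ha, rfl⟩, rfl⟩
      obtain ⟨a', ha', h'⟩ := hc a ha
      refine ⟨fun i => F a' (x i), Finset.mem_coe.2 (Finset.mem_image_of_mem _ ha'), ?_⟩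
      change edist _ _ ≤ (ε : ℝ≥0∞)
      rw [edist_nndist]
      exact_mod_cast h'
  rw [Set.encard_coe_eq_coe_finsetCard] at hle
  refine ⟨ne_top_of_le_ne_top (ENat.natCast_ne_top _) hle, le_trans ?_ hA⟩
  have h2 := ENat.toNat_le_of_le_natCast hle
  exact_mod_cast h2.trans Finset.card_image_le

/-- The entropies of the layers at the precision `e = ε / (2 Bw M^{10 L})`, and of the output
vector, add up to the stated bound. -/
theorem entropy_sum_le {M ℓ B Bw ε : ℝ} {L : ℕ} (hM2 : 2 ≤ M) (hℓ0 : 0 ≤ ℓ)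
    (hBwpos : 0 < Bw) (hε : 0 < ε) (hL : 1 ≤ L) :
    L * (200000 * ℓ * (C₂₁ ^ 2 * (M ^ (2 * L) * B) ^ 2 * (max 1 B) ^ 4 * M ^ 4 /
        (ε / (2 * Bw * (M ^ 10) ^ L)) ^ 2))
        + (Bw * (C₂₁ * M ^ (2 * L) * B) / (ε / 4)) ^ 2 * ℓ ≤
      1000000 * ℓ * (M ^ (29 * L) * (B ^ 2 * (max 1 B) ^ 4) * Bw ^ 2 * C₂₁ ^ 2) / ε ^ 2 := by
  have hM1 : 1 ≤ M := by linarith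
  have hM0 : 0 < M := by linarith
  set e := ε / (2 * Bw * (M ^ 10) ^ L) with he
  have hLM : (L : ℝ) ≤ M ^ L := by
    have h1 : (L : ℝ) ≤ 2 ^ L := by exact_mod_cast Nat.lt_two_pow_self.le
    exact h1.trans (by gcongr)
  have hR4 : 1 ≤ max 1 B ^ 4 := one_le_pow₀ (le_max_left _ _)
  set Q := M ^ (29 * L) * (B ^ 2 * (max 1 B) ^ 4) * Bw ^ 2 * C₂₁ ^ 2 / ε ^ 2 with hQ
  have hQ0 : 0 ≤ Q := by positivity
  have hM4 : M ^ 4 ≤ M ^ (4 * L) := pow_le_pow_right₀ hM1 (by omega)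
  have t1 : L * (C₂₁ ^ 2 * (M ^ (2 * L) * B) ^ 2 * (max 1 B) ^ 4 * M ^ 4 / e ^ 2) ≤ 4 * Q := by
    calc L * (C₂₁ ^ 2 * (M ^ (2 * L) * B) ^ 2 * (max 1 B) ^ 4 * M ^ 4 / e ^ 2)
        ≤ M ^ L * (C₂₁ ^ 2 * (M ^ (2 * L) * B) ^ 2 * (max 1 B) ^ 4 * M ^ (4 * L) / e ^ 2) := by
          gcongr
      _ = 4 * Q := by
          rw [he, hQ, show 29 * L = L + 4 * L + 4 * L + 20 * L by ring]
          simp only [pow_add, pow_mul]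
          field_simp
          ring
  have t2 : (Bw * (C₂₁ * M ^ (2 * L) * B) / (ε / 4)) ^ 2 ≤ 16 * Q := by
    calc (Bw * (C₂₁ * M ^ (2 * L) * B) / (ε / 4)) ^ 2
        = 16 * (M ^ (4 * L) * (B ^ 2 * 1) * Bw ^ 2 * C₂₁ ^ 2 / ε ^ 2) := by
          rw [show 4 * L = 2 * L * 2 by ring, pow_mul M (2 * L) 2]
          field_simp; norm_num
      _ ≤ 16 * Q := by
          have h29 : M ^ (4 * L) ≤ M ^ (29 * L) := pow_le_pow_right₀ hM1 (by omega)
          rw [hQ]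
          gcongr 16 * (?_ * (_ * ?_) * _ * _ / _)
  calc L * (200000 * ℓ * (C₂₁ ^ 2 * (M ^ (2 * L) * B) ^ 2 * (max 1 B) ^ 4 * M ^ 4 / e ^ 2))
        + (Bw * (C₂₁ * M ^ (2 * L) * B) / (ε / 4)) ^ 2 * ℓ
      = 200000 * ℓ * (L * (C₂₁ ^ 2 * (M ^ (2 * L) * B) ^ 2 * (max 1 B) ^ 4 * M ^ 4 / e ^ 2))
        + (Bw * (C₂₁ * M ^ (2 * L) * B) / (ε / 4)) ^ 2 * ℓ := by ring
    _ ≤ 200000 * ℓ * (4 * Q) + 16 * Q * ℓ := by gcongr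
    _ ≤ 1000000 * ℓ * Q := by nlinarith [mul_nonneg hℓ0 hQ0]
    _ = _ := by rw [hQ]; ring

variable [NeZero τ]

/-- The cover of one block on fixed inputs: the three matrices are covered at precisions
`ε_A`, `ε_V`, `ε_C` for which each contributes a fixed part of `e` to the error. -/
theorem hasCover_block (hσ : LipschitzWith Lσ σ) (hσ0 : σ 0 = 0) (hC : 0 ≤ C₂) (hC' : 0 ≤ C₂₁)
    {M R R' e ℓ : ℝ} (hM : 1 ≤ M) (hM₁ : C₂ ≤ M) (hM₂ : C₂ * Lσ ≤ M) (hR : 0 ≤ R) (hRR' : R ≤ R')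
    (hR' : 1 ≤ R') (he : 0 < e) (hd : Real.log (d + 1) ≤ ℓ) (hk : Real.log (k + 1) ≤ ℓ)
    (hn : Real.log (2 * (n * τ : ℕ) + 1) ≤ ℓ) (x : Fin n → Tokens τ d)
    (hx : ∀ i t, ‖x i t‖ ≤ R) :
    HasCover (layerSet d k C₂ C₂₁) (fun p i => block σ p (x i)) e
      (200000 * ℓ * (C₂₁ ^ 2 * R ^ 2 * R' ^ 4 * M ^ 4 / e ^ 2)) := by
  have hℓ0 : 0 ≤ ℓ := (Real.log_nonneg (by linarith [Nat.cast_nonneg (α := ℝ) d])).trans hd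
  have hcard : Real.log (2 * Fintype.card (Fin n × Fin τ) + 1) ≤ ℓ := by
    simpa [Fintype.card_prod] using hn
  set S := layerSet d k C₂ C₂₁ with hS
  have hM0 : 0 < M := by linarith
  have hR'0 : 0 < R' := by linarith
  set εA := e / (128 * M ^ 2 * R' ^ 2) with hεA
  set εV := e / (32 * M) with hεV
  set εC := e / 8 with hεC
  let X : Fin n × Fin τ → EuclideanSpace ℝ (Fin d) := fun q => x q.1 q.2
  have hX : ∀ q, ‖X q‖ ≤ R := fun q => hx q.1 q.2
  let Φ : LayerParams d k × LayerParams d k → Fin n × Fin τ → EuclideanSpace ℝ (Fin k) :=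
    fun a q => attention (mixLayer (a, a.1)) (x q.1) q.2
  have hA := hasCover_rowMul S (fun p => p.WK * p.WQ.transpose) X hC' hR
    (show 0 < εA by positivity) (fun p hp => hp.2.2.2.2.1) hX hd hcard
  have hV := hasCover_rowMul S (fun p => p.WV) X hC' hR
    (show 0 < εV by positivity) (fun p hp => hp.2.2.2.1) hX hk hcard
  have hΦ : HasCover (S ×ˢ S) Φ (4 * (R * (2 * εA)) * (C₂ * R) + 2 * εV)
      (10 * (C₂₁ * R / εA) ^ 2 * ℓ + 10 * (C₂₁ * R / εV) ^ 2 * ℓ) := by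
    refine HasCover.prod hA (fun a ha => HasCover.of_dist_le hV ?_) ?_
    · intro p hp p' hp' hpp
      refine (dist_pi_le_iff (by positivity)).2 fun q => ?_
      rw [dist_eq_norm]
      have h0 := norm_attention_sub_le (p' := mixLayer ((a, p'), a)) (Z' := x q.1) hC
        (mixLayer_mem ha hp ha) (hx q.1) q.2 (η := 0) (ξ := 2 * εV) (fun r => by simp [mixLayer])
        (fun s => by
          have := (dist_pi_le_iff (by positivity)).1 hpp (q.1, s)
          rwa [dist_eq_norm] at this)
      simpa using h0
    · intro b hb p hp p' hp' hpp
      refine (dist_pi_le_iff (by positivity)).2 fun q => ?_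
      rw [dist_eq_norm]
      have h0 := norm_attention_sub_le (p' := mixLayer ((p', b), p')) (Z' := x q.1) hC
        (mixLayer_mem hp hb hp) (hx q.1) q.2 (η := R * (2 * εA)) (ξ := 0) (fun r => by
          have := (dist_pi_le_iff (by positivity)).1 hpp (q.1, r)
          rw [dist_eq_norm] at this
          rw [← inner_sub_right]
          exact (abs_real_inner_le_norm _ _).trans
            (mul_le_mul (hx _ _) this (norm_nonneg _) hR))
        (fun s => by simp [mixLayer])
      simpa using h0
  have hΦR : ∀ a ∈ S ×ˢ S, ∀ q, ‖Φ a q‖ ≤ C₂ * R := fun a ha q =>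
    norm_attention_le hC (mixLayer_mem ha.1 ha.2 ha.1) (hx q.1) q.2
  have hL0 : (0 : ℝ) ≤ Lσ := Lσ.2
  have hblock : HasCover ((S ×ˢ S) ×ˢ S) (fun q i => block σ (mixLayer q) (x i))
      (4 * C₂ * Lσ * (4 * (R * (2 * εA)) * (C₂ * R) + 2 * εV) + 2 * (2 * εC))
      (10 * (C₂₁ * R / εA) ^ 2 * ℓ + 10 * (C₂₁ * R / εV) ^ 2 * ℓ +
        10 * (C₂₁ * (Lσ * (C₂ * R)) / εC) ^ 2 * ℓ) := by
    refine HasCover.prod hΦ (fun a ha => HasCover.of_dist_le (hasCover_rowMul S (fun p => p.WC)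
      (fun q => σ (normalize (Φ a q))) hC' (show 0 ≤ Lσ * (C₂ * R) by positivity)
      (show 0 < εC by positivity) (fun p hp => hp.2.2.2.2.2)
      (fun q => (norm_activation_le hσ hσ0 _).trans (by gcongr; exact hΦR a ha q)) hd hcard) ?_) ?_
    · intro p hp p' hp' hpp
      refine (dist_pi_le_iff (by positivity)).2 fun i => (dist_pi_le_iff (by positivity)).2
        fun t => ?_
      have := (dist_pi_le_iff (by positivity)).1 hpp (i, t)
      rw [dist_eq_norm] at this ⊢
      exact (norm_normalize_sub_le _ _).trans (by gcongr; exact this)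
    · intro p hp a ha a' ha' haa
      refine (dist_pi_le_iff (by positivity)).2 fun i => (dist_pi_le_iff (by positivity)).2
        fun t => ?_
      have := (dist_pi_le_iff (by positivity)).1 haa (i, t)
      rw [dist_eq_norm] at this ⊢
      exact (norm_postAttention_sub_le hσ hC hp.2.2.1 _ _).trans (by gcongr; exact this)
  refine HasCover.mono (HasCover.image mixLayer hblock (fun q hq => mixLayer_mem hq.1.1 hq.1.2 hq.2)
    fun p hp => ⟨((p, p), p), ⟨⟨hp, hp⟩, hp⟩, rfl⟩) ?_ ?_
  · have h1 : 4 * C₂ * Lσ * (4 * (R * (2 * εA)) * (C₂ * R)) ≤ e / 4 := by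
      calc 4 * C₂ * Lσ * (4 * (R * (2 * εA)) * (C₂ * R))
          = 32 * (C₂ * Lσ) * C₂ * R ^ 2 * εA := by ring
        _ ≤ 32 * M * M * R' ^ 2 * εA := by gcongr
        _ = e / 4 := by rw [hεA]; field_simp; norm_num
    have h2 : 4 * C₂ * Lσ * (2 * εV) ≤ e / 4 := by
      calc 4 * C₂ * Lσ * (2 * εV) = 8 * (C₂ * Lσ) * εV := by ring
        _ ≤ 8 * M * εV := by gcongr
        _ = e / 4 := by rw [hεV]; field_simp; norm_num
    rw [mul_add]
    linarith [show 2 * (2 * εC) = e / 2 by rw [hεC]; ring]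
  · have hR4 : 1 ≤ R' ^ 4 := one_le_pow₀ hR'
    have hM2 : M ^ 2 ≤ M ^ 4 := pow_le_pow_right₀ hM (by norm_num)
    set Q := C₂₁ ^ 2 * R ^ 2 * R' ^ 4 * M ^ 4 / e ^ 2 with hQ
    have hQ0 : 0 ≤ Q := by positivity
    have e1 : (C₂₁ * R / εA) ^ 2 = 16384 * Q := by
      rw [hεA, hQ]; field_simp; norm_num
    have e2 : (C₂₁ * R / εV) ^ 2 ≤ 1024 * Q := by
      calc (C₂₁ * R / εV) ^ 2 = 1024 * (C₂₁ ^ 2 * R ^ 2 * 1 * M ^ 2 / e ^ 2) := by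
            rw [hεV]; field_simp; norm_num
        _ ≤ 1024 * Q := by rw [hQ]; gcongr
    have e3 : (C₂₁ * (Lσ * (C₂ * R)) / εC) ^ 2 ≤ 64 * Q := by
      calc (C₂₁ * (Lσ * (C₂ * R)) / εC) ^ 2
          = 64 * (C₂₁ ^ 2 * R ^ 2 * 1 * (C₂ * Lσ) ^ 2 / e ^ 2) := by
            rw [hεC]; field_simp; norm_num
        _ ≤ 64 * (C₂₁ ^ 2 * R ^ 2 * 1 * M ^ 2 / e ^ 2) := by gcongr
        _ ≤ 64 * Q := by rw [hQ]; gcongr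
    calc 10 * (C₂₁ * R / εA) ^ 2 * ℓ + 10 * (C₂₁ * R / εV) ^ 2 * ℓ
          + 10 * (C₂₁ * (Lσ * (C₂ * R)) / εC) ^ 2 * ℓ
        ≤ 10 * (16384 * Q) * ℓ + 10 * (1024 * Q) * ℓ + 10 * (64 * Q) * ℓ := by
          rw [e1]; gcongr
      _ ≤ 200000 * ℓ * Q := by nlinarith [mul_nonneg hℓ0 hQ0]

/-- The rows of the hidden states grow at most geometrically with the depth. -/
theorem norm_transformer_le (hσ : LipschitzWith Lσ σ) (hσ0 : σ 0 = 0) (hC : 0 ≤ C₂) {c B : ℝ}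
    (hc : C₂ * Lσ * C₂ ≤ c) (L : ℕ) (W : Fin L → LayerParams d k)
    (hW : ∀ i, W i ∈ layerSet d k C₂ C₂₁) {X : Tokens τ d} (hX : ∀ t, ‖X t‖ ≤ B) (t : Fin τ) :
    ‖transformer σ L W X t‖ ≤ c ^ L * B := by
  have hB : 0 ≤ B := (norm_nonneg _).trans (hX t)
  induction L generalizing t with
  | zero => simpa [transformer] using hX t
  | succ L ih =>
    have h1 := norm_block_le hσ hσ0 hC (hW (Fin.last L)) hC (fun y =>
      (norm_rowMul_le_specNorm y _).trans (by gcongr; exact (hW (Fin.last L)).2.2.1))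
      (Z := transformer σ L (fun i => W i.castSucc) X) (ih _ fun i => hW _) t
    refine h1.trans ?_
    have hc0 : 0 ≤ c := le_trans (by positivity) hc
    calc C₂ * Lσ * C₂ * (c ^ L * B) ≤ c * (c ^ L * B) := by gcongr
      _ = _ := by ring

theorem hasCover_transformer (hσ : LipschitzWith Lσ σ) (hσ0 : σ 0 = 0) (hC : 0 ≤ C₂)
    (hC' : 0 ≤ C₂₁) {M B e ℓ : ℝ} (hM : M = max 2 C₂ * max 1 (Lσ : ℝ)) (hB : 0 ≤ B) (he : 0 < e)
    (hd : Real.log (d + 1) ≤ ℓ) (hk : Real.log (k + 1) ≤ ℓ)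
    (hn : Real.log (2 * (n * τ : ℕ) + 1) ≤ ℓ) (x : Fin n → Tokens τ d)
    (hx : ∀ i t, ‖x i t‖ ≤ B) (Lmax L : ℕ) (hL : L ≤ Lmax) :
    HasCover {W : Fin L → LayerParams d k | ∀ i, W i ∈ layerSet d k C₂ C₂₁}
      (fun W i => transformer σ L W (x i)) ((M ^ 10) ^ L * e)
      (L * (200000 * ℓ * (C₂₁ ^ 2 * (M ^ (2 * Lmax) * B) ^ 2 * (max 1 B) ^ 4 * M ^ 4 / e ^ 2))) := by
  have hL0 : (0 : ℝ) ≤ Lσ := Lσ.2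
  have hm : 2 ≤ max 2 C₂ := le_max_left _ _
  have hs : 1 ≤ max 1 (Lσ : ℝ) := le_max_left _ _
  have hCm : C₂ ≤ max 2 C₂ := le_max_right _ _
  have hLs : (Lσ : ℝ) ≤ max 1 (Lσ : ℝ) := le_max_right _ _
  set m := max 2 C₂
  set s := max 1 (Lσ : ℝ)
  have hm0 : 0 < m := by linarith
  have hM2 : 2 ≤ M := by rw [hM]; nlinarith
  have hM1 : 1 ≤ M := by linarith
  have hCM : C₂ ≤ M := by rw [hM]; nlinarith
  have hCLM : C₂ * Lσ ≤ M := by rw [hM]; gcongr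
  have hCLCM : C₂ * Lσ * C₂ ≤ M ^ 2 := by
    calc C₂ * Lσ * C₂ ≤ M * M := by gcongr
      _ = M ^ 2 := by ring
  have hΛ : 4 * C₂ * Lσ * (8 * C₂ ^ 2 + C₂) ≤ M ^ 9 := by
    have h4 : (4 : ℝ) ≤ M ^ 2 := by nlinarith
    have h9 : 8 * C₂ ^ 2 + C₂ ≤ M ^ 6 := by
      calc 8 * C₂ ^ 2 + C₂ ≤ 8 * M ^ 2 + M := by gcongr
        _ ≤ 8 * M ^ 2 + M * M := by nlinarith
        _ ≤ (M ^ 2 * M ^ 2) * M ^ 2 := by nlinarith [mul_le_mul h4 h4 (by norm_num) (by positivity)]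
        _ = M ^ 6 := by ring
    calc 4 * C₂ * Lσ * (8 * C₂ ^ 2 + C₂) = 4 * (C₂ * Lσ) * (8 * C₂ ^ 2 + C₂) := by ring
      _ ≤ M ^ 2 * M * M ^ 6 := by gcongr
      _ = M ^ 9 := by ring
  have hℓ0 : 0 ≤ ℓ := (Real.log_nonneg (by linarith [Nat.cast_nonneg (α := ℝ) d])).trans hd
  induction L with
  | zero =>
    refine HasCover.of_const (by simp) (by positivity) fun W _ W' _ => ?_
    rw [Subsingleton.elim W W', dist_self]
  | succ L ih =>
    have ih := ih (by omega)
    set H := 200000 * ℓ * (C₂₁ ^ 2 * (M ^ (2 * Lmax) * B) ^ 2 * (max 1 B) ^ 4 * M ^ 4 / e ^ 2)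
      with hH
    set D := (M ^ 10) ^ L * e with hD
    have hDe : e ≤ D := by
      have : 1 ≤ (M ^ 10) ^ L := one_le_pow₀ (one_le_pow₀ hM1)
      rw [hD]; nlinarith
    -- the hidden states entering the last block
    have hrow : ∀ W : Fin L → LayerParams d k, (∀ i, W i ∈ layerSet d k C₂ C₂₁) → ∀ i t,
        ‖transformer σ L W (x i) t‖ ≤ min (max 1 B) (M ^ (2 * Lmax) * B) := by
      intro W hW i t
      refine le_min ?_ ?_
      · rcases Nat.eq_zero_or_pos L with rfl | hpos
        · exact (hx i t).trans (le_max_right _ _)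
        · exact (norm_transformer_le_one hpos W _ t).trans (le_max_left _ _)
      · refine (norm_transformer_le hσ hσ0 hC hCLCM L W hW (hx i) t).trans ?_
        rw [← pow_mul]
        exact mul_le_mul_of_nonneg_right (pow_le_pow_right₀ hM1 (by omega)) hB
    have hprod : HasCover ({W : Fin L → LayerParams d k | ∀ i, W i ∈ layerSet d k C₂ C₂₁} ×ˢ
        layerSet d k C₂ C₂₁) (fun q i => block σ q.2 (transformer σ L q.1 (x i)))
        (M ^ 9 * D + e) (L * H + H) := by
      refine HasCover.prod ih (fun W hW => ?_) ?_
      · refine (hasCover_block hσ hσ0 hC hC' hM1 hCM hCLM (le_min (by positivity) (by positivity))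
          (min_le_left _ _) (le_max_left _ _) he hd hk hn _ (hrow W hW)).mono le_rfl ?_
        rw [hH]
        gcongr
        exact min_le_right _ _
      · intro p hp W hW W' hW' hWW
        have h0 : 0 ≤ M ^ 9 * D := by positivity
        refine (dist_pi_le_iff h0).2 fun i => (dist_pi_le_iff h0).2 fun t => ?_
        rw [dist_eq_norm]
        rcases Nat.eq_zero_or_pos L with rfl | hpos
        · rw [Subsingleton.elim W W', sub_self, norm_zero]; exact h0
        · refine (norm_block_sub_le hσ hC hp (norm_transformer_le_one hpos W _)
            (norm_transformer_le_one hpos W' _) (δ := D) (fun r => ?_) t).trans (by gcongr)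
          have := (dist_pi_le_iff (by positivity)).1 ((dist_pi_le_iff (by positivity)).1 hWW i) r
          rwa [dist_eq_norm] at this
    have hsnoc : HasCover {W : Fin (L + 1) → LayerParams d k | ∀ i, W i ∈ layerSet d k C₂ C₂₁}
        (fun W i => transformer σ (L + 1) W (x i)) (M ^ 9 * D + e) (L * H + H) := by
      refine HasCover.image (fun q : (Fin L → LayerParams d k) × LayerParams d k =>
        (Fin.snoc q.1 q.2 : Fin (L + 1) → LayerParams d k)) ?_ ?_ ?_
        (S := {W : Fin L → LayerParams d k | ∀ i, W i ∈ layerSet d k C₂ C₂₁} ×ˢ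
          layerSet d k C₂ C₂₁)
      · simp only [transformer_snoc]
        exact hprod
      · rintro ⟨W, p⟩ ⟨hW, hp⟩ i
        refine Fin.lastCases ?_ (fun j => ?_) i
        · simpa using hp
        · simpa using hW j
      · intro W hW
        exact ⟨(fun i => W i.castSucc, W (Fin.last L)), ⟨fun i => hW _, hW _⟩,
          Fin.snoc_init_self W⟩
    refine hsnoc.mono ?_ ?_
    · calc M ^ 9 * D + e ≤ M ^ 9 * D + D := by gcongr
        _ ≤ M ^ 9 * D + M ^ 9 * D := by
            have : 1 ≤ M ^ 9 := one_le_pow₀ hM1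
            have hD0 : 0 ≤ D := by positivity
            nlinarith
        _ ≤ M * (M ^ 9 * D) := by
            have : 0 ≤ M ^ 9 * D := by positivity
            nlinarith
        _ = (M ^ 10) ^ (L + 1) * e := by rw [hD]; ring
    · push_cast; linarith

/-- The entropy of the whole model. The last hidden state has norm at most a multiple of `C₂₁`
(its last factor is `W_C`), so that the output vector `w` costs no more than the layers. -/
theorem hasCover_fvlm (hσ : LipschitzWith Lσ σ) (hσ0 : σ 0 = 0) (hC : 0 ≤ C₂)
    (hC' : 0 ≤ C₂₁) {M B Bw ε ℓ : ℝ} (hM : M = max 2 C₂ * max 1 (Lσ : ℝ)) (hB : 0 ≤ B)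
    (hBw : 0 ≤ Bw) (hε : 0 < ε) {L : ℕ} (hL : 1 ≤ L)
    (hd : Real.log (d + 1) ≤ ℓ) (hk : Real.log (k + 1) ≤ ℓ)
    (hn : Real.log (2 * (n * τ : ℕ) + 1) ≤ ℓ) (x : Fin n → Tokens τ d)
    (hx : ∀ i t, ‖x i t‖ ≤ B) :
    HasCover (paramSet L d k C₂ C₂₁ Bw) (fun θ i => fvlm σ θ (x i)) ε
      (1000000 * ℓ * (M ^ (29 * L) * (B ^ 2 * (max 1 B) ^ 4) * Bw ^ 2 * C₂₁ ^ 2) / ε ^ 2) := by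
  have hL0 : (0 : ℝ) ≤ Lσ := Lσ.2
  have hm : 2 ≤ max 2 C₂ := le_max_left _ _
  have hs : 1 ≤ max 1 (Lσ : ℝ) := le_max_left _ _
  have hM2 : 2 ≤ M := by rw [hM]; nlinarith
  have hM1 : 1 ≤ M := by linarith
  have hCLM : C₂ * Lσ ≤ M := by
    rw [hM]; gcongr
    · exact le_max_right _ _
    · exact le_max_right _ _
  have hCM : C₂ ≤ M := by
    rw [hM]; nlinarith [le_max_right 2 C₂]
  have hCLCM : C₂ * Lσ * C₂ ≤ M ^ 2 := by
    calc C₂ * Lσ * C₂ ≤ M * M := by gcongr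
      _ = M ^ 2 := by ring
  have hℓ0 : 0 ≤ ℓ := (Real.log_nonneg (by linarith [Nat.cast_nonneg (α := ℝ) d])).trans hd
  have hM0 : 0 < M := by linarith
  rcases hBw.eq_or_lt with rfl | hBwpos
  · refine HasCover.of_const (by simp) hε.le fun θ hθ θ' hθ' => ?_
    have h0 : ∀ θ ∈ paramSet L d k C₂ C₂₁ 0, (fun i => fvlm σ θ (x i)) = 0 := fun θ hθ => by
      have : θ.w = 0 := norm_le_zero_iff.1 hθ.2
      funext i; simp [fvlm, this]
    rw [h0 θ hθ, h0 θ' hθ', dist_self]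
  have hτ : 0 < τ := NeZero.pos τ
  let last : Fin τ := ⟨τ - 1, Nat.sub_lt (NeZero.pos τ) Nat.one_pos⟩
  set e := ε / (2 * Bw * (M ^ 10) ^ L) with he
  have he0 : 0 < e := by positivity
  have hcard : Real.log (2 * Fintype.card (Fin n) + 1) ≤ ℓ := by
    refine le_trans (Real.log_le_log (by positivity) ?_) hn
    rw [Fintype.card_fin]
    gcongr
    exact Nat.le_mul_of_pos_right n hτ
  have hlast : ∀ W : Fin L → LayerParams d k, (∀ i, W i ∈ layerSet d k C₂ C₂₁) → ∀ i,
      ‖transformer σ L W (x i) last‖ ≤ C₂₁ * M ^ (2 * L) * B := by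
    intro W hW i
    obtain ⟨L, rfl⟩ := Nat.exists_eq_add_of_le' hL
    refine (norm_block_le hσ hσ0 hC (hW (Fin.last L)) hC' (fun y =>
      (norm_rowMul_le_norm21 y _).trans (by gcongr; exact (hW (Fin.last L)).2.2.2.2.2))
      (Z := transformer σ L (fun i => W i.castSucc) (x i))
      (norm_transformer_le hσ hσ0 hC hCLCM L _ (fun i => hW _) (hx i)) last).trans ?_
    calc C₂₁ * Lσ * C₂ * ((M ^ 2) ^ L * B) = C₂₁ * (C₂ * Lσ) * (M ^ (2 * L)) * B := by
          rw [← pow_mul]; ring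
      _ ≤ C₂₁ * M ^ 2 * M ^ (2 * L) * B := by
          gcongr
          exact hCLM.trans (by nlinarith)
      _ = _ := by ring
  have hout : ∀ W ∈ {W : Fin L → LayerParams d k | ∀ i, W i ∈ layerSet d k C₂ C₂₁},
      HasCover {w : EuclideanSpace ℝ (Fin d) | ‖w‖ ≤ Bw}
        (fun w i => inner ℝ w (transformer σ L W (x i) last)) (2 * (ε / 4))
        ((Bw * (C₂₁ * M ^ (2 * L) * B) / (ε / 4)) ^ 2 * ℓ) := fun W hW =>
    hasCover_inner {w : EuclideanSpace ℝ (Fin d) | ‖w‖ ≤ Bw} (fun w => w)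
      (fun i => transformer σ L W (x i) last) (show 0 ≤ C₂₁ * M ^ (2 * L) * B by positivity)
      (by positivity) (fun w hw => hw) (hlast W hW) hcard
  have hprod : HasCover ({W : Fin L → LayerParams d k | ∀ i, W i ∈ layerSet d k C₂ C₂₁} ×ˢ
      {w : EuclideanSpace ℝ (Fin d) | ‖w‖ ≤ Bw})
      (fun q i => inner ℝ q.2 (transformer σ L q.1 (x i) last))
      (Bw * ((M ^ 10) ^ L * e) + 2 * (ε / 4))
      (L * (200000 * ℓ * (C₂₁ ^ 2 * (M ^ (2 * L) * B) ^ 2 * (max 1 B) ^ 4 * M ^ 4 / e ^ 2))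
        + (Bw * (C₂₁ * M ^ (2 * L) * B) / (ε / 4)) ^ 2 * ℓ) := by
    refine HasCover.prod (hasCover_transformer hσ hσ0 hC hC' hM hB he0 hd hk hn x hx L L le_rfl)
      hout ?_
    intro w hw W _ W' _ hWW
    refine (dist_pi_le_iff (by positivity)).2 fun i => ?_
    have := (dist_pi_le_iff (by positivity)).1 ((dist_pi_le_iff (by positivity)).1 hWW i) last
    rw [dist_eq_norm] at this
    rw [Real.dist_eq, ← inner_sub_right]
    exact (abs_real_inner_le_norm _ _).trans (mul_le_mul hw this (norm_nonneg _) hBw)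
  have himage := HasCover.image (S' := paramSet L d k C₂ C₂₁ Bw)
    (ψ := fun (θ : Params L d k) i => fvlm σ θ (x i))
    (fun q : (Fin L → LayerParams d k) × EuclideanSpace ℝ (Fin d) => Params.mk q.1 q.2) hprod
    (fun q hq => ⟨hq.1, hq.2⟩) fun θ hθ => ⟨(θ.layer, θ.w), ⟨hθ.1, hθ.2⟩, rfl⟩
  refine himage.mono ?_ ?_
  · have : Bw * ((M ^ 10) ^ L * e) = ε / 2 := by rw [he]; field_simp
    rw [this]; linarith
  · exact entropy_sum_le hM2 hℓ0 hBwpos hε hL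

/-- The explicit covering constant of the model class. -/
theorem isCoveringConstant_fvlm (hσ : LipschitzWith Lσ σ) (hσ0 : σ 0 = 0) (hC : 0 ≤ C₂)
    (hC' : 0 ≤ C₂₁) {B Bw : ℝ} (hB : 0 ≤ B) (hBw : 0 ≤ Bw) {L N M : ℕ} (hL : 1 ≤ L) (hd : 1 ≤ d)
    (hN : 1 ≤ N) (hM : 1 ≤ M) :
    IsCoveringConstant {f : Tokens τ d → ℝ | ∃ θ ∈ paramSet L d k C₂ C₂₁ Bw, f = fvlm σ θ} B
      (N + M) (3000000 * (max 2 C₂ * max 1 (Lσ : ℝ)) ^ (29 * L) * (B ^ 2 * max 1 B ^ 4) * Bw ^ 2 *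
        C₂₁ ^ 2 * Real.log ((max d k : ℕ) * τ * ((N : ℝ) + M))) := by
  intro ε hε x hx
  have hτ : 1 ≤ τ := NeZero.pos τ
  set D : ℕ := max d k * τ * (N + M) with hD
  have hdk : d ≤ max d k := le_max_left _ _
  have hkk : k ≤ max d k := le_max_right _ _
  have hmax : 1 ≤ max d k := hd.trans hdk
  have hmD : max d k ≤ D := by
    rw [hD, mul_assoc]
    exact Nat.le_mul_of_pos_right _ (Nat.mul_pos hτ (by omega))
  have hnD : (N + M) * τ ≤ D := by
    rw [hD, mul_assoc, mul_comm (N + M)]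
    exact Nat.le_mul_of_pos_left _ hmax
  have hD2 : 2 ≤ D := by
    refine le_trans ?_ hnD
    nlinarith
  have hlog : ∀ j : ℕ, j ≤ 2 * D → Real.log (j + 1) ≤ 3 * Real.log D := by
    intro j hj
    rw [show (3 : ℝ) * Real.log D = Real.log ((D : ℝ) ^ 3) by rw [Real.log_pow]; norm_num]
    refine Real.log_le_log (by positivity) ?_
    have : j + 1 ≤ D ^ 3 := by nlinarith [Nat.mul_le_mul hD2 hD2, pow_succ D 2, sq D]
    exact_mod_cast this
  have hcov := hasCover_fvlm (ε := (ε : ℝ)) (ℓ := 3 * Real.log D) hσ hσ0 hC hC' rfl hB hBw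
    (by exact_mod_cast hε) hL (hlog d (by omega)) (hlog k (by omega))
    (by have := hlog (2 * ((N + M) * τ)) (by omega); push_cast at this ⊢; exact this) x
    (fun i t => (norm_le_pi_norm (x i) t).trans (hx i))
  obtain ⟨h1, h2⟩ := coveringNumber_le_of_hasCover hcov
  refine ⟨h1, ?_⟩
  have hlogle : ∀ (j : ℕ) (H : ℝ), 0 ≤ H → (j : ℝ) ≤ Real.exp H → Real.log j ≤ H := by
    intro j H hH hj
    rcases Nat.eq_zero_or_pos j with rfl | hpos
    · simpa using hH
    · exact (Real.log_le_iff_le_exp (by exact_mod_cast hpos)).2 hj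
  have hlogD : 0 ≤ Real.log D := Real.log_natCast_nonneg D
  refine (hlogle _ _ ?_ h2).trans (le_of_eq ?_)
  · have : 0 ≤ max 2 C₂ * max 1 (Lσ : ℝ) := by positivity
    positivity
  · rw [show ((max d k : ℕ) : ℝ) * τ * ((N : ℝ) + M) = D by rw [hD]; push_cast; ring]
    ring

end Model

/-! ### Chaining for Rademacher sums -/

/-- The sign `± 1` of a boolean. -/
def boolSign (b : Bool) : ℝ := if b then 1 else -1

/-- The signed sum `∑ ± u_i`. -/
def signedSum {m : ℕ} (s : Fin m → Bool) (u : Fin m → ℝ) : ℝ := ∑ i, boolSign (s i) * u i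

theorem abs_boolSign (b : Bool) : |boolSign b| = 1 := by cases b <;> simp [boolSign]

theorem signedSum_add {m : ℕ} (s : Fin m → Bool) (u v : Fin m → ℝ) :
    signedSum s (u + v) = signedSum s u + signedSum s v := by
  simp [signedSum, mul_add, Finset.sum_add_distrib]

theorem signedSum_finset_sum {m : ℕ} (s : Fin m → Bool) (J : ℕ) (u : ℕ → Fin m → ℝ) :
    signedSum s (∑ j ∈ Finset.range J, u j) = ∑ j ∈ Finset.range J, signedSum s (u j) := by
  induction J with
  | zero => simp [signedSum]
  | succ J ih => rw [Finset.sum_range_succ, signedSum_add, ih, Finset.sum_range_succ]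

theorem signedSum_le {m : ℕ} (s : Fin m → Bool) {u : Fin m → ℝ} {ρ : ℝ} (hu : ∀ i, |u i| ≤ ρ) :
    signedSum s u ≤ m * ρ := by
  calc signedSum s u ≤ ∑ _i : Fin m, ρ := Finset.sum_le_sum fun i _ => by
        refine (le_abs_self _).trans ?_
        rw [abs_mul, abs_boolSign, one_mul]; exact hu i
    _ = m * ρ := by simp

/-- Rademacher sums are subgaussian. -/
theorem sum_exp_signedSum_le {m : ℕ} (μ : ℝ) {u : Fin m → ℝ} {ρ : ℝ} (hu : ∀ i, |u i| ≤ ρ) :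
    ∑ s : Fin m → Bool, Real.exp (μ * signedSum s u) ≤
      2 ^ m * Real.exp (μ ^ 2 * (m * ρ ^ 2) / 2) := by
  have h1 : ∀ s : Fin m → Bool, Real.exp (μ * signedSum s u)
      = ∏ i, Real.exp (μ * (boolSign (s i) * u i)) := fun s => by
    rw [signedSum, Finset.mul_sum, Real.exp_sum]
  simp_rw [h1]
  rw [← Fintype.piFinset_univ, ← Finset.prod_univ_sum (fun _ => Finset.univ)
    (fun i b => Real.exp (μ * (boolSign b * u i)))]
  calc ∏ i, ∑ b, Real.exp (μ * (boolSign b * u i))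
      ≤ ∏ _i : Fin m, 2 * Real.exp (μ ^ 2 * ρ ^ 2 / 2) := by
        refine Finset.prod_le_prod (fun _ _ => by positivity) fun i _ => ?_
        have h2 : ∑ b, Real.exp (μ * (boolSign b * u i)) = 2 * Real.cosh (μ * u i) := by
          rw [Real.cosh_eq]; simp [boolSign]
          ring
        rw [h2]
        gcongr
        refine (Real.cosh_le_exp_half_sq _).trans (Real.exp_le_exp.2 ?_)
        rw [mul_pow, ← sq_abs (u i)]
        have : |u i| ^ 2 ≤ ρ ^ 2 := by gcongr; exact hu i
        gcongr
    _ = _ := by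
        rw [Finset.prod_const, Finset.card_univ, Fintype.card_fin, mul_pow, ← Real.exp_nat_mul]
        congr 2; ring

/-- One link of the chain: the exponential moments of the excess over `t = √(2H m) ρ` of the
maximum of `exp H` Rademacher sums. The moment of order `μ` is estimated through the larger one
of order `max μ (t / (m ρ²))`, at the price of the summand `1`. -/
theorem exists_link_bound {m : ℕ} (hm : 0 < m) (U : Finset (Fin m → ℝ)) {ρ H t μ : ℝ}
    (hρ : 0 < ρ) (hU : ∀ u ∈ U, ∀ i, |u i| ≤ ρ) (hcard : (U.card : ℝ) ≤ Real.exp H) (hH : 0 ≤ H)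
    (ht : 0 ≤ t) (htH : t ^ 2 = 2 * H * (m * ρ ^ 2)) (hμ : 0 ≤ μ) :
    ∃ g : (Fin m → Bool) → ℝ, (∀ s, ∀ u ∈ U, Real.exp (μ * (signedSum s u - t)) ≤ g s) ∧
      ∑ s, g s ≤ 2 ^ m * (1 + Real.exp (μ ^ 2 * (m * ρ ^ 2) / 2)) := by
  have hm' : (0 : ℝ) < m := by exact_mod_cast hm
  set S := (m : ℝ) * ρ ^ 2 with hS
  have hS0 : 0 < S := by positivity
  set ν := max μ (t / S) with hν
  have hν0 : 0 ≤ ν := hμ.trans (le_max_left _ _)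
  refine ⟨fun s => 1 + ∑ u ∈ U, Real.exp (ν * (signedSum s u - t)), fun s u hu => ?_, ?_⟩
  · have hsum : Real.exp (ν * (signedSum s u - t))
        ≤ ∑ u ∈ U, Real.exp (ν * (signedSum s u - t)) :=
      Finset.single_le_sum (f := fun u => Real.exp (ν * (signedSum s u - t)))
        (fun _ _ => (Real.exp_pos _).le) hu
    rcases le_total (signedSum s u) t with h | h
    · have h1 : Real.exp (μ * (signedSum s u - t)) ≤ 1 := by
        rw [Real.exp_le_one_iff]
        exact mul_nonpos_of_nonneg_of_nonpos hμ (by linarith)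
      linarith [Real.exp_pos (ν * (signedSum s u - t))]
    · have h1 : Real.exp (μ * (signedSum s u - t)) ≤ Real.exp (ν * (signedSum s u - t)) := by
        rw [Real.exp_le_exp]
        exact mul_le_mul_of_nonneg_right (le_max_left _ _) (by linarith)
      linarith
  · have hkey : H + ν ^ 2 * S / 2 - ν * t ≤ μ ^ 2 * S / 2 := by
      rcases le_total (t / S) μ with h | h
      · rw [hν, max_eq_left h]
        rw [div_le_iff₀ hS0] at h
        have : t * t ≤ μ * t * S := by nlinarith
        have h2 : 2 * H * S ≤ μ * t * S := by nlinarith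
        have h3 : 2 * H ≤ μ * t := le_of_mul_le_mul_right h2 hS0
        linarith
      · rw [hν, max_eq_right h]
        have h1 : (t / S) ^ 2 * S / 2 - t / S * t = -H := by
          field_simp
          nlinarith
        have : 0 ≤ μ ^ 2 * S / 2 := by positivity
        linarith
    have hcardbool : (Fintype.card (Fin m → Bool) : ℝ) = 2 ^ m := by simp
    calc ∑ s : Fin m → Bool, (1 + ∑ u ∈ U, Real.exp (ν * (signedSum s u - t)))
        = 2 ^ m + ∑ u ∈ U, Real.exp (-(ν * t)) * ∑ s, Real.exp (ν * signedSum s u) := by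
          rw [Finset.sum_add_distrib, Finset.sum_comm]
          congr 1
          · rw [← hcardbool]; simp
          · refine Finset.sum_congr rfl fun u _ => ?_
            rw [Finset.mul_sum]
            refine Finset.sum_congr rfl fun s _ => ?_
            rw [← Real.exp_add]; congr 1; ring
      _ ≤ 2 ^ m + ∑ u ∈ U, Real.exp (-(ν * t)) * (2 ^ m * Real.exp (ν ^ 2 * S / 2)) := by
          gcongr with u hu
          exact sum_exp_signedSum_le ν (hU u hu)
      _ = 2 ^ m + U.card * (2 ^ m * (Real.exp (-(ν * t)) * Real.exp (ν ^ 2 * S / 2))) := by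
          rw [Finset.sum_const, nsmul_eq_mul]; ring
      _ ≤ 2 ^ m + Real.exp H * (2 ^ m * (Real.exp (-(ν * t)) * Real.exp (ν ^ 2 * S / 2))) := by
          gcongr
      _ = 2 ^ m * (1 + Real.exp (H + ν ^ 2 * S / 2 - ν * t)) := by
          rw [show H + ν ^ 2 * S / 2 - ν * t = H + -(ν * t) + ν ^ 2 * S / 2 by ring,
            Real.exp_add, Real.exp_add]; ring
      _ ≤ _ := by gcongr

/-- Convexity of the exponential with the weights `2^{-(j+1)}` and a rest of weight `2^{-J}`. -/
theorem exp_sum_le_sum_exp (J : ℕ) (z : ℕ → ℝ) :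
    Real.exp (∑ j ∈ Finset.range J, z j) ≤
      ∑ j ∈ Finset.range J, (2 ^ (j + 1))⁻¹ * Real.exp (2 ^ (j + 1) * z j) + (2 ^ J)⁻¹ := by
  induction J generalizing z with
  | zero => simp
  | succ J ih =>
    have h := ih fun j => 2 * z (j + 1)
    rw [← Finset.mul_sum] at h
    set y := ∑ j ∈ Finset.range J, z (j + 1) with hy
    have hconv : Real.exp (y + z 0) ≤ 1 / 2 * Real.exp (2 * y) + 1 / 2 * Real.exp (2 * z 0) := by
      have h2 := sq_nonneg (Real.exp y - Real.exp (z 0))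
      rw [Real.exp_add, two_mul, two_mul, Real.exp_add, Real.exp_add]
      nlinarith
    rw [Finset.sum_range_succ', Finset.sum_range_succ']
    refine hconv.trans ?_
    have hsum : ∑ j ∈ Finset.range J, ((2 : ℝ) ^ (j + 1 + 1))⁻¹
        * Real.exp (2 ^ (j + 1 + 1) * z (j + 1))
        = 1 / 2 * ∑ j ∈ Finset.range J, (2 ^ (j + 1))⁻¹
          * Real.exp (2 ^ (j + 1) * (2 * z (j + 1))) := by
      rw [Finset.mul_sum]
      refine Finset.sum_congr rfl fun j _ => ?_
      rw [show (2 : ℝ) ^ (j + 1 + 1) * z (j + 1) = 2 ^ (j + 1) * (2 * z (j + 1)) by ring,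
        pow_succ (2 : ℝ) (j + 1), mul_inv]
      ring
    rw [hsum, pow_succ (2 : ℝ) J, mul_inv]
    norm_num
    linarith

theorem sum_inv_two_pow (J : ℕ) :
    ∑ j ∈ Finset.range J, ((2 : ℝ) ^ (j + 1))⁻¹ + (2 ^ J)⁻¹ = 1 := by
  induction J with
  | zero => simp
  | succ J ih =>
    rw [Finset.sum_range_succ, ← ih, pow_succ, mul_inv]; ring

/-- Dudley's chaining in exponential moments, for a class of entropy at most `C / η²` at every
scale `η`: above the level `m r 2^{-J} + 6 J √(m C)`, the supremum of the Rademacher sums is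
subgaussian with a variance proxy proportional to `m r²`, where `r` is the radius of the class. -/
theorem exists_chaining_bound {m : ℕ} (hm : 0 < m) {ι : Type*} (v : ι → Fin m → ℝ) {r C : ℝ}
    (hr : 0 < r) (hC : 0 ≤ C) (hv : ∀ θ i, |v θ i| ≤ r)
    (hcov : ∀ η : ℝ, 0 < η → ∃ F : Finset (Fin m → ℝ), (F.card : ℝ) ≤ Real.exp (C / η ^ 2) ∧
      ∀ θ, ∃ c ∈ F, ∀ i, |v θ i - c i| ≤ η) (J : ℕ) {lam : ℝ} (hlam : 0 ≤ lam) :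
    ∃ g : (Fin m → Bool) → ℝ,
      (∀ s θ, Real.exp (lam * (signedSum s (v θ) - (m * (r * (2 ^ J)⁻¹) + J * (6 * √(m * C)))))
        ≤ g s) ∧
      ∑ s, g s ≤ 2 ^ m * (2 * Real.exp (lam ^ 2 * (9 * m * r ^ 2 / 2))) := by
  classical
  set e : ℕ → ℝ := fun j => r * (2 ^ j)⁻¹ with he
  have he0 : ∀ j, 0 < e j := fun j => by positivity
  have hesucc : ∀ j, e j = 2 * e (j + 1) := fun j => by
    simp only [he]; rw [pow_succ, mul_inv]; ring
  have hF : ∀ j, ∃ F : Finset (Fin m → ℝ), (F.card : ℝ) ≤ Real.exp (C / e j ^ 2) ∧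
      (∀ θ, ∃ c ∈ F, ∀ i, |v θ i - c i| ≤ e j) ∧ (j = 0 → F = {0}) := by
    intro j
    rcases Nat.eq_zero_or_pos j with rfl | hj
    · refine ⟨{0}, ?_, fun θ => ⟨0, by simp, fun i => by simpa [he] using hv θ i⟩, fun _ => rfl⟩
      simpa using div_nonneg hC (sq_nonneg _)
    · obtain ⟨F, h1, h2⟩ := hcov (e j) (he0 j)
      exact ⟨F, h1, h2, fun h => absurd h hj.ne'⟩
  choose F hFcard hFcov hF0 using hF
  choose π hπF hπ using hFcov
  have hπ0 : ∀ θ, π 0 θ = 0 := fun θ => by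
    have := hπF 0 θ; rw [hF0 0 rfl] at this; simpa using this
  set t := 6 * √(m * C) with ht
  have ht2 : t ^ 2 = 36 * (m * C) := by rw [ht, mul_pow, Real.sq_sqrt (by positivity)]; norm_num
  -- the differences of consecutive approximations
  let U : ℕ → Finset (Fin m → ℝ) := fun j =>
    ((F (j + 1) ×ˢ F j).image fun c => c.1 - c.2).filter fun u => ∀ i, |u i| ≤ 3 * e (j + 1)
  have hU : ∀ j θ, π (j + 1) θ - π j θ ∈ U j := fun j θ => by
    refine Finset.mem_filter.2 ⟨Finset.mem_image.2 ⟨(π (j + 1) θ, π j θ),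
      Finset.mk_mem_product (hπF _ _) (hπF _ _), rfl⟩, fun i => ?_⟩
    have h1 := abs_le.1 (hπ (j + 1) θ i)
    have h2 := abs_le.1 (hπ j θ i)
    rw [hesucc j] at h2
    rw [Pi.sub_apply, abs_le]
    constructor <;> linarith
  have hlink : ∀ j, ∃ g : (Fin m → Bool) → ℝ,
      (∀ s, ∀ u ∈ U j, Real.exp (lam * 2 ^ (j + 1) * (signedSum s u - t)) ≤ g s) ∧
      ∑ s, g s ≤ 2 ^ m * (1 + Real.exp ((lam * 2 ^ (j + 1)) ^ 2
        * (m * (3 * e (j + 1)) ^ 2) / 2)) := by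
    intro j
    have hej := he0 (j + 1)
    refine exists_link_bound hm (U j) (H := 2 * C / e (j + 1) ^ 2) (by positivity)
      (fun u hu => (Finset.mem_filter.1 hu).2) ?_ (by positivity) (by positivity) ?_ (by positivity)
    · calc ((U j).card : ℝ) ≤ ((F (j + 1)).card : ℝ) * (F j).card := by
            rw [← Nat.cast_mul, ← Finset.card_product]
            exact_mod_cast (Finset.card_filter_le _ _).trans Finset.card_image_le
        _ ≤ Real.exp (C / e (j + 1) ^ 2) * Real.exp (C / e j ^ 2) :=
            mul_le_mul (hFcard _) (hFcard _) (Nat.cast_nonneg _) (Real.exp_pos _).le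
        _ = Real.exp (C / e (j + 1) ^ 2 + C / e j ^ 2) := (Real.exp_add _ _).symm
        _ ≤ _ := by
            rw [Real.exp_le_exp]
            have : C / e j ^ 2 ≤ C / e (j + 1) ^ 2 := by
              have h4 : e (j + 1) ≤ e j := by rw [hesucc j]; linarith
              gcongr
            calc _ ≤ C / e (j + 1) ^ 2 + C / e (j + 1) ^ 2 := by gcongr
              _ = _ := by ring
    · rw [ht2]; field_simp; ring
  choose G hG hGsum using hlink
  refine ⟨fun s => ∑ j ∈ Finset.range J, (2 ^ (j + 1))⁻¹ * G j s + (2 ^ J)⁻¹, fun s θ => ?_, ?_⟩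
  · have hsplit : v θ = (v θ - π J θ) + ∑ j ∈ Finset.range J, (π (j + 1) θ - π j θ) := by
      rw [Finset.sum_range_sub (fun j => π j θ), hπ0]; abel
    have hle : signedSum s (v θ) - (m * (r * (2 ^ J)⁻¹) + J * t)
        ≤ ∑ j ∈ Finset.range J, (signedSum s (π (j + 1) θ - π j θ) - t) := by
      rw [Finset.sum_sub_distrib, ← signedSum_finset_sum]
      have h1 := signedSum_le s (u := v θ - π J θ) (hπ J θ)
      have h2 : signedSum s (v θ) = signedSum s (v θ - π J θ)
          + signedSum s (∑ j ∈ Finset.range J, (π (j + 1) θ - π j θ)) := by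
        rw [← signedSum_add, ← hsplit]
      rw [h2]
      simp only [Finset.sum_const, Finset.card_range, nsmul_eq_mul]
      linarith
    calc _ ≤ Real.exp (∑ j ∈ Finset.range J,
          lam * (signedSum s (π (j + 1) θ - π j θ) - t)) := by
          rw [Real.exp_le_exp, ← Finset.mul_sum]; gcongr
      _ ≤ _ := exp_sum_le_sum_exp J _
      _ ≤ _ := by
          refine add_le_add (Finset.sum_le_sum fun j _ =>
            mul_le_mul_of_nonneg_left ?_ (by positivity)) le_rfl
          refine le_of_eq_of_le ?_ (hG j s _ (hU j θ))
          congr 1; ring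
  · set E := Real.exp (lam ^ 2 * (9 * m * r ^ 2 / 2)) with hE
    have hE1 : 1 ≤ E := by rw [hE, Real.one_le_exp_iff]; positivity
    have hGE : ∀ j, ∑ s, G j s ≤ 2 ^ m * (2 * E) := fun j => by
      refine (hGsum j).trans ?_
      have hexp : (lam * 2 ^ (j + 1)) ^ 2 * (m * (3 * e (j + 1)) ^ 2) / 2
          = lam ^ 2 * (9 * m * r ^ 2 / 2) := by
        simp only [he]; field_simp; norm_num
      rw [hexp]
      gcongr
      linarith
    calc ∑ s : Fin m → Bool, (∑ j ∈ Finset.range J, ((2 : ℝ) ^ (j + 1))⁻¹ * G j s + (2 ^ J)⁻¹)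
        = ∑ j ∈ Finset.range J, ((2 : ℝ) ^ (j + 1))⁻¹ * ∑ s, G j s + 2 ^ m * (2 ^ J)⁻¹ := by
          rw [Finset.sum_add_distrib, Finset.sum_comm]
          simp [Finset.mul_sum]
      _ ≤ ∑ j ∈ Finset.range J, ((2 : ℝ) ^ (j + 1))⁻¹ * (2 ^ m * (2 * E))
          + 2 ^ m * (2 * E) * (2 ^ J)⁻¹ := by
          gcongr with j _
          · exact hGE j
          · nlinarith [show (0 : ℝ) < 2 ^ m by positivity]
      _ = 2 ^ m * (2 * E) * (∑ j ∈ Finset.range J, ((2 : ℝ) ^ (j + 1))⁻¹ + (2 ^ J)⁻¹) := by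
          rw [← Finset.sum_mul]; ring
      _ = _ := by rw [sum_inv_two_pow, mul_one]

/-! ### Symmetrization and uniform deviations -/

section ExpSup

variable {ι : Type*}

/-- The maximum of the exponentials of a finite family. -/
noncomputable def expSup (a : ι → ℝ) : ℝ := ⨆ θ, Real.exp (a θ)

theorem expSup_le [Nonempty ι] {a : ι → ℝ} {B : ℝ} (h : ∀ θ, Real.exp (a θ) ≤ B) :
    expSup a ≤ B := ciSup_le h

theorem expSup_nonneg (a : ι → ℝ) : 0 ≤ expSup a := Real.iSup_nonneg fun _ => (Real.exp_pos _).le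

variable [Finite ι]

theorem exp_le_expSup (a : ι → ℝ) (θ : ι) : Real.exp (a θ) ≤ expSup a :=
  le_ciSup (f := fun θ => Real.exp (a θ)) (Set.finite_range _).bddAbove θ

theorem measurable_expSup {Ω : Type*} [MeasurableSpace Ω] {a : Ω → ι → ℝ}
    (ha : ∀ θ, Measurable fun ω => a ω θ) : Measurable fun ω => expSup (a ω) := by
  unfold expSup
  exact Measurable.iSup fun θ => (ha θ).exp

theorem integrable_expSup [Nonempty ι] {Ω : Type*} [MeasurableSpace Ω] {μ : Measure Ω}
    [IsFiniteMeasure μ] {a : Ω → ι → ℝ} {B : ℝ} (ha : ∀ θ, Measurable fun ω => a ω θ)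
    (hB : ∀ ω θ, a ω θ ≤ B) : Integrable (fun ω => expSup (a ω)) μ := by
  refine Integrable.of_bound (measurable_expSup ha).aestronglyMeasurable (Real.exp B)
    (ae_of_all _ fun ω => ?_)
  rw [Real.norm_of_nonneg (expSup_nonneg _)]
  exact expSup_le fun θ => Real.exp_le_exp.2 (hB ω θ)

theorem expSup_add_le [Nonempty ι] (a b : ι → ℝ) :
    expSup (fun θ => a θ + b θ) ≤
      1 / 2 * expSup (fun θ => 2 * a θ) + 1 / 2 * expSup (fun θ => 2 * b θ) := by
  refine expSup_le fun θ => ?_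
  have h1 := exp_le_expSup (fun θ => 2 * a θ) θ
  have h2 := exp_le_expSup (fun θ => 2 * b θ) θ
  have h3 := sq_nonneg (Real.exp (a θ) - Real.exp (b θ))
  simp only [two_mul, Real.exp_add] at h1 h2 ⊢
  nlinarith

end ExpSup

section Symmetrization

variable {𝓧 : Type*} [MeasurableSpace 𝓧] {m : ℕ}

/-- Exchange of the coordinates of two samples at the positions `i` with `s i = false`. -/
def swapSamples (s : Fin m → Bool) (p : (Fin m → 𝓧) × (Fin m → 𝓧)) :
    (Fin m → 𝓧) × (Fin m → 𝓧) :=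
  (fun i => if s i then p.1 i else p.2 i, fun i => if s i then p.2 i else p.1 i)

theorem measurePreserving_swapSamples (D : Measure 𝓧) [IsProbabilityMeasure D]
    (s : Fin m → Bool) :
    MeasurePreserving (swapSamples (𝓧 := 𝓧) s)
      ((Measure.pi fun _ : Fin m => D).prod (Measure.pi fun _ : Fin m => D))
      ((Measure.pi fun _ : Fin m => D).prod (Measure.pi fun _ : Fin m => D)) := by
  have h1 := measurePreserving_arrowProdEquivProdArrow 𝓧 𝓧 (Fin m) (fun _ => D) (fun _ => D)
  have h2 : MeasurePreserving
      (fun (a : Fin m → 𝓧 × 𝓧) i => (if s i then id else Prod.swap : 𝓧 × 𝓧 → 𝓧 × 𝓧) (a i))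
      (Measure.pi fun _ : Fin m => D.prod D) (Measure.pi fun _ : Fin m => D.prod D) := by
    refine measurePreserving_pi _ _ fun i => ?_
    by_cases hs : s i
    · simp only [hs, if_true]; exact MeasurePreserving.id _
    · simp only [hs]; exact Measure.measurePreserving_swap
  have h3 := (h1.comp h2).comp h1.symm
  convert h3 using 1
  funext p
  refine Prod.ext ?_ ?_ <;> funext i <;> by_cases hs : s i <;>
    simp [swapSamples, MeasurableEquiv.arrowProdEquivProdArrow, Equiv.arrowProdEquivProdArrow, hs]

theorem ae_pi_of_ae {D : Measure 𝓧} [IsProbabilityMeasure D] {p : 𝓧 → Prop}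
    (h : ∀ᵐ x ∂D, p x) : ∀ᵐ x ∂(Measure.pi fun _ : Fin m => D), ∀ i, p (x i) :=
  ae_all_iff.2 fun i =>
    (measurePreserving_eval (fun _ : Fin m => D) i).quasiMeasurePreserving.ae h

/-- Symmetrization: the exponential moment of the largest deviation of the empirical sums of a
finite class from their means is bounded by a conditional Rademacher moment. -/
theorem integral_expSup_le (D : Measure 𝓧) [IsProbabilityMeasure D] {ι : Type*} [Finite ι]
    [Nonempty ι] {ψ : ι → 𝓧 → ℝ} (hψ : ∀ θ, Measurable (ψ θ)) {b : ℝ} (hb : ∀ θ x, |ψ θ x| ≤ b)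
    {p : 𝓧 → Prop} (hp : ∀ᵐ x ∂D, p x) {lam Δ K : ℝ} (hlam : 0 ≤ lam)
    (hR : ∀ x : Fin m → 𝓧, (∀ i, p (x i)) →
      ∑ s, expSup (fun θ => 2 * (lam * (signedSum s (fun i => ψ θ (x i)) - Δ))) ≤ 2 ^ m * K) :
    ∫ x, expSup (fun θ => lam * (∑ i, (∫ y, ψ θ y ∂D - ψ θ (x i)) - 2 * Δ))
      ∂(Measure.pi fun _ : Fin m => D) ≤ K := by
  set Q := Measure.pi fun _ : Fin m => D with hQ
  have hm' : ∀ (θ : ι) (i : Fin m), Measurable fun x : Fin m → 𝓧 => ψ θ (x i) :=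
    fun θ i => (hψ θ).comp (measurable_pi_apply i)
  have hsumb : ∀ (c d : Fin m → ℝ), (∀ i, |c i| ≤ b) → (∀ i, |d i| ≤ b) →
      ∑ i, (c i - d i) ≤ m * (2 * b) := by
    intro c d hc hd
    calc ∑ i, (c i - d i) ≤ ∑ _i : Fin m, 2 * b := Finset.sum_le_sum fun i _ => by
          linarith [(abs_le.1 (hc i)).2, (abs_le.1 (hd i)).1]
      _ = _ := by simp
  have hmean : ∀ θ, |∫ y, ψ θ y ∂D| ≤ b := fun θ => by
    have := norm_integral_le_of_norm_le_const (μ := D) (f := ψ θ) (C := b)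
      (ae_of_all _ fun x => hb θ x)
    simpa using this
  let f : (Fin m → 𝓧) × (Fin m → 𝓧) → ℝ := fun q =>
    expSup (fun θ => lam * (∑ i, (ψ θ (q.2 i) - ψ θ (q.1 i)) - 2 * Δ))
  have hfm : ∀ θ, Measurable fun q : (Fin m → 𝓧) × (Fin m → 𝓧) =>
      lam * (∑ i, (ψ θ (q.2 i) - ψ θ (q.1 i)) - 2 * Δ) := fun θ =>
    measurable_const.mul ((Finset.measurable_sum _ fun i _ =>
      ((hm' θ i).comp measurable_snd).sub ((hm' θ i).comp measurable_fst)).sub_const _)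
  have hfb : ∀ (q : (Fin m → 𝓧) × (Fin m → 𝓧)) (θ : ι),
      lam * (∑ i, (ψ θ (q.2 i) - ψ θ (q.1 i)) - 2 * Δ) ≤ lam * (m * (2 * b) - 2 * Δ) := by
    intro q θ
    have := hsumb (fun i => ψ θ (q.2 i)) (fun i => ψ θ (q.1 i)) (fun i => hb _ _) fun i => hb _ _
    gcongr
  have hfint : Integrable f (Q.prod Q) := integrable_expSup hfm hfb
  -- Jensen's inequality for a second, independent sample
  have hJensen : ∀ x, expSup (fun θ => lam * (∑ i, (∫ y, ψ θ y ∂D - ψ θ (x i)) - 2 * Δ))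
      ≤ ∫ x', f (x, x') ∂Q := by
    intro x
    refine expSup_le fun θ => ?_
    set g : (Fin m → 𝓧) → ℝ := fun x' => lam * (∑ i, (ψ θ (x' i) - ψ θ (x i)) - 2 * Δ) with hg
    have hψint : ∀ i, Integrable (fun x' : Fin m → 𝓧 => ψ θ (x' i)) Q := fun i =>
      Integrable.of_bound (hm' θ i).aestronglyMeasurable b (ae_of_all _ fun x' => hb θ _)
    have hsumint : Integrable (fun x' : Fin m → 𝓧 => ∑ i, (ψ θ (x' i) - ψ θ (x i))) Q :=
      integrable_finsetSum _ fun i _ => (hψint i).sub (integrable_const _)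
    have hgint : Integrable g Q := (hsumint.sub (integrable_const _)).const_mul lam
    have hgmean : ∫ x', g x' ∂Q = lam * (∑ i, (∫ y, ψ θ y ∂D - ψ θ (x i)) - 2 * Δ) := by
      have hsumint' : ∀ i ∈ Finset.univ, Integrable
          (fun x' : Fin m → 𝓧 => ψ θ (x' i) - ψ θ (x i)) Q := fun i _ =>
        (hψint i).sub (integrable_const _)
      rw [hg, integral_const_mul, integral_sub hsumint (integrable_const _),
        integral_finsetSum _ hsumint']
      congr 2
      · refine Finset.sum_congr rfl fun i _ => ?_
        rw [integral_sub (hψint i) (integrable_const _), hQ,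
          integral_comp_eval (hψ θ).aestronglyMeasurable]
        simp
      · simp
    have hfx : Integrable (fun x' => f (x, x')) Q :=
      integrable_expSup (fun θ => (hfm θ).comp measurable_prodMk_left) fun x' θ => hfb (x, x') θ
    have hexp : Integrable (fun x' => Real.exp (g x')) Q := by
      refine hfx.mono' (hgint.aestronglyMeasurable.aemeasurable.exp.aestronglyMeasurable)
        (ae_of_all _ fun x' => ?_)
      rw [Real.norm_of_nonneg (Real.exp_pos _).le]
      exact exp_le_expSup (fun θ => lam * (∑ i, (ψ θ (x' i) - ψ θ (x i)) - 2 * Δ)) θ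
    rw [← hgmean]
    have hJ := convexOn_exp.map_integral_le (μ := Q) (f := g) Real.continuous_exp.continuousOn
      isClosed_univ (ae_of_all _ fun _ => Set.mem_univ _) hgint hexp
    refine hJ.trans (integral_mono hexp hfx fun x' => ?_)
    exact exp_le_expSup (fun θ => lam * (∑ i, (ψ θ (x' i) - ψ θ (x i)) - 2 * Δ)) θ
  have hswap : ∀ s, ∫ q, f q ∂(Q.prod Q) = ∫ q, f (swapSamples s q) ∂(Q.prod Q) := fun s =>
    (((measurePreserving_swapSamples D s).integral_comp'
      (f := MeasurableEquiv.ofInvolutive (swapSamples s) (fun q => by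
        refine Prod.ext ?_ ?_ <;> funext i <;> by_cases hs : s i <;> simp [swapSamples, hs])
        (measurePreserving_swapSamples D s).measurable) f)).symm
  have hbound : ∀ s (q : (Fin m → 𝓧) × (Fin m → 𝓧)), f (swapSamples s q) ≤
      1 / 2 * expSup (fun θ => 2 * (lam * (signedSum s (fun i => ψ θ (q.2 i)) - Δ)))
      + 1 / 2 * expSup (fun θ => 2 * (lam * (signedSum (fun i => !s i)
        (fun i => ψ θ (q.1 i)) - Δ))) := by
    intro s q
    refine le_of_eq_of_le ?_ (expSup_add_le _ _)
    simp only [f]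
    congr 1
    funext θ
    rw [← mul_add]
    congr 1
    have : ∑ i, (ψ θ ((swapSamples s q).2 i) - ψ θ ((swapSamples s q).1 i))
        = signedSum s (fun i => ψ θ (q.2 i)) + signedSum (fun i => !s i) fun i => ψ θ (q.1 i) := by
      rw [signedSum, signedSum, ← Finset.sum_add_distrib]
      refine Finset.sum_congr rfl fun i _ => ?_
      by_cases hs : s i <;> simp [swapSamples, hs, boolSign] <;> ring
    rw [this]; ring
  have hgood : ∀ᵐ q ∂(Q.prod Q), ∑ s, f (swapSamples s q) ≤ 2 ^ m * K := by
    have h1 := Measure.quasiMeasurePreserving_fst (μ := Q) (ν := Q) |>.ae (ae_pi_of_ae (m := m) hp)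
    have h2 := Measure.quasiMeasurePreserving_snd (μ := Q) (ν := Q) |>.ae (ae_pi_of_ae (m := m) hp)
    filter_upwards [h1, h2] with q hq1 hq2
    refine (Finset.sum_le_sum fun s _ => hbound s q).trans ?_
    rw [Finset.sum_add_distrib, ← Finset.mul_sum, ← Finset.mul_sum]
    have hneg : ∑ s : Fin m → Bool, expSup (fun θ => 2 * (lam * (signedSum (fun i => !s i)
        (fun i => ψ θ (q.1 i)) - Δ)))
        = ∑ s : Fin m → Bool, expSup (fun θ => 2 * (lam * (signedSum s
        (fun i => ψ θ (q.1 i)) - Δ))) :=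
      Function.Bijective.sum_comp (e := fun (s : Fin m → Bool) i => !s i)
        (Function.Involutive.bijective fun s => by funext i; simp)
        (fun s => expSup (fun θ => 2 * (lam * (signedSum s (fun i => ψ θ (q.1 i)) - Δ))))
    rw [hneg]
    linarith [hR q.1 hq1, hR q.2 hq2]
  have hfswap : ∀ s, Integrable (fun q => f (swapSamples s q)) (Q.prod Q) := fun s =>
    (measurePreserving_swapSamples D s).integrable_comp_of_integrable hfint
  have htotal : (2 : ℝ) ^ m * ∫ q, f q ∂(Q.prod Q) ≤ 2 ^ m * K := by
    calc (2 : ℝ) ^ m * ∫ q, f q ∂(Q.prod Q)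
        = ∑ s : Fin m → Bool, ∫ q, f (swapSamples s q) ∂(Q.prod Q) := by
          rw [← Finset.sum_congr rfl fun s _ => hswap s]; simp
      _ = ∫ q, ∑ s, f (swapSamples s q) ∂(Q.prod Q) :=
          (integral_finsetSum _ fun s _ => hfswap s).symm
      _ ≤ ∫ _q, 2 ^ m * K ∂(Q.prod Q) :=
          integral_mono_ae (integrable_finsetSum _ fun s _ => hfswap s) (integrable_const _) hgood
      _ = 2 ^ m * K := by simp
  have hFint : Integrable (fun x : Fin m → 𝓧 =>
      expSup (fun θ => lam * (∑ i, (∫ y, ψ θ y ∂D - ψ θ (x i)) - 2 * Δ))) Q := by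
    refine integrable_expSup (B := lam * (m * (2 * b) - 2 * Δ)) (fun θ => ?_) fun x θ => ?_
    · exact measurable_const.mul ((Finset.measurable_sum _ fun i _ =>
        measurable_const.sub (hm' θ i)).sub_const _)
    · have := hsumb (fun i => ∫ y, ψ θ y ∂D) (fun i => ψ θ (x i)) (fun i => hmean _)
        fun i => hb _ _
      gcongr
  calc _ ≤ ∫ x, ∫ x', f (x, x') ∂Q ∂Q := integral_mono hFint hfint.integral_prod_left hJensen
    _ = ∫ q, f q ∂(Q.prod Q) := (integral_prod _ hfint).symm
    _ ≤ K := le_of_mul_le_mul_left htotal (by positivity)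

/-- The one-sided uniform deviation inequality for a finite class. -/
theorem measure_deviation_le (D : Measure 𝓧) [IsProbabilityMeasure D] {ι : Type*} [Finite ι]
    [Nonempty ι] (hm : 0 < m) {ψ : ι → 𝓧 → ℝ} (hψ : ∀ θ, Measurable (ψ θ)) {b : ℝ}
    (hb : ∀ θ x, |ψ θ x| ≤ b) {p : 𝓧 → Prop} (hp : ∀ᵐ x ∂D, p x) {r C δ : ℝ} (hr : 0 < r)
    (hC : 0 ≤ C) (hδ : 0 < δ) (hδ1 : δ ≤ 1) (hψr : ∀ θ x, p x → |ψ θ x| ≤ r)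
    (hcov : ∀ x : Fin m → 𝓧, (∀ i, p (x i)) → ∀ η : ℝ, 0 < η → ∃ F : Finset (Fin m → ℝ),
      (F.card : ℝ) ≤ Real.exp (C / η ^ 2) ∧ ∀ θ, ∃ c ∈ F, ∀ i, |ψ θ (x i) - c i| ≤ η) (J : ℕ) :
    (Measure.pi fun _ : Fin m => D) {x | ∃ θ,
      2 * (m * (r * (2 ^ J)⁻¹) + J * (6 * √(m * C))) + 4 * √(9 * m * r ^ 2 / 2 * Real.log (2 / δ))
        < ∑ i, (∫ y, ψ θ y ∂D - ψ θ (x i))} ≤ ENNReal.ofReal δ := by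
  set Q := Measure.pi fun _ : Fin m => D with hQ
  have hm0 : (0 : ℝ) < m := by exact_mod_cast hm
  set Δ := m * (r * (2 ^ J)⁻¹) + J * (6 * √(m * C)) with hΔ
  set V := 9 * m * r ^ 2 / 2 with hV
  have hV0 : 0 < V := by positivity
  have hlog : 0 < Real.log (2 / δ) := Real.log_pos (by rw [lt_div_iff₀ hδ]; linarith)
  set u := 4 * √(V * Real.log (2 / δ)) with hu
  have hu0 : 0 < u := by positivity
  have hu2 : u ^ 2 = 16 * (V * Real.log (2 / δ)) := by
    rw [hu, mul_pow, Real.sq_sqrt (by positivity)]; norm_num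
  set lam := u / (8 * V) with hlam
  have hlam0 : 0 ≤ lam := by positivity
  set K := 2 * Real.exp ((2 * lam) ^ 2 * V) with hK
  let F : (Fin m → 𝓧) → ℝ := fun x =>
    expSup (fun θ => lam * (∑ i, (∫ y, ψ θ y ∂D - ψ θ (x i)) - 2 * Δ))
  have hmean : ∀ θ, |∫ y, ψ θ y ∂D| ≤ b := fun θ => by
    have := norm_integral_le_of_norm_le_const (μ := D) (f := ψ θ) (C := b)
      (ae_of_all _ fun x => hb θ x)
    simpa using this
  have hFint : Integrable F Q := by
    refine integrable_expSup (B := lam * (m * (2 * b) - 2 * Δ)) (fun θ => ?_) fun x θ => ?_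
    · exact measurable_const.mul ((Finset.measurable_sum _ fun i _ =>
        measurable_const.sub ((hψ θ).comp (measurable_pi_apply i))).sub_const _)
    · have : ∑ i, (∫ y, ψ θ y ∂D - ψ θ (x i)) ≤ m * (2 * b) := by
        calc _ ≤ ∑ _i : Fin m, 2 * b := Finset.sum_le_sum fun i _ => by
              linarith [(abs_le.1 (hmean θ)).2, (abs_le.1 (hb θ (x i))).1]
          _ = _ := by simp
      gcongr
  have hFle : ∫ x, F x ∂Q ≤ K := by
    refine integral_expSup_le D hψ hb hp hlam0 fun x hx => ?_
    obtain ⟨g, hg, hgsum⟩ := exists_chaining_bound hm (fun θ i => ψ θ (x i)) hr hC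
      (fun θ i => hψr θ _ (hx i)) (hcov x hx) J (lam := 2 * lam) (by positivity)
    refine (Finset.sum_le_sum fun s _ => expSup_le fun θ => ?_).trans hgsum
    rw [← mul_assoc]
    exact hg s θ
  have hsub : {x | ∃ θ, 2 * Δ + u < ∑ i, (∫ y, ψ θ y ∂D - ψ θ (x i))}
      ⊆ {x | Real.exp (lam * u) ≤ F x} := by
    rintro x ⟨θ, hθ⟩
    refine le_trans (Real.exp_le_exp.2 ?_) (exp_le_expSup _ θ)
    gcongr
    linarith
  have hmarkov := mul_meas_ge_le_integral_of_nonneg (μ := Q) (f := F)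
    (ae_of_all _ fun x => expSup_nonneg _) hFint (Real.exp (lam * u))
  have hreal : Q.real {x | Real.exp (lam * u) ≤ F x} ≤ δ := by
    have h1 : Real.exp (lam * u) * Q.real {x | Real.exp (lam * u) ≤ F x} ≤ K := hmarkov.trans hFle
    have h2 : K = Real.exp (lam * u) * δ := by
      have h3 : (2 * lam) ^ 2 * V = lam * u + Real.log (δ / 2) := by
        have h4 : Real.log (δ / 2) = -Real.log (2 / δ) := by rw [← Real.log_inv, inv_div]
        have h5 : Real.log (2 / δ) = u ^ 2 / (16 * V) := by rw [hu2]; field_simp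
        rw [h4, h5, hlam]
        field_simp
        norm_num
      rw [hK, h3, Real.exp_add, Real.exp_log (by positivity)]; ring
    rw [h2] at h1
    exact le_of_mul_le_mul_left h1 (Real.exp_pos _)
  refine (measure_mono hsub).trans ?_
  rw [← ofReal_measureReal (measure_ne_top Q _)]
  exact ENNReal.ofReal_le_ofReal hreal

/-- The one-sided uniform deviation inequality for a class with a countable subclass that is
dense in the supremum norm on the support of the distribution. -/
theorem exists_uniform_deviation (D : Measure 𝓧) [IsProbabilityMeasure D] {α : Type*}
    (hm : 0 < m) {S : Set α} {ψ : α → 𝓧 → ℝ} (hψ : ∀ θ, Measurable (ψ θ)) {b : ℝ}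
    (hb : ∀ θ x, |ψ θ x| ≤ b) {p : 𝓧 → Prop} (hp : ∀ᵐ x ∂D, p x) {r C δ : ℝ} (hr : 0 < r)
    (hC : 0 ≤ C) (hδ : 0 < δ) (hδ1 : δ ≤ 1) (hψr : ∀ θ ∈ S, ∀ x, p x → |ψ θ x| ≤ r)
    (hcov : ∀ x : Fin m → 𝓧, (∀ i, p (x i)) → ∀ η : ℝ, 0 < η → ∃ F : Finset (Fin m → ℝ),
      (F.card : ℝ) ≤ Real.exp (C / η ^ 2) ∧ ∀ θ ∈ S, ∃ c ∈ F, ∀ i, |ψ θ (x i) - c i| ≤ η)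
    {S₀ : Set α} (hS₀S : S₀ ⊆ S) (hS₀ : S₀.Countable)
    (hdense : ∀ θ ∈ S, ∀ η : ℝ, 0 < η → ∃ θ' ∈ S₀, ∀ x, p x → |ψ θ x - ψ θ' x| ≤ η) (J : ℕ) :
    ∃ B : Set (Fin m → 𝓧), (Measure.pi fun _ : Fin m => D) B ≤ ENNReal.ofReal δ ∧
      ∀ x ∉ B, ∀ θ ∈ S, ∑ i, (∫ y, ψ θ y ∂D - ψ θ (x i)) ≤
        2 * (m * (r * (2 ^ J)⁻¹) + J * (6 * √(m * C))) +
          4 * √(9 * m * r ^ 2 / 2 * Real.log (2 / δ)) := by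
  set Q := Measure.pi fun _ : Fin m => D with hQ
  set t := 2 * (m * (r * (2 ^ J)⁻¹) + J * (6 * √(m * C))) +
    4 * √(9 * m * r ^ 2 / 2 * Real.log (2 / δ)) with ht
  rcases S₀.eq_empty_or_nonempty with rfl | hne
  · refine ⟨∅, by simp, fun x _ θ hθ => ?_⟩
    obtain ⟨θ', hθ', -⟩ := hdense θ hθ 1 one_pos
    exact absurd hθ' (Set.notMem_empty _)
  obtain ⟨e, he⟩ := hS₀.exists_eq_range hne
  have heS : ∀ j, e j ∈ S := fun j => hS₀S (he ▸ Set.mem_range_self j)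
  let A : ℕ → Set (Fin m → 𝓧) := fun q =>
    {x | ∃ j : Fin (q + 1), t < ∑ i, (∫ y, ψ (e j) y ∂D - ψ (e j) (x i))}
  have hA : ∀ q, Q (A q) ≤ ENNReal.ofReal δ := fun q =>
    measure_deviation_le D hm (ψ := fun j : Fin (q + 1) => ψ (e j)) (fun j => hψ _)
      (fun j x => hb _ x) hp hr hC hδ hδ1 (fun j x hx => hψr _ (heS j) x hx)
      (fun x hx η hη => by
        obtain ⟨F, h1, h2⟩ := hcov x hx η hη
        exact ⟨F, h1, fun j => h2 _ (heS j)⟩) J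
  have hmono : Monotone A := by
    rintro q q' hqq x ⟨j, hj⟩
    exact ⟨⟨j, by omega⟩, hj⟩
  have hbad : Q {x | ¬ ∀ i, p (x i)} = 0 := ae_pi_of_ae hp
  refine ⟨(⋃ q, A q) ∪ {x | ¬ ∀ i, p (x i)}, ?_, fun x hx θ hθ => ?_⟩
  · refine (measure_union_le _ _).trans ?_
    rw [hbad, add_zero, hmono.measure_iUnion]
    exact iSup_le hA
  · rw [Set.mem_union, not_or] at hx
    have hxp : ∀ i, p (x i) := by simpa using hx.2
    have hint : ∀ θ, Integrable (ψ θ) D := fun θ =>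
      Integrable.of_bound (hψ θ).aestronglyMeasurable b (ae_of_all _ fun x => hb θ x)
    refine le_of_forall_pos_le_add fun ε hε => ?_
    set η := ε / (2 * m) with hη
    have hm0 : (0 : ℝ) < m := by exact_mod_cast hm
    have hη0 : 0 < η := by positivity
    obtain ⟨θ', hθ', happ⟩ := hdense θ hθ η hη0
    obtain ⟨j, rfl⟩ : θ' ∈ Set.range e := he ▸ hθ'
    have hj : ∑ i, (∫ y, ψ (e j) y ∂D - ψ (e j) (x i)) ≤ t := by
      by_contra hcon
      exact hx.1 (Set.mem_iUnion.2 ⟨j, ⟨j, by omega⟩, not_le.1 hcon⟩)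
    have hmean : |∫ y, ψ θ y ∂D - ∫ y, ψ (e j) y ∂D| ≤ η := by
      rw [← integral_sub (hint _) (hint _)]
      have := norm_integral_le_of_norm_le_const (μ := D) (f := fun y => ψ θ y - ψ (e j) y)
        (C := η) (by filter_upwards [hp] with y hy using happ y hy)
      simpa using this
    calc ∑ i, (∫ y, ψ θ y ∂D - ψ θ (x i))
        ≤ ∑ i, ((∫ y, ψ (e j) y ∂D - ψ (e j) (x i)) + 2 * η) := by
          refine Finset.sum_le_sum fun i _ => ?_
          have h1 := abs_le.1 hmean
          have h2 := abs_le.1 (happ (x i) (hxp i))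
          linarith
      _ = ∑ i, (∫ y, ψ (e j) y ∂D - ψ (e j) (x i)) + m * (2 * η) := by
          rw [Finset.sum_add_distrib]; simp
      _ = ∑ i, (∫ y, ψ (e j) y ∂D - ψ (e j) (x i)) + ε := by
          rw [hη]; field_simp
      _ ≤ t + ε := by gcongr

end Symmetrization

/-! ### Deviations of the losses of a class with a covering constant -/

/-- A class of continuous functions has a countable subclass that is dense in the supremum norm on
a given compact set. -/
theorem exists_countable_uniform_dense {α X : Type*} [MetricSpace X] [SecondCountableTopology X]
    (K : Set X) (hK : IsCompact K) (S : Set α) (F : α → X → ℝ) (hF : ∀ θ, Continuous (F θ)) :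
    ∃ S₀ ⊆ S, S₀.Countable ∧ ∀ θ ∈ S, ∀ η : ℝ, 0 < η →
      ∃ θ' ∈ S₀, ∀ x ∈ K, |F θ x - F θ' x| ≤ η := by
  have : CompactSpace K := isCompact_iff_compactSpace.1 hK
  let Φ : α → C(K, ℝ) := fun θ => ⟨fun x => F θ x, (hF θ).comp continuous_subtype_val⟩
  obtain ⟨T, hTS, hTc, hT⟩ :=
    (TopologicalSpace.IsSeparable.of_separableSpace (Φ '' S)).exists_countable_dense_subset
  have hg : ∀ f : T, ∃ θ ∈ S, Φ θ = f := fun f => hTS f.2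
  choose g hgS hgΦ using hg
  have := hTc.to_subtype
  refine ⟨Set.range g, Set.range_subset_iff.2 hgS, Set.countable_range g, fun θ hθ η hη => ?_⟩
  obtain ⟨f, hf, hd⟩ := Metric.mem_closure_iff.1 (hT (Set.mem_image_of_mem Φ hθ)) η hη
  refine ⟨g ⟨f, hf⟩, Set.mem_range_self _, fun x hx => ?_⟩
  have h1 := (ContinuousMap.dist_apply_le_dist (f := Φ θ) (g := Φ (g ⟨f, hf⟩)) ⟨x, hx⟩)
  rw [hgΦ ⟨f, hf⟩] at h1
  rw [← Real.dist_eq]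
  have h2 := congrArg (fun φ : C(K, ℝ) => φ ⟨x, hx⟩) (hgΦ ⟨f, hf⟩)
  refine le_trans (le_of_eq ?_) (h1.trans hd.le)
  rw [← h2]; rfl

section CoveringConstant

variable {τ d n : ℕ} {α : Type*} {S : Set α} {F : α → Tokens τ d → ℝ} {B C : ℝ}

theorem IsCoveringConstant.nonneg (h : IsCoveringConstant {f | ∃ θ ∈ S, f = F θ} B n C)
    (hB : 0 ≤ B) : 0 ≤ C := by
  have h1 := (h 1 one_pos (fun _ => 0) (fun _ => by simpa using hB)).2
  have h2 := Real.log_natCast_nonneg (Metric.coveringNumber 1 {v : Fin n → ℝ |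
    ∃ f ∈ {f | ∃ θ ∈ S, f = F θ}, v = fun i => f ((fun _ => 0 : Fin n → Tokens τ d) i)}).toNat
  simpa using h2.trans h1

/-- A covering constant at sample size `n` serves smaller samples, which are padded by zeros. -/
theorem IsCoveringConstant.exists_cover (h : IsCoveringConstant {f | ∃ θ ∈ S, f = F θ} B n C)
    (hB : 0 ≤ B) {m : ℕ} (hmn : m ≤ n) (x : Fin m → Tokens τ d) (hx : ∀ i, ‖x i‖ ≤ B) {ε : ℝ}
    (hε : 0 < ε) : ∃ A : Finset (Fin m → ℝ), (A.card : ℝ) ≤ Real.exp (C / ε ^ 2) ∧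
      ∀ θ ∈ S, ∃ c ∈ A, ∀ i, |F θ (x i) - c i| ≤ ε := by
  classical
  let y : Fin n → Tokens τ d := fun j => if hj : (j : ℕ) < m then x ⟨j, hj⟩ else 0
  have hy : ∀ j, ‖y j‖ ≤ B := fun j => by
    by_cases hj : (j : ℕ) < m
    · simpa [y, hj] using hx ⟨j, hj⟩
    · simpa [y, hj] using hB
  lift ε to ℝ≥0 using hε.le
  obtain ⟨hfin, hlog⟩ := h ε (by exact_mod_cast hε) y hy
  obtain ⟨A, -, hAfin, hAcov, hAcard⟩ := Metric.exists_set_encard_eq_coveringNumber hfin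
  refine ⟨hAfin.toFinset.image fun c i => c (Fin.castLE hmn i), ?_, fun θ hθ => ?_⟩
  · rw [← hAcard, hAfin.encard_eq_coe_toFinset_card, ENat.toNat_natCast] at hlog
    refine le_trans (Nat.cast_le.2 Finset.card_image_le) ?_
    rcases Nat.eq_zero_or_pos hAfin.toFinset.card with h0 | hpos
    · rw [h0]; simpa using (Real.exp_pos _).le
    · exact (Real.log_le_iff_le_exp (by exact_mod_cast hpos)).1 hlog
  · obtain ⟨c, hcA, hc⟩ := hAcov (x := fun j => F θ (y j)) ⟨F θ, ⟨θ, hθ, rfl⟩, rfl⟩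
    refine ⟨_, Finset.mem_image_of_mem _ (hAfin.mem_toFinset.2 hcA), fun i => ?_⟩
    have hc' : edist (fun j => F θ (y j)) c ≤ (ε : ℝ≥0∞) := hc
    rw [edist_nndist] at hc'
    have hc'' : dist (fun j => F θ (y j)) c ≤ ε := by exact_mod_cast hc'
    have := (dist_pi_le_iff ε.2).1 hc'' (Fin.castLE hmn i)
    rw [Real.dist_eq] at this
    simpa [y] using this

/-- In a symmetric class the functions `± f` are covered by one centre only at scales `ε ≥ |f|`, so
that a covering constant controls the supremum of the class. -/
theorem IsCoveringConstant.sq_le (h : IsCoveringConstant {f | ∃ θ ∈ S, f = F θ} B n C)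
    (hn : 0 < n) (hsymm : ∀ θ ∈ S, ∃ θ' ∈ S, ∀ x, F θ' x = -F θ x) {θ : α} (hθ : θ ∈ S)
    {x : Tokens τ d} (hx : ‖x‖ ≤ B) : Real.log 2 * F θ x ^ 2 ≤ C := by
  have hB : 0 ≤ B := (norm_nonneg _).trans hx
  have hlt : ∀ ε : ℝ, 0 < ε → ε < |F θ x| → Real.log 2 * ε ^ 2 ≤ C := by
    intro ε hε hεF
    obtain ⟨A, hA, hc⟩ := h.exists_cover hB le_rfl (fun _ => x) (fun _ => hx) hε
    obtain ⟨θ', hθ', hneg⟩ := hsymm θ hθ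
    obtain ⟨c, hcA, hc1⟩ := hc θ hθ
    obtain ⟨c', hcA', hc2⟩ := hc θ' hθ'
    have hne : c ≠ c' := by
      rintro rfl
      have h1 := abs_le.1 (hc1 ⟨0, hn⟩)
      have h2 := abs_le.1 (hc2 ⟨0, hn⟩)
      rw [hneg] at h2
      have h3 : |F θ x| ≤ ε := abs_le.2 ⟨by linarith, by linarith⟩
      linarith
    have hcard : 2 ≤ A.card := Finset.one_lt_card.2 ⟨c, hcA, c', hcA', hne⟩
    have h2 : (2 : ℝ) ≤ Real.exp (C / ε ^ 2) := le_trans (by exact_mod_cast hcard) hA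
    have h3 := (Real.log_le_iff_le_exp two_pos).2 h2
    rwa [le_div_iff₀ (by positivity)] at h3
  by_contra! hcon
  have hlog : 0 < Real.log 2 := Real.log_pos one_lt_two
  have hC0 := h.nonneg hB
  -- a scale strictly between `√(C / log 2)` and `|F θ x|`
  have hsq : √(C / Real.log 2) < |F θ x| := by
    rw [Real.sqrt_lt' (by
      rw [abs_pos]; rintro h0
      rw [h0] at hcon; simp at hcon; linarith), sq_abs, div_lt_iff₀ hlog]
    linarith
  obtain ⟨ε, h1, h2⟩ := exists_between hsq
  have hε : 0 < ε := (Real.sqrt_nonneg _).trans_lt h1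
  have h3 := hlt ε hε h2
  rw [Real.sqrt_lt' hε, div_lt_iff₀ hlog] at h1
  linarith

/-- Two-sided uniform deviations of the centred losses `l(f(x), y) - l(0, y)`. -/
theorem exists_loss_deviation (h : IsCoveringConstant {f | ∃ θ ∈ S, f = F θ} B n C) (hB : 0 ≤ B)
    (hF : ∀ θ, Continuous (F θ)) {l : ℝ → ℝ → ℝ} {b : ℝ} {K : ℝ≥0} (hl : ∀ a y, |l a y| ≤ b)
    (hl₁ : ∀ y, LipschitzWith K fun a => l a y) (hl₂ : ∀ a, LipschitzWith K fun y => l a y)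
    (hK : 0 < K) (D : Measure (Tokens τ d)) [IsProbabilityMeasure D] {g : Tokens τ d → ℝ}
    (hg : Measurable g) (hD : ∀ᵐ x ∂D, ‖x‖ ≤ B) {m : ℕ} (hm : 0 < m) (hmn : m ≤ n) {r δ : ℝ}
    (hr : 0 < r) (hψr : ∀ θ ∈ S, ∀ x, ‖x‖ ≤ B → |l (F θ x) (g x) - l 0 (g x)| ≤ r) (hδ : 0 < δ)
    (hδ1 : δ ≤ 1) (J : ℕ) :
    ∃ A : Set (Fin m → Tokens τ d), (Measure.pi fun _ : Fin m => D) A ≤ 2 * ENNReal.ofReal δ ∧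
      ∀ x ∉ A, ∀ θ ∈ S,
        |m * (risk l D g (F θ) - risk l D g 0) - (∑ i, l (F θ (x i)) (g (x i))
          - ∑ i, l 0 (g (x i)))| ≤
        2 * (m * (r * (2 ^ J)⁻¹) + J * (6 * √(m * (K ^ 2 * C)))) +
          4 * √(9 * m * r ^ 2 / 2 * Real.log (2 / δ)) := by
  classical
  have hC0 := h.nonneg hB
  have hlcont : Continuous (Function.uncurry l) := (LipschitzWith.uncurry hl₁ hl₂).continuous
  have hmeas : ∀ f : Tokens τ d → ℝ, Measurable f → Measurable fun x => l (f x) (g x) :=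
    fun f hf => hlcont.measurable.comp (hf.prodMk hg)
  have hmF : ∀ θ, Measurable fun x => l (F θ x) (g x) := fun θ => hmeas _ (hF θ).measurable
  have hm0 : Measurable fun x => l 0 (g x) := hmeas (fun _ => 0) measurable_const
  have hint : ∀ f : Tokens τ d → ℝ, Measurable f → Integrable (fun x => l (f x) (g x)) D :=
    fun f hf => Integrable.of_bound (hmeas f hf).aestronglyMeasurable b (ae_of_all _ fun x => hl _ _)
  obtain ⟨S₀, hS₀S, hS₀c, hdense⟩ := exists_countable_uniform_dense (Metric.closedBall 0 B)
    (isCompact_closedBall (0 : Tokens τ d) B) S F hF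
  have hK' : (0 : ℝ) < K := by exact_mod_cast hK
  have hlip : ∀ a a' y, |l a y - l a' y| ≤ K * |a - a'| := fun a a' y => by
    simpa [Real.dist_eq] using (hl₁ y).dist_le_mul a a'
  have hside : ∀ κ : ℝ, |κ| = 1 → ∃ A : Set (Fin m → Tokens τ d),
      (Measure.pi fun _ : Fin m => D) A ≤ ENNReal.ofReal δ ∧ ∀ x ∉ A, ∀ θ ∈ S,
        κ * (m * (risk l D g (F θ) - risk l D g 0) - (∑ i, l (F θ (x i)) (g (x i))
          - ∑ i, l 0 (g (x i)))) ≤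
        2 * (m * (r * (2 ^ J)⁻¹) + J * (6 * √(m * (K ^ 2 * C)))) +
          4 * √(9 * m * r ^ 2 / 2 * Real.log (2 / δ)) := by
    intro κ hκ
    obtain ⟨A, hA, hAx⟩ := exists_uniform_deviation D hm (S := S) (b := 2 * b)
      (ψ := fun θ x => κ * (l (F θ x) (g x) - l 0 (g x)))
      (fun θ => ((hmF θ).sub hm0).const_mul κ)
      (fun θ x => by
        rw [abs_mul, hκ, one_mul]
        exact (abs_sub _ _).trans (by linarith [hl (F θ x) (g x), hl 0 (g x)]))
      hD hr (C := K ^ 2 * C) (by positivity) hδ hδ1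
      (fun θ hθ x hx => by rw [abs_mul, hκ, one_mul]; exact hψr θ hθ x hx)
      (fun x hx η hη => by
        obtain ⟨A, hA, hc⟩ := h.exists_cover hB hmn x hx (ε := η / K) (by positivity)
        refine ⟨A.image fun c i => κ * (l (c i) (g (x i)) - l 0 (g (x i))), ?_, fun θ hθ => ?_⟩
        · refine le_trans (by exact_mod_cast Finset.card_image_le) (hA.trans (le_of_eq ?_))
          congr 1; field_simp
        · obtain ⟨c, hcA, hc⟩ := hc θ hθ
          refine ⟨_, Finset.mem_image_of_mem _ hcA, fun i => ?_⟩
          rw [← mul_sub, abs_mul, hκ, one_mul, sub_sub_sub_cancel_right]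
          refine (hlip _ _ _).trans ?_
          have := hc i
          rw [le_div_iff₀ hK'] at this
          linarith)
      hS₀S hS₀c
      (fun θ hθ η hη => by
        obtain ⟨θ', hθ', hd⟩ := hdense θ hθ (η / K) (by positivity)
        refine ⟨θ', hθ', fun x hx => ?_⟩
        rw [← mul_sub, abs_mul, hκ, one_mul, sub_sub_sub_cancel_right]
        refine (hlip _ _ _).trans ?_
        have := hd x (mem_closedBall_zero_iff.2 hx)
        rw [le_div_iff₀ hK'] at this
        linarith) J
    refine ⟨A, hA, fun x hx θ hθ => le_of_eq_of_le ?_ (hAx x hx θ hθ)⟩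
    have hmean : ∫ y, κ * (l (F θ y) (g y) - l 0 (g y)) ∂D
        = κ * (risk l D g (F θ) - risk l D g 0) := by
      rw [integral_const_mul, integral_sub (hint _ (hF θ).measurable)
        (hint (fun _ => 0) measurable_const)]
      rfl
    rw [hmean]
    simp only [Finset.sum_sub_distrib, ← Finset.mul_sum, Finset.sum_const, Finset.card_univ,
      Fintype.card_fin, nsmul_eq_mul]
    ring
  obtain ⟨A₁, hA₁, h₁⟩ := hside 1 (by simp)
  obtain ⟨A₂, hA₂, h₂⟩ := hside (-1) (by simp)
  refine ⟨A₁ ∪ A₂, (measure_union_le _ _).trans ?_, fun x hx θ hθ => ?_⟩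
  · rw [two_mul]; exact add_le_add hA₁ hA₂
  · rw [Set.mem_union, not_or] at hx
    have e1 := h₁ x hx.1 θ hθ
    have e2 := h₂ x hx.2 θ hθ
    rw [abs_le]
    constructor <;> linarith

end CoveringConstant

/-! ### The excess risk of empirical risk minimizers -/

/-- The deviation bound at sample size `n`, for the number `J` of chaining levels with
`2^J ≥ (1 + Bw) (1 + n / C)` and the failure probability `δ / 4`. -/
theorem deviation_bound_le {n C K Bw b r δ : ℝ} (hn : 0 < n) (hC : 0 < C) (hK : 0 < K)
    (hBw : 0 ≤ Bw) (hr : 0 ≤ r) (hrb : r ≤ 2 * b) (hrBw : r ≤ K * Bw)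
    (hrC : r ≤ K * √(C / Real.log 2)) (hδ : 0 < δ) (hδ1 : δ < 1) {J : ℕ}
    (hJ : J = ⌈(Real.log (1 + Bw) + Real.log (1 + n / C)) / Real.log 2⌉₊) :
    2 * (n * (r * (2 ^ J)⁻¹) + J * (6 * √(n * (K ^ 2 * C)))) +
        4 * √(9 * n * r ^ 2 / 2 * Real.log (2 / (δ / 4))) ≤
      n * (32 * (b * √(Real.log (1 / δ) / n) + (1 + Real.log (1 + Bw)) *
        (K * √(C / n) * (1 + Real.log (1 + n / C))))) := by
  set a := Real.log (1 + Bw) with ha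
  set c := Real.log (1 + n / C) with hc
  set ℓ := Real.log (1 / δ) with hℓ
  have hnC : 0 < n / C := by positivity
  have ha0 : 0 ≤ a := Real.log_nonneg (by linarith)
  have hc0 : 0 ≤ c := Real.log_nonneg (by linarith)
  have hℓ0 : 0 ≤ ℓ := Real.log_nonneg (by rw [le_div_iff₀ hδ]; linarith)
  have hlog2 : 0 < Real.log 2 := Real.log_pos one_lt_two
  have hb0 : 0 ≤ b := by linarith
  set s := √n with hs
  set q := √C with hq
  have hs0 : 0 < s := Real.sqrt_pos.2 hn
  have hq0 : 0 < q := Real.sqrt_pos.2 hC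
  have hs2 : s ^ 2 = n := Real.sq_sqrt hn.le
  have hq2 : q ^ 2 = C := Real.sq_sqrt hC.le
  have e1 : √(n * (K ^ 2 * C)) = K * (s * q) := by
    rw [Real.sqrt_mul hn.le, Real.sqrt_mul (by positivity), Real.sqrt_sq hK.le]; ring
  have e2 : √(C / n) = q / s := Real.sqrt_div hC.le n
  have e3 : √(ℓ / n) = √ℓ / s := Real.sqrt_div hℓ0 n
  have hJle : (J : ℝ) ≤ 1 + 3 / 2 * (a + c) := by
    have h1 : (J : ℝ) < (a + c) / Real.log 2 + 1 := hJ ▸ Nat.ceil_lt_add_one (by positivity)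
    have h2 : (a + c) / Real.log 2 ≤ 3 / 2 * (a + c) := by
      rw [div_le_iff₀ hlog2]
      nlinarith [Real.log_two_gt_d9, add_nonneg ha0 hc0]
    linarith
  have hpow : (1 + Bw) * (1 + n / C) ≤ 2 ^ J := by
    have h1 : (a + c) / Real.log 2 ≤ J := hJ ▸ Nat.le_ceil _
    rw [div_le_iff₀ hlog2] at h1
    calc (1 + Bw) * (1 + n / C) = Real.exp (a + c) := by
          rw [Real.exp_add, Real.exp_log (by linarith), Real.exp_log (by linarith)]
      _ ≤ Real.exp (J * Real.log 2) := Real.exp_le_exp.2 h1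
      _ = 2 ^ J := by rw [mul_comm, Real.exp_mul, Real.exp_log two_pos, Real.rpow_natCast]
  have t1 : n * (r * (2 ^ J)⁻¹) ≤ K * (s * q) := by
    have h2 : s / q ≤ 1 + n / C := by
      rw [← hs2, ← hq2, ← div_pow]
      nlinarith [sq_nonneg (s / q - 1), show 0 < s / q by positivity]
    have h3 : Bw * (s / q) ≤ 2 ^ J := by
      refine le_trans ?_ hpow
      gcongr
      linarith
    rw [← mul_assoc, ← div_eq_mul_inv, div_le_iff₀ (by positivity)]
    calc n * r ≤ n * (K * Bw) := by gcongr
      _ = K * (s * q) * (Bw * (s / q)) := by rw [← hs2]; field_simp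
      _ ≤ _ := by gcongr
  have t2 : 4 * √(9 * n * r ^ 2 / 2 * Real.log (2 / (δ / 4)))
      ≤ 18 * (K * (s * q)) + 18 * (b * (s * √ℓ)) := by
    have h8 : Real.log (2 / (δ / 4)) = 3 * Real.log 2 + ℓ := by
      rw [show 2 / (δ / 4) = 2 ^ 3 * (1 / δ) by field_simp; norm_num,
        Real.log_mul (by norm_num) (by positivity), Real.log_pow, ← hℓ]
      norm_num
    have h9 : √(3 * Real.log 2 + ℓ) ≤ √(3 * Real.log 2) + √ℓ := by
      refine Real.sqrt_le_iff.2 ⟨by positivity, ?_⟩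
      rw [add_sq, Real.sq_sqrt (by positivity), Real.sq_sqrt hℓ0]
      have : 0 ≤ 2 * √(3 * Real.log 2) * √ℓ := by positivity
      linarith
    have h10 : √(9 * n * r ^ 2 / 2 * (3 * Real.log 2 + ℓ))
        ≤ 9 / 4 * (r * s * √(3 * Real.log 2 + ℓ)) := by
      refine Real.sqrt_le_iff.2 ⟨by positivity, ?_⟩
      have h11 : √(3 * Real.log 2 + ℓ) ^ 2 = 3 * Real.log 2 + ℓ := Real.sq_sqrt (by positivity)
      calc 9 * n * r ^ 2 / 2 * (3 * Real.log 2 + ℓ)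
          ≤ 81 / 16 * (n * r ^ 2 * (3 * Real.log 2 + ℓ)) := by
            have : 0 ≤ n * r ^ 2 * (3 * Real.log 2 + ℓ) := by positivity
            linarith
        _ = (9 / 4 * (r * s * √(3 * Real.log 2 + ℓ))) ^ 2 := by
            rw [mul_pow, mul_pow, mul_pow, h11, hs2]; ring
    have h12 : r * √(3 * Real.log 2) ≤ 2 * (K * q) := by
      calc r * √(3 * Real.log 2) ≤ K * √(C / Real.log 2) * √(3 * Real.log 2) := by gcongr
        _ = K * √(3 * C) := by
            rw [mul_assoc, ← Real.sqrt_mul (by positivity)]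
            congr 2; field_simp
        _ ≤ K * (2 * q) := by
            gcongr
            refine Real.sqrt_le_iff.2 ⟨by positivity, ?_⟩
            rw [mul_pow, hq2]; linarith
        _ = _ := by ring
    rw [h8]
    calc 4 * √(9 * n * r ^ 2 / 2 * (3 * Real.log 2 + ℓ))
        ≤ 4 * (9 / 4 * (r * s * √(3 * Real.log 2 + ℓ))) := by gcongr
      _ ≤ 4 * (9 / 4 * (r * s * (√(3 * Real.log 2) + √ℓ))) := by gcongr
      _ = 9 * s * (r * √(3 * Real.log 2)) + 9 * (r * (s * √ℓ)) := by ring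
      _ ≤ 9 * s * (2 * (K * q)) + 9 * (2 * b * (s * √ℓ)) := by gcongr
      _ = _ := by ring
  rw [e1, e2, e3]
  have hKsq : 0 ≤ K * (s * q) := by positivity
  have hbs : 0 ≤ b * (s * √ℓ) := by positivity
  have hac : 0 ≤ a * c := mul_nonneg ha0 hc0
  have hR : n * (32 * (b * (√ℓ / s) + (1 + a) * (K * (q / s) * (1 + c))))
      = 32 * (b * (s * √ℓ)) + 32 * ((1 + a) * (1 + c)) * (K * (s * q)) := by
    rw [← hs2]; field_simp
  rw [hR]
  have hJ2 : (J : ℝ) * (6 * (K * (s * q))) ≤ (1 + 3 / 2 * (a + c)) * (6 * (K * (s * q))) := by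
    gcongr
  have hfin : (32 + 18 * (a + c)) * (K * (s * q)) ≤ 32 * ((1 + a) * (1 + c)) * (K * (s * q)) := by
    refine mul_le_mul_of_nonneg_right ?_ hKsq
    nlinarith
  linarith

section Continuity

variable {τ d k : ℕ} {σ : EuclideanSpace ℝ (Fin k) → EuclideanSpace ℝ (Fin k)}

theorem continuous_rowMul {m n : ℕ} (W : Matrix (Fin m) (Fin n) ℝ) :
    Continuous fun z : EuclideanSpace ℝ (Fin m) => rowMul z W := by
  have h : LipschitzWith ⟨specNorm W, norm_nonneg _⟩
      fun z : EuclideanSpace ℝ (Fin m) => rowMul z W :=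
    LipschitzWith.of_dist_le_mul fun z z' => by
      rw [dist_eq_norm, dist_eq_norm, ← rowMul_sub]
      exact norm_rowMul_le_specNorm _ _
  exact h.continuous

theorem continuous_normalize {n : ℕ} :
    Continuous (normalize : EuclideanSpace ℝ (Fin n) → EuclideanSpace ℝ (Fin n)) := by
  have h : LipschitzWith 2 (normalize : EuclideanSpace ℝ (Fin n) → EuclideanSpace ℝ (Fin n)) :=
    LipschitzWith.of_dist_le_mul fun u v => by
      rw [dist_eq_norm, dist_eq_norm]
      exact norm_normalize_sub_le u v
  exact h.continuous

theorem continuous_attention [NeZero τ] (p : LayerParams d k) (t : Fin τ) :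
    Continuous fun Z : Tokens τ d => attention p Z t := by
  have hrow : ∀ {n : ℕ} (W : Matrix (Fin d) (Fin n) ℝ) (r : Fin τ),
      Continuous fun Z : Tokens τ d => rowMul (Z r) W := fun W r =>
    (continuous_rowMul W).comp (continuous_apply r)
  refine continuous_finsetSum _ fun s _ => Continuous.fun_smul ?_ (hrow _ s)
  have hexp : ∀ r, Continuous fun Z : Tokens τ d =>
      Real.exp (inner ℝ (rowMul (Z t) p.WQ) (rowMul (Z r) p.WK)) := fun r =>
    Real.continuous_exp.comp ((hrow _ t).inner (hrow _ r))
  refine (hexp s).div (continuous_finsetSum _ fun r _ => hexp r) fun Z => ?_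
  exact (Finset.sum_pos (fun _ _ => Real.exp_pos _) Finset.univ_nonempty).ne'

theorem continuous_transformer [NeZero τ] (hσ : Continuous σ) (L : ℕ)
    (W : Fin L → LayerParams d k) : Continuous (transformer (τ := τ) σ L W) := by
  induction L with
  | zero => exact continuous_id
  | succ L ih =>
    refine continuous_pi fun t => ?_
    exact continuous_normalize.comp ((continuous_rowMul _).comp (hσ.comp
      (continuous_normalize.comp ((continuous_attention _ t).comp (ih _)))))

theorem continuous_fvlm [NeZero τ] (hσ : Continuous σ) {L : ℕ} (θ : Params L d k) :
    Continuous (fvlm (τ := τ) σ θ) :=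
  continuous_const.inner ((continuous_apply _).comp (continuous_transformer hσ L θ.layer))

end Continuity

theorem abs_fvlm_le {τ d k L : ℕ} [NeZero τ] {C₂ C₂₁ Bw : ℝ}
    {σ : EuclideanSpace ℝ (Fin k) → EuclideanSpace ℝ (Fin k)} (hL : 1 ≤ L) {θ : Params L d k}
    (hθ : θ ∈ paramSet L d k C₂ C₂₁ Bw) (X : Tokens τ d) : |fvlm σ θ X| ≤ Bw := by
  refine (abs_real_inner_le_norm _ _).trans ?_
  have h1 := norm_transformer_le_one (σ := σ) hL θ.layer X
    ⟨τ - 1, Nat.sub_lt (NeZero.pos τ) Nat.one_pos⟩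
  calc _ ≤ ‖θ.w‖ * 1 := by gcongr
    _ ≤ Bw := by rw [mul_one]; exact hθ.2

theorem exists_neg_fvlm {τ d k L : ℕ} [NeZero τ] {C₂ C₂₁ Bw : ℝ}
    (σ : EuclideanSpace ℝ (Fin k) → EuclideanSpace ℝ (Fin k)) {θ : Params L d k}
    (hθ : θ ∈ paramSet L d k C₂ C₂₁ Bw) :
    ∃ θ' ∈ paramSet L d k C₂ C₂₁ Bw, ∀ X : Tokens τ d, fvlm σ θ' X = -fvlm σ θ X :=
  ⟨⟨θ.layer, -θ.w⟩, ⟨hθ.1, by simpa using hθ.2⟩, fun X => by simp [fvlm]⟩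

/-- With high probability, an empirical risk minimizer over the pooled samples is almost a
minimizer of the pooled risk. The deviations of the two samples are controlled separately, since
their joint law is not specified. -/
theorem exists_pooled_excess_risk_event {τ d N M : ℕ} {α : Type*} {S : Set α}
    {F : α → Tokens τ d → ℝ} {B C Bw : ℝ}
    (h : IsCoveringConstant {f | ∃ θ ∈ S, f = F θ} B (N + M) C) (hB : 0 ≤ B) (hBw : 0 ≤ Bw)
    (hN : 1 ≤ N) (hM : 1 ≤ M) (hF : ∀ θ, Continuous (F θ))
    (hFBw : ∀ θ ∈ S, ∀ x, |F θ x| ≤ Bw) (hsymm : ∀ θ ∈ S, ∃ θ' ∈ S, ∀ x, F θ' x = -F θ x)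
    {l : ℝ → ℝ → ℝ} {b : ℝ} {K : ℝ≥0} (hl : ∀ a y, |l a y| ≤ b)
    (hl₁ : ∀ y, LipschitzWith K fun a => l a y) (hl₂ : ∀ a, LipschitzWith K fun y => l a y)
    (Dt Dm : Measure (Tokens τ d)) [IsProbabilityMeasure Dt] [IsProbabilityMeasure Dm]
    {gt gm : Tokens τ d → ℝ} (hgt : Measurable gt) (hgm : Measurable gm)
    (hDt : ∀ᵐ x ∂Dt, ‖x‖ ≤ B) (hDm : ∀ᵐ x ∂Dm, ‖x‖ ≤ B) {Ω : Type*} [MeasurableSpace Ω]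
    (P : Measure Ω) [IsProbabilityMeasure P] {Xt : Fin N → Ω → Tokens τ d}
    {Xm : Fin M → Ω → Tokens τ d} (hXt : ∀ i, HasLaw (Xt i) Dt P) (hXti : iIndepFun Xt P)
    (hXm : ∀ i, HasLaw (Xm i) Dm P) (hXmi : iIndepFun Xm P) {δ : ℝ} (hδ : 0 < δ) (hδ1 : δ < 1) :
    ∃ E : Set Ω, MeasurableSet E ∧ 1 - δ ≤ P.real E ∧ ∀ ω ∈ E, ∀ θhat ∈ S,
      IsMinOn (fun θ => empRisk l gt gm (fun i => Xt i ω) (fun i => Xm i ω) (F θ)) S θhat →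
      ∀ θ ∈ S, N * risk l Dt gt (F θhat) + M * risk l Dm gm (F θhat) ≤
        N * risk l Dt gt (F θ) + M * risk l Dm gm (F θ) + ((N : ℝ) + M) *
          (128 * (b * √(Real.log (1 / δ) / (N + M)) + (1 + Real.log (1 + Bw)) *
            (K * √(C / (N + M)) * (1 + Real.log (1 + (N + M) / C))))) := by
  have hNM : 0 < N + M := by omega
  have hn : (0 : ℝ) < (N : ℝ) + M := by exact_mod_cast hNM
  have hC0 := h.nonneg hB
  have hb0 : 0 ≤ b := (abs_nonneg _).trans (hl 0 0)
  have hlog2 : 0 < Real.log 2 := Real.log_pos one_lt_two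
  set r := min (2 * b) (K * min Bw √(C / Real.log 2)) with hr
  have hr0 : 0 ≤ r := by positivity
  have hrb : r ≤ 2 * b := min_le_left _ _
  have hrBw : r ≤ K * Bw := (min_le_right _ _).trans (by gcongr; exact min_le_left _ _)
  have hrC : r ≤ K * √(C / Real.log 2) := (min_le_right _ _).trans (by gcongr; exact min_le_right _ _)
  have hψr : ∀ (g : Tokens τ d → ℝ), ∀ θ ∈ S, ∀ x, ‖x‖ ≤ B →
      |l (F θ x) (g x) - l 0 (g x)| ≤ r := by
    intro g θ hθ x hx
    refine le_min ((abs_sub _ _).trans (by linarith [hl (F θ x) (g x), hl 0 (g x)])) ?_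
    have h1 : |l (F θ x) (g x) - l 0 (g x)| ≤ K * |F θ x| := by
      simpa [Real.dist_eq] using (hl₁ (g x)).dist_le_mul (F θ x) 0
    refine h1.trans ?_
    gcongr
    refine le_min (hFBw θ hθ x) (Real.le_sqrt_of_sq_le ?_)
    rw [sq_abs, le_div_iff₀ hlog2, mul_comm]
    exact h.sq_le hNM hsymm hθ hx
  set gen := b * √(Real.log (1 / δ) / (N + M)) + (1 + Real.log (1 + Bw)) *
    (K * √(C / (N + M)) * (1 + Real.log (1 + (N + M) / C))) with hgen
  have hgen0 : 0 ≤ gen := by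
    have h1 : 0 ≤ Real.log (1 + Bw) := Real.log_nonneg (by linarith)
    have h2 : 0 ≤ Real.log (1 + ((N : ℝ) + M) / C) :=
      Real.log_nonneg (by linarith [div_nonneg hn.le hC0])
    positivity
  rcases hr0.eq_or_lt with hr00 | hrpos
  · -- all the losses agree with those of the zero function
    have hrisk : ∀ (D : Measure (Tokens τ d)) (g : Tokens τ d → ℝ), (∀ᵐ x ∂D, ‖x‖ ≤ B) →
        ∀ θ ∈ S, risk l D g (F θ) = risk l D g 0 := by
      intro D g hD θ hθ
      refine integral_congr_ae ?_
      filter_upwards [hD] with x hx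
      have := hψr g θ hθ x hx
      rw [← hr00] at this
      exact sub_eq_zero.1 (abs_nonpos_iff.1 this)
    refine ⟨Set.univ, MeasurableSet.univ, by simp; exact hδ.le, fun ω _ θhat hθhat _ θ hθ => ?_⟩
    rw [hrisk Dt gt hDt θhat hθhat, hrisk Dt gt hDt θ hθ, hrisk Dm gm hDm θhat hθhat,
      hrisk Dm gm hDm θ hθ]
    have : 0 ≤ ((N : ℝ) + M) * (128 * gen) := by positivity
    linarith
  have hKpos : 0 < K := by
    refine pos_iff_ne_zero.2 fun h0 => ?_
    rw [h0] at hrBw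
    simp at hrBw
    linarith
  have hCpos : 0 < C := by
    refine lt_of_le_of_ne hC0 fun h0 => ?_
    rw [← h0] at hrC
    simp at hrC
    linarith
  set J := ⌈(Real.log (1 + Bw) + Real.log (1 + ((N : ℝ) + M) / C)) / Real.log 2⌉₊ with hJ
  have hbound := deviation_bound_le (b := b) hn hCpos (K := K) (by exact_mod_cast hKpos) hBw hr0 hrb
    hrBw hrC hδ hδ1 hJ
  have hmono : ∀ m : ℕ, m ≤ N + M →
      2 * (m * (r * (2 ^ J)⁻¹) + J * (6 * √(m * (K ^ 2 * C)))) +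
          4 * √(9 * m * r ^ 2 / 2 * Real.log (2 / (δ / 4))) ≤ ((N : ℝ) + M) * (32 * gen) := by
    intro m hm
    have hm' : (m : ℝ) ≤ (N : ℝ) + M := by exact_mod_cast hm
    have hlog : 0 ≤ Real.log (2 / (δ / 4)) :=
      Real.log_nonneg (by rw [le_div_iff₀ (by positivity)]; linarith)
    refine le_trans ?_ hbound
    gcongr
  obtain ⟨At, hAt, hAtx⟩ := exists_loss_deviation h hB hF hl hl₁ hl₂ hKpos Dt hgt hDt (m := N)
    (by omega) (by omega) hrpos (hψr gt) (δ := δ / 4) (by positivity) (by linarith) J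
  obtain ⟨Am, hAm, hAmx⟩ := exists_loss_deviation h hB hF hl hl₁ hl₂ hKpos Dm hgm hDm (m := M)
    (by omega) (by omega) hrpos (hψr gm) (δ := δ / 4) (by positivity) (by linarith) J
  have htransfer : ∀ {m : ℕ} (D : Measure (Tokens τ d)) [IsProbabilityMeasure D]
      (X : Fin m → Ω → Tokens τ d), (∀ i, HasLaw (X i) D P) → iIndepFun X P →
      ∀ A : Set (Fin m → Tokens τ d),
        P ((fun ω i => X i ω) ⁻¹' A) ≤ (Measure.pi fun _ : Fin m => D) A := by
    intro m D _ X hX hXi A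
    have h1 := (iIndepFun_iff_map_fun_eq_pi_map fun i => (hX i).aemeasurable).1 hXi
    simp_rw [fun i => (hX i).map_eq] at h1
    rw [← h1]
    exact Measure.le_map_apply (aemeasurable_pi_lambda _ fun i => (hX i).aemeasurable) A
  set bad := ((fun ω i => Xt i ω) ⁻¹' At) ∪ ((fun ω i => Xm i ω) ⁻¹' Am) with hbad
  have hbadle : P bad ≤ ENNReal.ofReal δ := by
    calc P bad ≤ 2 * ENNReal.ofReal (δ / 4) + 2 * ENNReal.ofReal (δ / 4) :=
          (measure_union_le _ _).trans (add_le_add ((htransfer Dt Xt hXt hXti At).trans hAt)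
            ((htransfer Dm Xm hXm hXmi Am).trans hAm))
      _ = ENNReal.ofReal δ := by
          rw [← add_mul, show (2 + 2 : ℝ≥0∞) = ENNReal.ofReal 4 by norm_num,
            ← ENNReal.ofReal_mul (by norm_num)]
          congr 1; ring
  refine ⟨(toMeasurable P bad)ᶜ, (measurableSet_toMeasurable _ _).compl, ?_, ?_⟩
  · rw [probReal_compl_eq_one_sub (measurableSet_toMeasurable _ _), measureReal_def,
      measure_toMeasurable]
    have := ENNReal.toReal_mono ENNReal.ofReal_ne_top hbadle
    rw [ENNReal.toReal_ofReal hδ.le] at this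
    linarith
  · intro ω hω θhat hθhat hmin θ hθ
    have hωbad : ω ∉ bad := fun hh => hω (subset_toMeasurable _ _ hh)
    rw [hbad, Set.mem_union, not_or] at hωbad
    have hT := hmono N (by omega)
    have hT' := hmono M (by omega)
    have a1 := abs_le.1 (hAtx _ hωbad.1 θhat hθhat)
    have a2 := abs_le.1 (hAtx _ hωbad.1 θ hθ)
    have a3 := abs_le.1 (hAmx _ hωbad.2 θhat hθhat)
    have a4 := abs_le.1 (hAmx _ hωbad.2 θ hθ)
    have hopt : ∑ i, l (F θhat (Xt i ω)) (gt (Xt i ω)) + ∑ i, l (F θhat (Xm i ω)) (gm (Xm i ω))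
        ≤ ∑ i, l (F θ (Xt i ω)) (gt (Xt i ω)) + ∑ i, l (F θ (Xm i ω)) (gm (Xm i ω)) :=
      le_of_mul_le_mul_left (isMinOn_iff.1 hmin θ hθ) (one_div_pos.2 hn)
    linarith

/-- From the pooled risk to the risk `R` of one of the two distributions: replacing the other risk
`R'` by `R` costs at most `M ε` on each side of the pooled inequality. -/
theorem excess_risk_le {α : Type*} {S : Set α} {R R' : α → ℝ} {N M b gen K : ℝ} (hM : 0 ≤ M)
    (hNM : 0 < N + M) (hR : ∀ θ, |R θ| ≤ b) (hR' : ∀ θ, |R' θ| ≤ b)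
    (hgen : 0 ≤ gen) (hK : 128 ≤ K) {θhat : α} (hθhat : θhat ∈ S)
    (hpool : ∀ θ ∈ S, N * R θhat + M * R' θhat ≤ N * R θ + M * R' θ + (N + M) * (128 * gen)) :
    R θhat ≤ (⨅ θ : S, R θ.1) + K * (M / (N + M) * (⨆ θ : S, |R' θ.1 - R θ.1|) + gen) := by
  have : Nonempty S := ⟨⟨θhat, hθhat⟩⟩
  set ε := ⨆ θ : S, |R' θ.1 - R θ.1| with hε
  have hbdd : BddAbove (Set.range fun θ : S => |R' θ.1 - R θ.1|) := by
    refine ⟨2 * b, ?_⟩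
    rintro _ ⟨θ, rfl⟩
    exact (abs_sub _ _).trans (by linarith [hR θ.1, hR' θ.1])
  have hεle : ∀ θ ∈ S, |R' θ - R θ| ≤ ε := fun θ hθ => le_ciSup hbdd ⟨θ, hθ⟩
  have hε0 : 0 ≤ ε := (abs_nonneg _).trans (hεle θhat hθhat)
  rw [← sub_le_iff_le_add]
  refine le_ciInf fun θ => ?_
  have h1 := abs_le.1 (hεle θhat hθhat)
  have h2 := abs_le.1 (hεle θ.1 θ.2)
  have h3 := hpool θ.1 θ.2
  have h4 : (N + M) * R θhat ≤ (N + M) * R θ.1 + (2 * M * ε + (N + M) * (128 * gen)) := by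
    nlinarith
  have h5 : R θhat ≤ R θ.1 + (2 * (M / (N + M) * ε) + 128 * gen) := by
    refine le_of_mul_le_mul_left (h4.trans (le_of_eq ?_)) hNM
    field_simp
  have h6 : 0 ≤ M / (N + M) * ε := by positivity
  have h7 : 2 * (M / (N + M) * ε) + 128 * gen ≤ K * (M / (N + M) * ε + gen) := by nlinarith
  linarith

theorem abs_risk_le {τ d : ℕ} {l : ℝ → ℝ → ℝ} {b : ℝ} (hl : ∀ a y, |l a y| ≤ b)
    (D : Measure (Tokens τ d)) [IsProbabilityMeasure D] (g f : Tokens τ d → ℝ) :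
    |risk l D g f| ≤ b := by
  have := norm_integral_le_of_norm_le_const (μ := D) (f := fun X => l (f X) (g X)) (C := b)
    (ae_of_all _ fun x => hl _ _)
  simpa [risk] using this

end VLM

theorem theorem1 :
    ∃ (K : ℝ) (c : ℕ), 0 < K ∧
    ∀ (L d k τ N M : ℕ) [NeZero τ], 1 ≤ L → 1 ≤ d → 1 ≤ N → 1 ≤ M →
    ∀ (C₂ C₂₁ BX Bw : ℝ), 0 ≤ C₂ → 0 ≤ C₂₁ → 0 ≤ BX → 0 ≤ Bw →
    ∀ (Lσ : ℝ≥0) (σ : EuclideanSpace ℝ (Fin k) → EuclideanSpace ℝ (Fin k)),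
      LipschitzWith Lσ σ → σ 0 = 0 →
    -- the explicit value is a covering constant of the model class
    VLM.IsCoveringConstant
      {f : VLM.Tokens τ d → ℝ | ∃ θ ∈ VLM.paramSet L d k C₂ C₂₁ Bw, f = VLM.fvlm σ θ} BX (N + M)
      (K * (max 2 C₂ * max 1 (Lσ : ℝ)) ^ (c * L) * (BX ^ 2 * max 1 BX ^ 4) * Bw ^ 2 * C₂₁ ^ 2 *
        Real.log ((max d k : ℕ) * τ * ((N : ℝ) + M))) ∧
    -- the risk bounds hold for every covering constant
    ∀ Cvlm : ℝ,
      VLM.IsCoveringConstant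
        {f : VLM.Tokens τ d → ℝ | ∃ θ ∈ VLM.paramSet L d k C₂ C₂₁ Bw, f = VLM.fvlm σ θ} BX (N + M)
        Cvlm →
    ∀ (l : ℝ → ℝ → ℝ) (b : ℝ) (Lloss : ℝ≥0),
      (∀ a y, |l a y| ≤ b) →
      (∀ y, LipschitzWith Lloss (fun a => l a y)) → (∀ a, LipschitzWith Lloss (fun y => l a y)) →
    ∀ (Dtxt Dmul : Measure (VLM.Tokens τ d)) [IsProbabilityMeasure Dtxt]
      [IsProbabilityMeasure Dmul] (gtxt gmul : VLM.Tokens τ d → ℝ),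
      Measurable gtxt → Measurable gmul →
      (∀ᵐ X ∂Dtxt, ‖X‖ ≤ BX) → (∀ᵐ X ∂Dmul, ‖X‖ ≤ BX) →
    ∀ {Ω : Type*} [MeasurableSpace Ω] (P : Measure Ω) [IsProbabilityMeasure P]
      (Xtxt : Fin N → Ω → VLM.Tokens τ d) (Xmul : Fin M → Ω → VLM.Tokens τ d),
      (∀ i, HasLaw (Xtxt i) Dtxt P) → iIndepFun Xtxt P →
      (∀ i, HasLaw (Xmul i) Dmul P) → iIndepFun Xmul P →
    ∀ δ : ℝ, 0 < δ → δ < 1 →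
    ∃ E : Set Ω, MeasurableSet E ∧ 1 - δ ≤ P.real E ∧
      ∀ ω ∈ E, ∀ θhat ∈ VLM.paramSet L d k C₂ C₂₁ Bw,
        IsMinOn (fun θ => VLM.empRisk l gtxt gmul (fun i => Xtxt i ω) (fun i => Xmul i ω)
          (VLM.fvlm σ θ)) (VLM.paramSet L d k C₂ C₂₁ Bw) θhat →
        VLM.risk l Dtxt gtxt (VLM.fvlm σ θhat) ≤
          (⨅ θ : VLM.paramSet L d k C₂ C₂₁ Bw, VLM.risk l Dtxt gtxt (VLM.fvlm σ θ.1)) +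
          K * (((M : ℝ) / (N + M)) * (⨆ θ : VLM.paramSet L d k C₂ C₂₁ Bw,
              |VLM.risk l Dmul gmul (VLM.fvlm σ θ.1) - VLM.risk l Dtxt gtxt (VLM.fvlm σ θ.1)|) +
            b * Real.sqrt (Real.log (1 / δ) / (N + M)) +
            (1 + Real.log (1 + Bw)) * (Lloss * Real.sqrt (Cvlm / (N + M)) *
              (1 + Real.log (1 + (N + M) / Cvlm)))) ∧
        VLM.risk l Dmul gmul (VLM.fvlm σ θhat) ≤
          (⨅ θ : VLM.paramSet L d k C₂ C₂₁ Bw, VLM.risk l Dmul gmul (VLM.fvlm σ θ.1)) +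
          K * (((N : ℝ) / (N + M)) * (⨆ θ : VLM.paramSet L d k C₂ C₂₁ Bw,
              |VLM.risk l Dmul gmul (VLM.fvlm σ θ.1) - VLM.risk l Dtxt gtxt (VLM.fvlm σ θ.1)|) +
            b * Real.sqrt (Real.log (1 / δ) / (N + M)) +
            (1 + Real.log (1 + Bw)) * (Lloss * Real.sqrt (Cvlm / (N + M)) *
              (1 + Real.log (1 + (N + M) / Cvlm)))) := by
  refine ⟨3000000, 29, by norm_num, ?_⟩
  intro L d k τ N M _ hL hd hN hM C₂ C₂₁ BX Bw hC₂ hC₂₁ hBX hBw Lσ σ hσ hσ0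
  refine ⟨VLM.isCoveringConstant_fvlm hσ hσ0 hC₂ hC₂₁ hBX hBw hL hd hN hM, ?_⟩
  intro Cvlm hCvlm l b Lloss hl hl₁ hl₂ Dtxt Dmul _ _ gtxt gmul hgtxt hgmul hDtxt hDmul Ω _ P _
    Xtxt Xmul hXtxt hXtxti hXmul hXmuli δ hδ hδ1
  obtain ⟨E, hE, hPE, hgood⟩ := VLM.exists_pooled_excess_risk_event hCvlm hBX hBw hN hM
    (VLM.continuous_fvlm hσ.continuous) (fun θ hθ => VLM.abs_fvlm_le hL hθ)
    (fun θ hθ => VLM.exists_neg_fvlm σ hθ) hl hl₁ hl₂ Dtxt Dmul hgtxt hgmul hDtxt hDmul P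
    hXtxt hXtxti hXmul hXmuli hδ hδ1
  have hNM : (0 : ℝ) < N + M := by
    have : (0 : ℝ) < N := by exact_mod_cast hN
    positivity
  have hgen : 0 ≤ b * Real.sqrt (Real.log (1 / δ) / (N + M)) + (1 + Real.log (1 + Bw)) *
      (Lloss * Real.sqrt (Cvlm / (N + M)) * (1 + Real.log (1 + (N + M) / Cvlm))) := by
    have h0 : 0 ≤ b := (abs_nonneg _).trans (hl 0 0)
    have h1 : 0 ≤ Real.log (1 + Bw) := Real.log_nonneg (by linarith)
    have h2 : 0 ≤ Real.log (1 + ((N : ℝ) + M) / Cvlm) :=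
      Real.log_nonneg (by linarith [div_nonneg hNM.le (hCvlm.nonneg hBX)])
    positivity
  refine ⟨E, hE, hPE, fun ω hω θhat hθhat hmin => ?_⟩
  have hpool := hgood ω hω θhat hθhat hmin
  constructor
  · have h := VLM.excess_risk_le (R := fun θ => VLM.risk l Dtxt gtxt (VLM.fvlm σ θ))
      (R' := fun θ => VLM.risk l Dmul gmul (VLM.fvlm σ θ)) (K := 3000000) (Nat.cast_nonneg M) hNM
      (fun θ => VLM.abs_risk_le hl Dtxt _ _) (fun θ => VLM.abs_risk_le hl Dmul _ _) hgen
      (by norm_num) hθhat hpool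
    rwa [← add_assoc] at h
  · have h := VLM.excess_risk_le (R := fun θ => VLM.risk l Dmul gmul (VLM.fvlm σ θ))
      (R' := fun θ => VLM.risk l Dtxt gtxt (VLM.fvlm σ θ)) (N := M) (K := 3000000)
      (Nat.cast_nonneg N) (by linarith)
      (fun θ => VLM.abs_risk_le hl Dmul _ _) (fun θ => VLM.abs_risk_le hl Dtxt _ _) hgen
      (by norm_num) hθhat fun θ hθ => by
        have := hpool θ hθ
        linarith
    simp_rw [abs_sub_comm (VLM.risk l Dmul gmul _)]
    rwa [← add_assoc, add_comm (M : ℝ) N] at h
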